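/- **Theories.** All theories are theories of classical first-order logic without primitive equality, with $\neg,\vee,\forall$ as primitive connectives; $\vdash$ is derivability, and the axioms below stand for their universal closures. *ZFU* (Zermelo–Fraenkel set theory with urelements and choice) has a unary predicate $S$ ("is a set") and binary predicates $\in$ and $=$. Its axioms: $=$ is reflexive and substitutive for all formulas; $x\in y\Rightarrow S(y)$; extensionality for sets; pairing, union, power set, separation (schema), infinity, regularity, replacement (schema), and choice (every set of pairwise disjoint non-empty sets has a choice set). *$\mathcal Q$* (quasi-set theory) has unary predicates $m,M,Z$, binary predicates $\equiv,\in$ and a unary function symbol $qc$. Put $Q(x):=\neg(m(x)\vee M(x))$ ($x$ is a quasi-set, qset), $D(x):=M(x)\vee Z(x)$, $E(x):=Q(x)\wedge\forall y(y\in x\Rightarrow Q(y))$, $x\subseteq y:=\forall z(z\in x\Rightarrow z\in y)$, and $$x=_Ey:=(Q(x)\wedge Q(y)\wedge\forall z(z\in x\Leftrightarrow z\in y))\vee(M(x)\wedge M(y)\wedge\forall_Qz(x\in z\Leftrightarrow y\in z)),$$ where $\forall_Q,\exists_Q$ are relativized to $Q$. $[x]$ is the qset of all $t\equiv x$. $\mathrm{Sim}(x,y)$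 says that $z\equiv t$ for all $z\in x$, $t\in y$, and $\mathrm{QSim}(x,y):=\mathrm{Sim}(x,y)\wedge qc(x)=_Eqc(y)$. The elements of $x/{\equiv}$ are the qsets $z$ such that, for some $u\in x$, $z$ consists exactly of the $t\in x$ with $t\equiv u$. **The translation.** For a formula $A$ of ZFU, $A^q$ is defined by: $(S(x))^q$ is $Z(x)$; $(x=y)^q$ is $((M(x)\wedge M(y))\vee(Z(x)\wedge Z(y)))\wedge x=_Ey$; $(x\in y)^q$ is $((M(x)\vee Z(x))\wedge Z(y))\wedge x\in y$; $(\neg B)^q$ is $\neg B^q$; $(B\vee C)^q$ is $B^q\vee C^q$; $(\forall xB)^q$ is $\forall x(M(x)\vee Z(x)\Rightarrow B^q)$. In the axioms of $\mathcal Q$, "cardinal", "$card(x)$", "natural number", $0,1,\le,<$, sum and $2^\alpha$ (the cardinal of the set of functions from $\alpha$ to $2$) mean the $q$-translations of the ZFU definitions; cardinals are initial von Neumann ordinals. **Axioms of $\mathcal Q$.** (Q1–Q3) $\equiv$ is reflexive, symmetric and transitive. (Q4) $x=_Ey\Rightarrow(A(x,x)\Rightarrow A(x,y))$ for every formula $A$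 of $\mathcal Q$. (Q5) $\neg(m(x)\wedge M(x))$. (Q6) $x\in y\Rightarrow Q(y)$. (Q7) $Z(x)\Rightarrow Q(x)$. (Q8) $\forall_Qx(\forall y(y\in x\Rightarrow D(y))\Leftrightarrow Z(x))$. (Q9) $m(x)\wedge x\equiv y\Rightarrow m(y)$; $\;x=_Ey\wedge M(x)\Rightarrow M(y)$; $\;x=_Ey\wedge Z(x)\Rightarrow Z(y)$. (Q10) There is an empty qset $\emptyset$. (Q11) $D(x)\wedge D(y)\wedge x\equiv y\Rightarrow x=_Ey$. (Q12) For all $x,y$ there is a qset whose elements are exactly the $t$ with $t\equiv x$ or $t\equiv y$. (Q13) Separation: for every qset $x$ and formula $A$ there is a qset of exactly the $t\in x$ with $A(t)$. (Q14) If $E(x)$, there is a qset $\bigcup x$ whose elements are exactly the elements of elements of $x$. (Q15) Every qset $x$ has a power qset $\mathcal P(x)$, whose elements are exactly the qsets $t\subseteq x$. (Q16) There is a qset $x$ with $\emptyset\in x$ and $y\cup[y]\in x$ for every qset $y\in x$. (Q17) If $E(x)$ and $x\neq_E\emptyset$, some qset $y\in x$ has no element in common with $x$. (Q18) $\neg Q(x)\Rightarrow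 qc(x)=_E0$. (Q19) For every qset $x$ there is, up to $=_E$, exactly one cardinal $y$ with $y=_Eqc(x)$ and $(Z(x)\Rightarrow y=_Ecard(x))$. (Q20) If the qset $x$ is non-empty, $qc(x)\neq_E0$. (Q21) If $x$ is a qset with $qc(x)=_E\alpha$ and $\beta\le\alpha$ is a cardinal, there is a qset $y\subseteq x$ with $qc(y)=_E\beta$. (Q22) For qsets $y\subseteq x$: $qc(y)\le qc(x)$. (Q23) For qsets $x\subseteq y$ with $x\ne_Ey$ and $qc(x)$ a natural number: $qc(x)<qc(y)$. (Q24) For qsets $x,y$ without common elements: $qc(x\cup y)=_Eqc(x)+qc(y)$. (Q25) For every qset $x$: $qc(\mathcal P(x))=_E2^{qc(x)}$. (Q26) Weak extensionality: for qsets $x,y$, if every $z\in x/{\equiv}$ has a $t\in y/{\equiv}$ with $\mathrm{QSim}(z,t)$ and every $t\in y/{\equiv}$ has a $z\in x/{\equiv}$ with $\mathrm{QSim}(t,z)$, then $x\equiv y$. (Q27) Replacement: for every qset $u$ and formula $A(w,s)$, if every $w\in u$ has an $s$ with $A(w,s)$, and $A(w,s)\wedge A(w',s')\wedge w\equiv w'$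 implies $s\equiv s'$ for all $w,w'\in u$, then there is a qset of exactly the $s$ with $A(w,s)$ for some $w\in u$. (Q28) Choice: for every qset $x$ with $E(x)$ whose elements are non-empty and such that any two of its elements that are not extensionally identical have no common element, there is a qset $u$ such that for all $y\in x$ and $v\in y$ there is a qset $w\subseteq[v]$ with $qc(w)=_E1$ and $w\cap y\equiv w\cap u$. **Theorem 5.** (1) For every closed formula $A$ of ZFU, $\vdash_{ZFU}A$ if and only if $\vdash_{\mathcal Q}A^q$. (2) More generally, for every formula $A$ of ZFU with free variables among $x_0,\dots,x_{n-1}$, $\vdash_{ZFU}A$ if and only if $\vdash_{\mathcal Q}D(x_0)\Rightarrow\cdots\Rightarrow D(x_{n-1})\Rightarrow A^q$. (3) If $\mathcal Q$ is consistent, then so is ZFU. -/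

import Mathlib

namespace QST

/-! ## First-order logic without primitive equality

Variables are de Bruijn indices: `all φ` binds the variable `0` of `φ`, and the variable `n + 1`
of `φ` is the variable `n` of `all φ`. The primitive connectives are negation, disjunction and the
universal quantifier. -/

/-- First-order formulas over the symbols of `L`; there is no primitive equality. -/
inductive Fml (L : FirstOrder.Language.{0, 0}) : Type
  | rel {n : ℕ} (R : L.Relations n) (ts : Fin n → L.Term ℕ) : Fml L
  | neg (φ : Fml L) : Fml L
  | or (φ ψ : Fml L) : Fml L
  | all (φ : Fml L) : Fml L

namespace Fml

variable {L : FirstOrder.Language.{0, 0}}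

def imp (φ ψ : Fml L) : Fml L := or (neg φ) ψ
def and (φ ψ : Fml L) : Fml L := neg (or (neg φ) (neg ψ))
def iff (φ ψ : Fml L) : Fml L := and (imp φ ψ) (imp ψ φ)
def ex (φ : Fml L) : Fml L := neg (all (neg φ))

/-- The action of a substitution under one binder. -/
def up (σ : ℕ → L.Term ℕ) : ℕ → L.Term ℕ
  | 0 => FirstOrder.Language.Term.var 0
  | n + 1 => (σ n).relabel Nat.succ

/-- Simultaneous capture-avoiding substitution of terms for the free variables. -/
def subst : Fml L → (ℕ → L.Term ℕ) → Fml L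
  | rel R ts, σ => rel R (fun i => (ts i).subst σ)
  | neg φ, σ => neg (φ.subst σ)
  | or φ ψ, σ => or (φ.subst σ) (ψ.subst σ)
  | all φ, σ => all (φ.subst (up σ))

/-- Renaming of the free variables. -/
def rename (φ : Fml L) (f : ℕ → ℕ) : Fml L := φ.subst (fun n => FirstOrder.Language.Term.var (f n))

/-- Shift all free variables by one. -/
def lift (φ : Fml L) : Fml L := φ.rename Nat.succ

/-- The result of removing the quantifier of `all φ` and putting `t` for the bound variable. -/
def inst (φ : Fml L) (t : L.Term ℕ) : Fml L :=
  φ.subst (fun n => match n with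
    | 0 => t
    | k + 1 => FirstOrder.Language.Term.var k)

/-- All free variables of the formula are smaller than `n`. -/
def FreeBelow : ℕ → Fml L → Prop
  | n, rel _ ts => ∀ i, ∀ x ∈ (ts i).varFinset, x < n
  | n, neg φ => FreeBelow n φ
  | n, or φ ψ => FreeBelow n φ ∧ FreeBelow n ψ
  | n, all φ => FreeBelow (n + 1) φ

/-- Closed formulas. -/
def IsSentence (φ : Fml L) : Prop := FreeBelow 0 φ

/-- `n`-fold universal quantification. -/
def alls : ℕ → Fml L → Fml L
  | 0, φ => φ
  | n + 1, φ => alls n (all φ)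

end Fml

infixr:60 " ⟶ᶠ " => Fml.imp
infix:58 " ⟷ᶠ " => Fml.iff
infixr:66 " ∧ᶠ " => Fml.and
infixr:64 " ∨ᶠ " => Fml.or
prefix:max "¬ᶠ" => Fml.neg

/-- Derivability in classical first-order logic: Gentzen's natural deduction. -/
inductive Deriv {L : FirstOrder.Language.{0, 0}} : Set (Fml L) → Fml L → Prop
  | hyp {Γ : Set (Fml L)} {φ : Fml L} (h : φ ∈ Γ) : Deriv Γ φ
  | negI {Γ : Set (Fml L)} {φ ψ : Fml L} (h₁ : Deriv (insert φ Γ) ψ)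
      (h₂ : Deriv (insert φ Γ) (¬ᶠ ψ)) : Deriv Γ (¬ᶠ φ)
  | dne {Γ : Set (Fml L)} {φ : Fml L} (h : Deriv Γ (¬ᶠ (¬ᶠ φ))) : Deriv Γ φ
  | orI₁ {Γ : Set (Fml L)} {φ ψ : Fml L} (h : Deriv Γ φ) : Deriv Γ (φ ∨ᶠ ψ)
  | orI₂ {Γ : Set (Fml L)} {φ ψ : Fml L} (h : Deriv Γ ψ) : Deriv Γ (φ ∨ᶠ ψ)
  | orE {Γ : Set (Fml L)} {φ ψ χ : Fml L} (h : Deriv Γ (φ ∨ᶠ ψ)) (h₁ : Deriv (insert φ Γ) χ)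
      (h₂ : Deriv (insert ψ Γ) χ) : Deriv Γ χ
  | allI {Γ : Set (Fml L)} {φ : Fml L} (h : Deriv (Fml.lift '' Γ) φ) : Deriv Γ (Fml.all φ)
  | allE {Γ : Set (Fml L)} {φ : Fml L} (t : L.Term ℕ) (h : Deriv Γ (Fml.all φ)) :
      Deriv Γ (φ.inst t)

/-- A theory proves no contradiction. -/
def Consistent {L : FirstOrder.Language.{0, 0}} (T : Set (Fml L)) : Prop :=
  ¬ ∃ φ : Fml L, Deriv T φ ∧ Deriv T (¬ᶠ φ)

/-- The universal closures of the formulas in `A`. -/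
def univClosures {L : FirstOrder.Language.{0, 0}} (A : Fml L → Prop) : Set (Fml L) :=
  {φ | ∃ ψ n, A ψ ∧ ψ.FreeBelow n ∧ φ = Fml.alls n ψ}

open Fml

/-! ## ZFU: Zermelo-Fraenkel set theory with urelements and choice -/

/-- The predicate symbols of ZFU: `S` (being a set), membership and equality. -/
inductive ZRel : ℕ → Type
  | S : ZRel 1
  | mem : ZRel 2
  | eq : ZRel 2

abbrev LZ : FirstOrder.Language.{0, 0} := ⟨fun _ => Empty, ZRel⟩

namespace ZFU

/-! In this namespace an argument `x : ℕ` stands for the variable with index `x`; it becomes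
`x + 1` under a quantifier. -/

def S (x : ℕ) : Fml LZ := rel (L := LZ) ZRel.S ![FirstOrder.Language.Term.var x]
def mem (x y : ℕ) : Fml LZ :=
  rel (L := LZ) ZRel.mem ![FirstOrder.Language.Term.var x, FirstOrder.Language.Term.var y]
def eq (x y : ℕ) : Fml LZ :=
  rel (L := LZ) ZRel.eq ![FirstOrder.Language.Term.var x, FirstOrder.Language.Term.var y]

/-- `x ⊆ y`. -/
def sub (x y : ℕ) : Fml LZ := all (mem 0 (x + 1) ⟶ᶠ mem 0 (y + 1))

/-- `x` is the empty set, i.e. the number `0`. -/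
def isZero (x : ℕ) : Fml LZ := S x ∧ᶠ all (¬ᶠ (mem 0 (x + 1)))

/-- `x = {∅}`, i.e. the number `1`. -/
def isOne (x : ℕ) : Fml LZ := S x ∧ᶠ all (mem 0 (x + 1) ⟷ᶠ isZero 0)

/-- `x = {∅, {∅}}`, i.e. the number `2`. -/
def isTwo (x : ℕ) : Fml LZ := S x ∧ᶠ all (mem 0 (x + 1) ⟷ᶠ (isZero 0 ∨ᶠ isOne 0))

/-- `z = {a, b}`. -/
def isUPair (z a b : ℕ) : Fml LZ :=
  S z ∧ᶠ all (mem 0 (z + 1) ⟷ᶠ (eq 0 (a + 1) ∨ᶠ eq 0 (b + 1)))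

/-- `p = ⟨a, b⟩ = {{a}, {a, b}}`. -/
def isPair (p a b : ℕ) : Fml LZ :=
  S p ∧ᶠ all (mem 0 (p + 1) ⟷ᶠ (isUPair 0 (a + 1) (a + 1) ∨ᶠ isUPair 0 (a + 1) (b + 1)))

/-- `⟨a, b⟩ ∈ f`. -/
def pairMem (a b f : ℕ) : Fml LZ := ex (mem 0 (f + 1) ∧ᶠ isPair 0 (a + 1) (b + 1))

/-- `z = x ∪ y`. -/
def isUnion (z x y : ℕ) : Fml LZ :=
  S z ∧ᶠ all (mem 0 (z + 1) ⟷ᶠ (mem 0 (x + 1) ∨ᶠ mem 0 (y + 1)))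

/-- `z = x ∪ {x}`. -/
def isSucc (z x : ℕ) : Fml LZ :=
  S z ∧ᶠ all (mem 0 (z + 1) ⟷ᶠ (mem 0 (x + 1) ∨ᶠ eq 0 (x + 1)))

/-- `f` is a function from `x` to `y`. -/
def isFun (f x y : ℕ) : Fml LZ :=
  S f ∧ᶠ
  all (mem 0 (f + 1) ⟶ᶠ
    ex (ex (mem 1 (x + 3) ∧ᶠ mem 0 (y + 3) ∧ᶠ isPair 2 1 0))) ∧ᶠ
  all (mem 0 (x + 1) ⟶ᶠ
    ex (pairMem 1 0 (f + 2) ∧ᶠ all (pairMem 2 0 (f + 3) ⟶ᶠ eq 0 1)))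

/-- The sets `x` and `y` are equinumerous: there is a function from `x` to `y` that takes each
value in `y` exactly once. -/
def equinum (x y : ℕ) : Fml LZ :=
  S x ∧ᶠ S y ∧ᶠ
  ex (isFun 0 (x + 1) (y + 1) ∧ᶠ
    all (mem 0 (y + 2) ⟶ᶠ
      ex (pairMem 0 1 2 ∧ᶠ all (pairMem 0 2 3 ⟶ᶠ eq 0 1))))

/-- `x` is a von Neumann ordinal: a transitive set of sets that is linearly ordered by membership
(the order is a well-order by regularity). -/
def isOrd (x : ℕ) : Fml LZ :=
  S x ∧ᶠ
  all (mem 0 (x + 1) ⟶ᶠ (S 0 ∧ᶠ sub 0 (x + 1))) ∧ᶠ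
  all (all ((mem 1 (x + 2) ∧ᶠ mem 0 (x + 2)) ⟶ᶠ (mem 1 0 ∨ᶠ eq 1 0 ∨ᶠ mem 0 1)))

/-- `x` is a cardinal: an ordinal that is not equinumerous with any of its elements. -/
def isCardinal (x : ℕ) : Fml LZ :=
  isOrd x ∧ᶠ all (mem 0 (x + 1) ⟶ᶠ ¬ᶠ (equinum 0 (x + 1)))

/-- `y` is the cardinal of the set `x`. -/
def isCardOf (y x : ℕ) : Fml LZ := isCardinal y ∧ᶠ equinum x y

/-- `x` is a natural number: an ordinal such that it and all its elements are zero or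
successors. -/
def isNat (x : ℕ) : Fml LZ :=
  isOrd x ∧ᶠ
  all ((mem 0 (x + 1) ∨ᶠ eq 0 (x + 1)) ⟶ᶠ (isZero 0 ∨ᶠ ex (isSucc 1 0)))

/-- `a < b` for cardinals (as ordinals). -/
def cardLt (a b : ℕ) : Fml LZ := isCardinal a ∧ᶠ isCardinal b ∧ᶠ mem a b

/-- `a ≤ b` for cardinals (as ordinals). -/
def cardLe (a b : ℕ) : Fml LZ :=
  isCardinal a ∧ᶠ isCardinal b ∧ᶠ (mem a b ∨ᶠ eq a b)

/-- `c = a + b` for cardinals: `c` is the cardinal of the union of two disjoint sets that have the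
cardinals `a` and `b`. -/
def isCardSum (c a b : ℕ) : Fml LZ :=
  ex (ex (ex (isCardOf (a + 3) 2 ∧ᶠ isCardOf (b + 3) 1 ∧ᶠ
    all (¬ᶠ (mem 0 3 ∧ᶠ mem 0 2)) ∧ᶠ isUnion 0 2 1 ∧ᶠ isCardOf (c + 3) 0)))

/-- `c = 2 ^ a` for cardinals: `c` is the cardinal of the set of all functions from `a` to `2`. -/
def isCardPow (c a : ℕ) : Fml LZ :=
  isCardinal a ∧ᶠ
  ex (isTwo 0 ∧ᶠ ex (S 0 ∧ᶠ all (mem 0 1 ⟷ᶠ isFun 0 (a + 3) 2) ∧ᶠ isCardOf (c + 2) 0))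

/-- The axioms of ZFU, up to universal closure. -/
inductive Ax : Fml LZ → Prop
  /-- Equality is reflexive. -/
  | eqRefl : Ax (all (eq 0 0))
  /-- Substitutivity of equality: `∀ x y, x = y → (A(x, x) → A(x, y))`. The variables `1` and `0`
  of `A` stand for the first and the second place; other variables are parameters. -/
  | eqSubst (A : Fml LZ) :
      Ax (all (all (eq 1 0 ⟶ᶠ
        (A.rename (fun n => match n with
          | 0 => 1
          | k + 1 => k + 1) ⟶ᶠ A))))
  /-- Only sets have elements. -/
  | memSet : Ax (all (all (mem 1 0 ⟶ᶠ S 0)))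
  /-- Extensionality for sets. -/
  | ext : Ax (all (all ((S 1 ∧ᶠ S 0 ∧ᶠ all (mem 0 2 ⟷ᶠ mem 0 1)) ⟶ᶠ eq 1 0)))
  /-- Pairing. -/
  | pairing : Ax (all (all (ex (isUPair 0 2 1))))
  /-- Union. -/
  | union : Ax (all (S 0 ⟶ᶠ
      ex (S 0 ∧ᶠ all (mem 0 1 ⟷ᶠ ex (mem 1 0 ∧ᶠ mem 0 3)))))
  /-- Power set. -/
  | power : Ax (all (S 0 ⟶ᶠ ex (S 0 ∧ᶠ all (mem 0 1 ⟷ᶠ (S 0 ∧ᶠ sub 0 2)))))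
  /-- Separation for `A(t)`; `t` is the variable `0` of `A`, the other variables are
  parameters (with `1` for the given set). -/
  | separation (A : Fml LZ) :
      Ax (all (S 0 ⟶ᶠ ex (S 0 ∧ᶠ all (mem 0 1 ⟷ᶠ (mem 0 2 ∧ᶠ
        A.rename (fun n => match n with
          | 0 => 0
          | k + 1 => k + 2))))))
  /-- Infinity. -/
  | infinity : Ax (ex (S 0 ∧ᶠ ex (isZero 0 ∧ᶠ mem 0 1) ∧ᶠ
      all (mem 0 1 ⟶ᶠ ex (isSucc 0 1 ∧ᶠ mem 0 2))))
  /-- Regularity. -/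
  | regularity : Ax (all ((S 0 ∧ᶠ ex (mem 0 1)) ⟶ᶠ
      ex (mem 0 1 ∧ᶠ all (¬ᶠ (mem 0 1 ∧ᶠ mem 0 2)))))
  /-- Replacement for `A(w, s)`; `w` and `s` are the variables `1` and `0` of `A`, the other
  variables are parameters (with `2` for the given set `u`): if for every `w ∈ u` there is exactly
  one `s` with `A(w, s)`, then the `s` with `A(w, s)` for some `w ∈ u` form a set. -/
  | replacement (A : Fml LZ) :
      Ax (all ((S 0 ∧ᶠ
        all (mem 0 1 ⟶ᶠ ex (A ∧ᶠ
          all (A.rename (fun n => match n with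
            | 0 => 0
            | k + 1 => k + 2) ⟶ᶠ eq 0 1)))) ⟶ᶠ
        ex (S 0 ∧ᶠ all (mem 0 1 ⟷ᶠ ex (mem 0 3 ∧ᶠ
          A.rename (fun n => match n with
            | 0 => 1
            | 1 => 0
            | k + 2 => k + 3))))))
  /-- Choice: every set of pairwise disjoint non-empty sets has a choice set. -/
  | choice : Ax (all ((S 0 ∧ᶠ
      all (mem 0 1 ⟶ᶠ (S 0 ∧ᶠ ex (mem 0 1))) ∧ᶠ
      all (all ((mem 1 2 ∧ᶠ mem 0 2 ∧ᶠ ¬ᶠ (eq 1 0)) ⟶ᶠ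
        all (¬ᶠ (mem 0 2 ∧ᶠ mem 0 1))))) ⟶ᶠ
      ex (S 0 ∧ᶠ all (mem 0 2 ⟶ᶠ
        ex (all ((mem 0 2 ∧ᶠ mem 0 3) ⟷ᶠ eq 0 1))))))

/-- The theory ZFU. -/
def theory : Set (Fml LZ) := univClosures Ax

end ZFU

/-! ## The language of quasi-set theory -/

/-- The predicate symbols of quasi-set theory: `m` (micro-atoms), `M` (macro-atoms),
`Z` (sets), indistinguishability and membership. -/
inductive QRel : ℕ → Type
  | m : QRel 1
  | M : QRel 1
  | Z : QRel 1
  | ind : QRel 2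
  | mem : QRel 2

/-- The only function symbol: the quasi-cardinal. -/
inductive QFun : ℕ → Type
  | qc : QFun 1

abbrev LQ : FirstOrder.Language.{0, 0} := ⟨QFun, QRel⟩

namespace Qset

/-- Terms of quasi-set theory. -/
abbrev Tm : Type := LQ.Term ℕ

/-- The variable with index `n`. -/
def v (n : ℕ) : Tm := FirstOrder.Language.Term.var n

/-- The quasi-cardinal of `t`. -/
def qc (t : Tm) : Tm := FirstOrder.Language.Term.func (L := LQ) QFun.qc ![t]

/-- Shift of the variables of a term under one binder. -/
def sh (t : Tm) : Tm := t.relabel Nat.succ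

def m (x : Tm) : Fml LQ := rel (L := LQ) QRel.m ![x]
def M (x : Tm) : Fml LQ := rel (L := LQ) QRel.M ![x]
def Z (x : Tm) : Fml LQ := rel (L := LQ) QRel.Z ![x]
/-- `x ≡ y`. -/
def ind (x y : Tm) : Fml LQ := rel (L := LQ) QRel.ind ![x, y]
/-- `x ∈ y`. -/
def mem (x y : Tm) : Fml LQ := rel (L := LQ) QRel.mem ![x, y]

/-- `x` is a quasi-set. -/
def Q (x : Tm) : Fml LQ := ¬ᶠ (m x ∨ᶠ M x)

/-- `x` is a classical thing (a Ding). -/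
def D (x : Tm) : Fml LQ := M x ∨ᶠ Z x

/-- `∀_Q`: for all quasi-sets. -/
def allQ (φ : Fml LQ) : Fml LQ := all (Q (v 0) ⟶ᶠ φ)

/-- `∃_Q`: there is a quasi-set. -/
def exQ (φ : Fml LQ) : Fml LQ := ex (Q (v 0) ∧ᶠ φ)

/-- `x` is a quasi-set all of whose elements are quasi-sets. -/
def E (x : Tm) : Fml LQ := Q x ∧ᶠ all (mem (v 0) (sh x) ⟶ᶠ Q (v 0))

/-- Extensional identity. -/
def eqE (x y : Tm) : Fml LQ :=
  (Q x ∧ᶠ Q y ∧ᶠ all (mem (v 0) (sh x) ⟷ᶠ mem (v 0) (sh y))) ∨ᶠ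
  (M x ∧ᶠ M y ∧ᶠ allQ (mem (sh x) (v 0) ⟷ᶠ mem (sh y) (v 0)))

/-- `x ⊆ y`. -/
def sub (x y : Tm) : Fml LQ := all (mem (v 0) (sh x) ⟶ᶠ mem (v 0) (sh y))

/-- `x =_E ∅`. -/
def isEmpty (x : Tm) : Fml LQ := Q x ∧ᶠ all (¬ᶠ (mem (v 0) (sh x)))

/-- `x ∩ y =_E ∅`. -/
def disj (x y : Tm) : Fml LQ := all (¬ᶠ (mem (v 0) (sh x) ∧ᶠ mem (v 0) (sh y)))

/-- `z` is the union `x ∪ y`. -/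
def isUnion (z x y : Tm) : Fml LQ :=
  Q z ∧ᶠ all (mem (v 0) (sh z) ⟷ᶠ (mem (v 0) (sh x) ∨ᶠ mem (v 0) (sh y)))

/-- `z` is the intersection `x ∩ y`. -/
def isInter (z x y : Tm) : Fml LQ :=
  Q z ∧ᶠ all (mem (v 0) (sh z) ⟷ᶠ (mem (v 0) (sh x) ∧ᶠ mem (v 0) (sh y)))

/-- `z` is `x ∪ [x]`, where `[x]` consists of the indistinguishable from `x`. -/
def isSucc (z x : Tm) : Fml LQ :=
  Q z ∧ᶠ all (mem (v 0) (sh z) ⟷ᶠ (mem (v 0) (sh x) ∨ᶠ ind (v 0) (sh x)))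

/-- `z` is the quasi-set of all sub-quasi-sets of `x`. -/
def isPower (z x : Tm) : Fml LQ :=
  Q z ∧ᶠ all (mem (v 0) (sh z) ⟷ᶠ (Q (v 0) ∧ᶠ sub (v 0) (sh x)))

/-- `z` is an element of the quotient of `x` by indistinguishability. -/
def isClass (z x : Tm) : Fml LQ :=
  Q z ∧ᶠ ex (mem (v 0) (sh x) ∧ᶠ
    all (mem (v 0) (sh (sh z)) ⟷ᶠ (mem (v 0) (sh (sh x)) ∧ᶠ ind (v 0) (v 1))))

/-- `x` and `y` are similar: all their elements are indistinguishable. -/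
def Sim (x y : Tm) : Fml LQ :=
  all (all ((mem (v 1) (sh (sh x)) ∧ᶠ mem (v 0) (sh (sh y))) ⟶ᶠ ind (v 1) (v 0)))

/-- `x` and `y` are similar and have the same quasi-cardinal. -/
def QSim (x y : Tm) : Fml LQ := Sim x y ∧ᶠ eqE (qc x) (qc y)

/-! ### The translation of ZFU -/

/-- Terms of ZFU are variables, and variables are kept. -/
def trTerm : LZ.Term ℕ → Tm
  | FirstOrder.Language.Term.var n => FirstOrder.Language.Term.var n
  | FirstOrder.Language.Term.func f _ => Empty.elim f

/-- The translation `A ↦ A^q`. -/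
def tr : Fml LZ → Fml LQ
  | .rel (n := 1) ZRel.S ts => Z (trTerm (ts 0))
  | .rel (n := 2) ZRel.eq ts =>
      ((M (trTerm (ts 0)) ∧ᶠ M (trTerm (ts 1))) ∨ᶠ (Z (trTerm (ts 0)) ∧ᶠ Z (trTerm (ts 1)))) ∧ᶠ
        eqE (trTerm (ts 0)) (trTerm (ts 1))
  | .rel (n := 2) ZRel.mem ts =>
      ((M (trTerm (ts 0)) ∨ᶠ Z (trTerm (ts 0))) ∧ᶠ Z (trTerm (ts 1))) ∧ᶠ
        mem (trTerm (ts 0)) (trTerm (ts 1))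
  | .neg A => ¬ᶠ (tr A)
  | .or A B => tr A ∨ᶠ tr B
  | .all A => all ((M (v 0) ∨ᶠ Z (v 0)) ⟶ᶠ tr A)

/-- The notion of the classical part of quasi-set theory that is given by the ZFU-formula `A`,
said of the terms `ts` (the `i`-th term for the variable `i` of `A`). -/
def cl (A : Fml LZ) (ts : List Tm) : Fml LQ := (tr A).subst (fun i => ts.getD i (v i))

/-- `x` is a finite quasi-set: its quasi-cardinal is a natural number. -/
def isFin (x : Tm) : Fml LQ := Q x ∧ᶠ cl (ZFU.isNat 0) [qc x]

/-! ### The axioms of quasi-set theory -/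

/-- The axioms of quasi-set theory, up to universal closure. -/
inductive Ax : Fml LQ → Prop
  | q1 : Ax (all (ind (v 0) (v 0)))
  | q2 : Ax (all (all (ind (v 1) (v 0) ⟶ᶠ ind (v 0) (v 1))))
  | q3 : Ax (all (all (all ((ind (v 2) (v 1) ∧ᶠ ind (v 1) (v 0)) ⟶ᶠ ind (v 2) (v 0)))))
  /-- Substitutivity of extensional identity: `∀ x y, x =_E y → (A(x, x) → A(x, y))`. -/
  | q4 (A : Fml LQ) :
      Ax (all (all (eqE (v 1) (v 0) ⟶ᶠ
        (A.rename (fun n => match n with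
          | 0 => 1
          | k + 1 => k + 1) ⟶ᶠ A))))
  | q5 : Ax (all (¬ᶠ (m (v 0) ∧ᶠ M (v 0))))
  | q6 : Ax (all (all (mem (v 1) (v 0) ⟶ᶠ Q (v 0))))
  | q7 : Ax (all (Z (v 0) ⟶ᶠ Q (v 0)))
  | q8 : Ax (allQ (all (mem (v 0) (v 1) ⟶ᶠ D (v 0)) ⟷ᶠ Z (v 0)))
  | q9 : Ax (all (all ((m (v 1) ∧ᶠ ind (v 1) (v 0)) ⟶ᶠ m (v 0))) ∧ᶠ
      all (all ((eqE (v 1) (v 0) ∧ᶠ M (v 1)) ⟶ᶠ M (v 0))) ∧ᶠ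
      all (all ((eqE (v 1) (v 0) ∧ᶠ Z (v 1)) ⟶ᶠ Z (v 0))))
  /-- The empty quasi-set. -/
  | q10 : Ax (exQ (all (¬ᶠ (mem (v 0) (v 1)))))
  | q11 : Ax (all (D (v 0) ⟶ᶠ all (D (v 0) ⟶ᶠ (ind (v 1) (v 0) ⟶ᶠ eqE (v 1) (v 0)))))
  /-- Weak pairs. -/
  | q12 : Ax (all (all (exQ (all (mem (v 0) (v 1) ⟷ᶠ (ind (v 0) (v 3) ∨ᶠ ind (v 0) (v 2)))))))
  /-- Separation for `A(t)`; `t` is the variable `0` of `A`. -/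
  | q13 (A : Fml LQ) :
      Ax (allQ (exQ (all (mem (v 0) (v 1) ⟷ᶠ (mem (v 0) (v 2) ∧ᶠ
        A.rename (fun n => match n with
          | 0 => 0
          | k + 1 => k + 2))))))
  /-- Union. -/
  | q14 : Ax (allQ (E (v 0) ⟶ᶠ
      exQ (all (mem (v 0) (v 1) ⟷ᶠ ex (mem (v 1) (v 0) ∧ᶠ mem (v 0) (v 3))))))
  /-- Power quasi-set. -/
  | q15 : Ax (allQ (ex (isPower (v 0) (v 1))))
  /-- Infinity. -/
  | q16 : Ax (exQ (ex (isEmpty (v 0) ∧ᶠ mem (v 0) (v 1)) ∧ᶠ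
      all ((mem (v 0) (v 1) ∧ᶠ Q (v 0)) ⟶ᶠ ex (isSucc (v 0) (v 1) ∧ᶠ mem (v 0) (v 2)))))
  /-- Regularity. -/
  | q17 : Ax (allQ ((E (v 0) ∧ᶠ ¬ᶠ (isEmpty (v 0))) ⟶ᶠ
      exQ (mem (v 0) (v 1) ∧ᶠ disj (v 0) (v 1))))
  | q18 : Ax (all (¬ᶠ (Q (v 0)) ⟶ᶠ isEmpty (qc (v 0))))
  /-- The quasi-cardinal is a cardinal of the classical part, unique up to extensional identity;
  for a set it is its cardinal. -/
  | q19 : Ax (allQ (ex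
      ((cl (ZFU.isCardinal 0) [v 0] ∧ᶠ eqE (v 0) (qc (v 1)) ∧ᶠ
        (Z (v 1) ⟶ᶠ cl (ZFU.isCardOf 0 1) [v 0, v 1])) ∧ᶠ
      all ((cl (ZFU.isCardinal 0) [v 0] ∧ᶠ eqE (v 0) (qc (v 2)) ∧ᶠ
        (Z (v 2) ⟶ᶠ cl (ZFU.isCardOf 0 1) [v 0, v 2])) ⟶ᶠ eqE (v 0) (v 1)))))
  | q20 : Ax (allQ (¬ᶠ (isEmpty (v 0)) ⟶ᶠ ¬ᶠ (isEmpty (qc (v 0)))))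
  /-- Every cardinal `β ≤ α` is the quasi-cardinal of a sub-quasi-set, where `α = qc(x)`. -/
  | q21 : Ax (allQ (all (eqE (qc (v 1)) (v 0) ⟶ᶠ
      all (cl (ZFU.cardLe 0 1) [v 0, v 1] ⟶ᶠ
        exQ (sub (v 0) (v 3) ∧ᶠ eqE (qc (v 0)) (v 1))))))
  | q22 : Ax (allQ (allQ (sub (v 0) (v 1) ⟶ᶠ cl (ZFU.cardLe 0 1) [qc (v 0), qc (v 1)])))
  | q23 : Ax (allQ (allQ
      ((isFin (v 1) ∧ᶠ sub (v 1) (v 0) ∧ᶠ ¬ᶠ (eqE (v 1) (v 0))) ⟶ᶠ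
        cl (ZFU.cardLt 0 1) [qc (v 1), qc (v 0)])))
  | q24 : Ax (allQ (allQ
      (all (¬ᶠ (mem (v 0) (v 2)) ∨ᶠ ¬ᶠ (mem (v 0) (v 1))) ⟶ᶠ
        ex (isUnion (v 0) (v 2) (v 1) ∧ᶠ
          cl (ZFU.isCardSum 0 1 2) [qc (v 0), qc (v 2), qc (v 1)]))))
  | q25 : Ax (allQ (ex (isPower (v 0) (v 1) ∧ᶠ
      cl (ZFU.isCardPow 0 1) [qc (v 0), qc (v 1)])))
  /-- Weak extensionality. -/
  | q26 : Ax (allQ (allQ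
      ((all (isClass (v 0) (v 2) ⟶ᶠ ex (isClass (v 0) (v 2) ∧ᶠ QSim (v 1) (v 0))) ∧ᶠ
        all (isClass (v 0) (v 1) ⟶ᶠ ex (isClass (v 0) (v 3) ∧ᶠ QSim (v 1) (v 0)))) ⟶ᶠ
      ind (v 1) (v 0))))
  /-- Replacement for `A(w, s)`; `w` and `s` are the variables `1` and `0` of `A`, the other
  variables are parameters (with `2` for the given quasi-set `u`): if for every `w ∈ u` there is
  an `s` with `A(w, s)`, and if `s ≡ s'` whenever `A(w, s)` and `A(w', s')` with `w ≡ w'` in `u`,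
  then the `s` with `A(w, s)` for some `w ∈ u` form a quasi-set. -/
  | q27 (A : Fml LQ) :
      Ax (allQ (
        (all (mem (v 0) (v 1) ⟶ᶠ ex A) ∧ᶠ
          all (all ((mem (v 1) (v 2) ∧ᶠ mem (v 0) (v 2)) ⟶ᶠ all (all
            ((A.rename (fun n => match n with
                | 0 => 1
                | 1 => 3
                | k + 2 => k + 4) ∧ᶠ
              A.rename (fun n => match n with
                | 0 => 0
                | 1 => 2
                | k + 2 => k + 4) ∧ᶠ
              ind (v 3) (v 2)) ⟶ᶠ ind (v 1) (v 0)))))) ⟶ᶠ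
        exQ (all (mem (v 0) (v 1) ⟷ᶠ ex (mem (v 0) (v 3) ∧ᶠ
          A.rename (fun n => match n with
            | 0 => 1
            | 1 => 0
            | k + 2 => k + 3))))))
  /-- Choice. Here `[t]` is the quasi-set of the indistinguishable from `t`, so `w ⊆ [t]` says
  that all elements of `w` are indistinguishable from `t`. -/
  | q28 : Ax (allQ (
      (E (v 0) ∧ᶠ all (all ((mem (v 1) (v 2) ∧ᶠ mem (v 0) (v 2)) ⟶ᶠ
        ((¬ᶠ (eqE (v 1) (v 0)) ⟶ᶠ disj (v 1) (v 0)) ∧ᶠ ¬ᶠ (isEmpty (v 1)))))) ⟶ᶠ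
      exQ (all (all ((mem (v 1) (v 3) ∧ᶠ mem (v 0) (v 1)) ⟶ᶠ
        exQ (all (mem (v 0) (v 1) ⟶ᶠ ind (v 0) (v 2)) ∧ᶠ
          cl (ZFU.isOne 0) [qc (v 0)] ∧ᶠ
          ex (ex (isInter (v 1) (v 2) (v 4) ∧ᶠ isInter (v 0) (v 2) (v 5) ∧ᶠ
            ind (v 1) (v 0)))))))))

/-- Quasi-set theory. -/
def theory : Set (Fml LQ) := univClosures Ax

/-- `D(x₀) → … → D(xₙ₋₁) → φ`, where `xᵢ` is the variable `i`. -/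
def relD : ℕ → Fml LQ → Fml LQ
  | 0, φ => φ
  | n + 1, φ => relD n (D (v n) ⟶ᶠ φ)

end Qset

end QST

set_option autoImplicit false

namespace QST

/-! ## Semantics, soundness and completeness -/

section Logic

variable {L : FirstOrder.Language.{0, 0}}

/-- The assignment `e` with `a` put in front. -/
def cons {X : Type} (a : X) (e : ℕ → X) : ℕ → X
  | 0 => a
  | n + 1 => e n

@[simp] theorem cons_zero {X : Type} (a : X) (e : ℕ → X) : cons a e 0 = a := rfl
@[simp] theorem cons_succ {X : Type} (a : X) (e : ℕ → X) (n : ℕ) : cons a e (n + 1) = e n := rfl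
theorem cons_tail {X : Type} (e : ℕ → X) : cons (e 0) (fun n => e (n + 1)) = e := by
  funext n; cases n <;> rfl

/-- Truth of a formula in a structure under an assignment. -/
def Sat {X : Type} [L.Structure X] : Fml L → (ℕ → X) → Prop
  | .rel R ts, e => FirstOrder.Language.Structure.RelMap R (fun i => (ts i).realize e)
  | .neg φ, e => ¬ Sat φ e
  | .or φ ψ, e => Sat φ e ∨ Sat ψ e
  | .all φ, e => ∀ a, Sat φ (cons a e)

section
variable {X : Type} [L.Structure X] (φ ψ : Fml L) (e : ℕ → X)

@[simp] theorem sat_neg : Sat (¬ᶠ φ) e ↔ ¬ Sat φ e := Iff.rfl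
@[simp] theorem sat_or : Sat (φ ∨ᶠ ψ) e ↔ Sat φ e ∨ Sat ψ e := Iff.rfl
@[simp] theorem sat_all : Sat (Fml.all φ) e ↔ ∀ a, Sat φ (cons a e) := Iff.rfl
@[simp] theorem sat_imp : Sat (φ ⟶ᶠ ψ) e ↔ (Sat φ e → Sat ψ e) := by
  simp only [Fml.imp, sat_neg, sat_or]; tauto
@[simp] theorem sat_and : Sat (φ ∧ᶠ ψ) e ↔ (Sat φ e ∧ Sat ψ e) := by
  simp only [Fml.and, sat_neg, sat_or]; tauto
@[simp] theorem sat_iff : Sat (φ ⟷ᶠ ψ) e ↔ (Sat φ e ↔ Sat ψ e) := by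
  simp only [Fml.iff, sat_and, sat_imp]; tauto
@[simp] theorem sat_ex : Sat (Fml.ex φ) e ↔ ∃ a, Sat φ (cons a e) := by
  simp [Fml.ex]

end

theorem sat_subst {X : Type} [L.Structure X] (φ : Fml L) :
    ∀ (σ : ℕ → L.Term ℕ) (e : ℕ → X),
      Sat (φ.subst σ) e ↔ Sat φ (fun n => (σ n).realize e) := by
  induction φ with
  | rel R ts => intro σ e; simp [Fml.subst, Sat, FirstOrder.Language.Term.realize_subst]
  | neg φ ih => intro σ e; simp [Fml.subst, ih]
  | or φ ψ ih₁ ih₂ => intro σ e; simp [Fml.subst, ih₁, ih₂]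
  | all φ ih =>
    intro σ e
    simp only [Fml.subst, sat_all, ih]
    refine forall_congr' fun a => ?_
    have : (fun n => (Fml.up σ n).realize (cons a e)) = cons a (fun n => (σ n).realize e) := by
      funext n
      cases n with
      | zero => rfl
      | succ n => simp [Fml.up, FirstOrder.Language.Term.realize_relabel]; rfl
    rw [this]

theorem sat_rename {X : Type} [L.Structure X] (φ : Fml L) (f : ℕ → ℕ) (e : ℕ → X) :
    Sat (φ.rename f) e ↔ Sat φ (fun n => e (f n)) := by
  simp [Fml.rename, sat_subst]

theorem sat_lift {X : Type} [L.Structure X] (φ : Fml L) (a : X) (e : ℕ → X) :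
    Sat φ.lift (cons a e) ↔ Sat φ e := by
  simp [Fml.lift, sat_rename]

theorem sat_inst {X : Type} [L.Structure X] (φ : Fml L) (t : L.Term ℕ) (e : ℕ → X) :
    Sat (φ.inst t) e ↔ Sat φ (cons (t.realize e) e) := by
  rw [Fml.inst, sat_subst]
  refine iff_of_eq (congrArg _ ?_)
  funext n
  cases n <;> rfl

theorem realize_congr {X : Type} [L.Structure X] {t : L.Term ℕ} {e e' : ℕ → X}
    (h : ∀ x ∈ t.varFinset, e x = e' x) : t.realize e = t.realize e' := by
  induction t with
  | var x => exact h x (by simp [FirstOrder.Language.Term.varFinset])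
  | func f ts ih =>
    simp only [FirstOrder.Language.Term.realize]
    congr 1
    funext i
    exact ih i fun x hx => h x (by simp only [FirstOrder.Language.Term.varFinset, Finset.mem_biUnion]; exact ⟨i, by simp, hx⟩)

theorem sat_congr {X : Type} [L.Structure X] (φ : Fml L) :
    ∀ {n : ℕ} {e e' : ℕ → X}, φ.FreeBelow n → (∀ k < n, e k = e' k) → (Sat φ e ↔ Sat φ e') := by
  induction φ with
  | rel R ts =>
    intro n e e' hf h
    have : (fun i => (ts i).realize e) = fun i => (ts i).realize e' :=
      funext fun i => realize_congr fun x hx => h x (hf i x hx)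
    simp only [Sat, this]
  | neg φ ih => intro n e e' hf h; simp only [sat_neg, ih hf h]
  | or φ ψ ih₁ ih₂ => intro n e e' hf h; simp only [sat_or, ih₁ hf.1 h, ih₂ hf.2 h]
  | all φ ih =>
    intro n e e' hf h
    refine forall_congr' fun a => ih hf fun k hk => ?_
    cases k with
    | zero => rfl
    | succ k => exact h k (by omega)

theorem Fml.FreeBelow.mono {φ : Fml L} : ∀ {m n : ℕ}, φ.FreeBelow m → m ≤ n → φ.FreeBelow n := by
  induction φ with
  | rel R ts => intro m n h hmn i x hx; exact (h i x hx).trans_le hmn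
  | neg φ ih => intro m n h hmn; exact ih (m := m) h hmn
  | or φ ψ ih₁ ih₂ => intro m n h hmn; exact ⟨ih₁ h.1 hmn, ih₂ h.2 hmn⟩
  | all φ ih => intro m n h hmn; exact ih (m := m + 1) h (by omega)

theorem Fml.exists_freeBelow (φ : Fml L) : ∃ n, φ.FreeBelow n := by
  induction φ with
  | rel R ts =>
    refine ⟨(Finset.univ.biUnion fun i => (ts i).varFinset).sup id + 1, fun i x hx => ?_⟩
    exact Nat.lt_succ_of_le (Finset.le_sup (f := id) (Finset.mem_biUnion.2 ⟨i, by simp, hx⟩))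
  | neg φ ih => exact ih
  | or φ ψ ih₁ ih₂ =>
    obtain ⟨m, hm⟩ := ih₁
    obtain ⟨n, hn⟩ := ih₂
    exact ⟨max m n, hm.mono (le_max_left _ _), hn.mono (le_max_right _ _)⟩
  | all φ ih =>
    obtain ⟨m, hm⟩ := ih
    exact ⟨m, hm.mono (Nat.le_succ m)⟩

theorem Fml.freeBelow_alls {φ : Fml L} : ∀ {n k : ℕ}, φ.FreeBelow (k + n) →
    (Fml.alls n φ).FreeBelow k
  | 0, _, h => h
  | n + 1, k, h => Fml.freeBelow_alls (φ := Fml.all φ) (n := n) (by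
      rw [Fml.FreeBelow]; exact h)

/-! ### Substitution -/

theorem term_subst_subst (t : L.Term ℕ) (σ τ : ℕ → L.Term ℕ) :
    (t.subst σ).subst τ = t.subst fun n => (σ n).subst τ := by
  induction t with
  | var x => rfl
  | func f ts ih => simp [FirstOrder.Language.Term.subst, ih]

theorem term_relabel_eq_subst (t : L.Term ℕ) (f : ℕ → ℕ) :
    t.relabel f = t.subst fun n => FirstOrder.Language.Term.var (f n) := by
  induction t with
  | var x => rfl
  | func f ts ih => simp [FirstOrder.Language.Term.subst, FirstOrder.Language.Term.relabel, ih]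

theorem term_subst_var (t : L.Term ℕ) : t.subst FirstOrder.Language.Term.var = t := by
  induction t with
  | var x => rfl
  | func f ts ih => simp [FirstOrder.Language.Term.subst, ih]

theorem term_subst_congr {t : L.Term ℕ} {σ τ : ℕ → L.Term ℕ}
    (h : ∀ x ∈ t.varFinset, σ x = τ x) : t.subst σ = t.subst τ := by
  induction t with
  | var x => exact h x (by simp [FirstOrder.Language.Term.varFinset])
  | func f ts ih =>
    simp only [FirstOrder.Language.Term.subst]
    congr 1
    funext i
    exact ih i fun x hx => h x (by simp only [FirstOrder.Language.Term.varFinset, Finset.mem_biUnion]; exact ⟨i, by simp, hx⟩)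

namespace Fml

theorem up_comp (σ τ : ℕ → L.Term ℕ) :
    (fun n => (up σ n).subst (up τ)) = up fun n => (σ n).subst τ := by
  funext n
  cases n with
  | zero => rfl
  | succ n =>
    simp only [up, term_relabel_eq_subst, term_subst_subst]
    congr 1
    funext k
    simp [FirstOrder.Language.Term.subst, up, term_relabel_eq_subst]

theorem subst_subst (φ : Fml L) : ∀ σ τ : ℕ → L.Term ℕ,
    (φ.subst σ).subst τ = φ.subst fun n => (σ n).subst τ := by
  induction φ with
  | rel R ts => intro σ τ; simp [subst, term_subst_subst]
  | neg φ ih => intro σ τ; simp [subst, ih]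
  | or φ ψ ih₁ ih₂ => intro σ τ; simp [subst, ih₁, ih₂]
  | all φ ih => intro σ τ; simp only [subst, ih, up_comp]

theorem subst_congr {φ : Fml L} : ∀ {n : ℕ} {σ τ : ℕ → L.Term ℕ}, φ.FreeBelow n →
    (∀ k < n, σ k = τ k) → φ.subst σ = φ.subst τ := by
  induction φ with
  | rel R ts =>
    intro n σ τ hf h
    simp only [subst]
    congr 1
    funext i
    exact term_subst_congr fun x hx => h x (hf i x hx)
  | neg φ ih => intro n σ τ hf h; simp only [subst, ih (n := n) hf h]
  | or φ ψ ih₁ ih₂ => intro n σ τ hf h; simp only [subst, ih₁ hf.1 h, ih₂ hf.2 h]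
  | all φ ih =>
    intro n σ τ hf h
    simp only [subst]
    rw [ih (n := n + 1) hf fun k hk => ?_]
    cases k with
    | zero => rfl
    | succ k => simp only [up, h k (by omega)]

theorem up_var : up (FirstOrder.Language.Term.var : ℕ → L.Term ℕ) = FirstOrder.Language.Term.var := by
  funext n; cases n <;> rfl

theorem subst_var (φ : Fml L) : φ.subst FirstOrder.Language.Term.var = φ := by
  induction φ with
  | rel R ts => simp [subst, term_subst_var]
  | neg φ ih => simp [subst, ih]
  | or φ ψ ih₁ ih₂ => simp [subst, ih₁, ih₂]
  | all φ ih => simp only [subst, up_var, ih]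

theorem lift_subst_up (φ : Fml L) (σ : ℕ → L.Term ℕ) :
    φ.lift.subst (up σ) = (φ.subst σ).lift := by
  simp only [lift, rename, subst_subst]
  congr 1
  funext n
  simp [up, FirstOrder.Language.Term.subst, term_relabel_eq_subst]

theorem inst_subst (φ : Fml L) (t : L.Term ℕ) (σ : ℕ → L.Term ℕ) :
    (φ.inst t).subst σ = (φ.subst (up σ)).inst (t.subst σ) := by
  simp only [inst, subst_subst]
  congr 1
  funext n
  cases n with
  | zero => rfl
  | succ n =>
    simp only [up, term_relabel_eq_subst, term_subst_subst]
    exact (term_subst_var _).symm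

end Fml

/-! ### Derivations -/

namespace Deriv

theorem mono {Γ Δ : Set (Fml L)} {φ : Fml L} (h : Deriv Γ φ) (hs : Γ ⊆ Δ) : Deriv Δ φ := by
  induction h generalizing Δ with
  | hyp h => exact hyp (hs h)
  | negI _ _ ih₁ ih₂ => exact negI (ih₁ (Set.insert_subset_insert hs)) (ih₂ (Set.insert_subset_insert hs))
  | dne _ ih => exact dne (ih hs)
  | orI₁ _ ih => exact orI₁ (ih hs)
  | orI₂ _ ih => exact orI₂ (ih hs)
  | orE _ _ _ ih ih₁ ih₂ =>
    exact orE (ih hs) (ih₁ (Set.insert_subset_insert hs)) (ih₂ (Set.insert_subset_insert hs))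
  | allI _ ih => exact allI (ih (Set.image_mono hs))
  | allE t _ ih => exact allE t (ih hs)

/-- Needed to turn a fresh free variable into a bound one. The quantifier introduction survives
because `up σ` takes the lift of a formula to the lift of its instance under `σ`. -/
theorem subst {Γ : Set (Fml L)} {φ : Fml L} (h : Deriv Γ φ) (σ : ℕ → L.Term ℕ) :
    Deriv ((fun ψ => ψ.subst σ) '' Γ) (φ.subst σ) := by
  induction h generalizing σ with
  | hyp h => exact hyp (Set.mem_image_of_mem _ h)
  | negI _ _ ih₁ ih₂ =>
    have h₁ := ih₁ σ
    have h₂ := ih₂ σ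
    rw [Set.image_insert_eq] at h₁ h₂
    exact negI h₁ h₂
  | dne _ ih => exact dne (ih σ)
  | orI₁ _ ih => exact orI₁ (ih σ)
  | orI₂ _ ih => exact orI₂ (ih σ)
  | orE _ _ _ ih ih₁ ih₂ =>
    have h₁ := ih₁ σ
    have h₂ := ih₂ σ
    rw [Set.image_insert_eq] at h₁ h₂
    exact orE (ih σ) h₁ h₂
  | allI _ ih =>
    refine allI ((ih (Fml.up σ)).mono ?_)
    rintro _ ⟨_, ⟨ψ, hψ, rfl⟩, rfl⟩
    exact ⟨_, ⟨ψ, hψ, rfl⟩, (Fml.lift_subst_up ψ σ).symm⟩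
  | allE t _ ih =>
    rw [Fml.inst_subst]
    exact allE _ (ih σ)

theorem compact {Γ : Set (Fml L)} {φ : Fml L} (h : Deriv Γ φ) :
    ∃ F ⊆ Γ, F.Finite ∧ Deriv F φ := by
  -- In rules that discharge a hypothesis, that hypothesis is removed from the finite set and
  -- supplied again by the rule.
  have shrink : ∀ {Γ F : Set (Fml L)} {φ : Fml L}, F ⊆ insert φ Γ → F.Finite →
      F \ {φ} ⊆ Γ ∧ (F \ {φ}).Finite ∧ F ⊆ insert φ (F \ {φ}) := by
    intro Γ F φ h hf
    exact ⟨by simpa [Set.sdiff_subset_iff] using h, hf.subset Set.sdiff_subset,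
        by simp [Set.subset_insert]⟩
  induction h with
  | @hyp Γ φ h => exact ⟨{φ}, by simpa using h, Set.finite_singleton _, hyp rfl⟩
  | negI _ _ ih₁ ih₂ =>
    obtain ⟨F, hF, hf, h₁⟩ := ih₁
    obtain ⟨G, hG, hg, h₂⟩ := ih₂
    obtain ⟨a₁, a₂, a₃⟩ := shrink hF hf
    obtain ⟨b₁, b₂, b₃⟩ := shrink hG hg
    exact ⟨_, Set.union_subset a₁ b₁, a₂.union b₂,
      negI (h₁.mono (a₃.trans (Set.insert_subset_insert Set.subset_union_left)))
        (h₂.mono (b₃.trans (Set.insert_subset_insert Set.subset_union_right)))⟩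
  | dne _ ih => obtain ⟨F, hF, hf, h⟩ := ih; exact ⟨F, hF, hf, dne h⟩
  | orI₁ _ ih => obtain ⟨F, hF, hf, h⟩ := ih; exact ⟨F, hF, hf, orI₁ h⟩
  | orI₂ _ ih => obtain ⟨F, hF, hf, h⟩ := ih; exact ⟨F, hF, hf, orI₂ h⟩
  | orE _ _ _ ih ih₁ ih₂ =>
    obtain ⟨F, hF, hf, h₁⟩ := ih₁
    obtain ⟨G, hG, hg, h₂⟩ := ih₂
    obtain ⟨H, hH, hh, h₃⟩ := ih
    obtain ⟨a₁, a₂, a₃⟩ := shrink hF hf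
    obtain ⟨b₁, b₂, b₃⟩ := shrink hG hg
    refine ⟨_, Set.union_subset hH (Set.union_subset a₁ b₁), hh.union (a₂.union b₂),
      orE (h₃.mono Set.subset_union_left) (h₁.mono (a₃.trans (Set.insert_subset_insert ?_)))
        (h₂.mono (b₃.trans (Set.insert_subset_insert ?_)))⟩
    · exact Set.subset_union_left.trans Set.subset_union_right
    · exact Set.subset_union_right.trans Set.subset_union_right
  | allI _ ih =>
    obtain ⟨F, hF, hf, h⟩ := ih
    obtain ⟨G, hG, hg, rfl⟩ := (Set.exists_subset_image_finite_and (p := fun s => s = F)).1 ⟨F, hF, hf, rfl⟩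
    exact ⟨G, hG, hg, allI h⟩
  | allE t _ ih => obtain ⟨F, hF, hf, h⟩ := ih; exact ⟨F, hF, hf, allE t h⟩

theorem absurd {Γ : Set (Fml L)} {φ ψ : Fml L} (h : Deriv Γ φ) (h' : Deriv Γ (¬ᶠ φ)) : Deriv Γ ψ :=
  dne (negI (h.mono (Set.subset_insert _ _)) (h'.mono (Set.subset_insert _ _)))

theorem neg_of_not_consistent {Γ : Set (Fml L)} {φ : Fml L} (h : ¬ Consistent (insert φ Γ)) :
    Deriv Γ (¬ᶠ φ) := by
  simp only [Consistent, not_not] at h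
  obtain ⟨ψ, h₁, h₂⟩ := h
  exact negI h₁ h₂

theorem of_not_consistent {Γ : Set (Fml L)} {φ : Fml L} (h : ¬ Consistent (insert (¬ᶠ φ) Γ)) :
    Deriv Γ φ :=
  dne (neg_of_not_consistent h)

theorem neg_or_left {Γ : Set (Fml L)} {φ ψ : Fml L} (h : Deriv Γ (¬ᶠ (φ ∨ᶠ ψ))) :
    Deriv Γ (¬ᶠ φ) :=
  negI (orI₁ (ψ := ψ) (hyp (Set.mem_insert _ _))) (h.mono (Set.subset_insert _ _))

theorem neg_or_right {Γ : Set (Fml L)} {φ ψ : Fml L} (h : Deriv Γ (¬ᶠ (φ ∨ᶠ ψ))) :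
    Deriv Γ (¬ᶠ ψ) :=
  negI (orI₂ (φ := φ) (hyp (Set.mem_insert _ _))) (h.mono (Set.subset_insert _ _))

theorem sound {Γ : Set (Fml L)} {φ : Fml L} (h : Deriv Γ φ) {X : Type} [L.Structure X] :
    ∀ e : ℕ → X, (∀ ψ ∈ Γ, Sat ψ e) → Sat φ e := by
  induction h with
  | hyp h => exact fun e he => he _ h
  | negI _ _ ih₁ ih₂ =>
    intro e he hφ
    have := Set.forall_insert_of_forall he hφ
    exact ih₂ e this (ih₁ e this)
  | dne _ ih => exact fun e he => not_not.1 (ih e he)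
  | orI₁ _ ih => exact fun e he => Or.inl (ih e he)
  | orI₂ _ ih => exact fun e he => Or.inr (ih e he)
  | orE _ _ _ ih ih₁ ih₂ =>
    exact fun e he => (ih e he).elim (fun h => ih₁ e (Set.forall_insert_of_forall he h))
      (fun h => ih₂ e (Set.forall_insert_of_forall he h))
  | allI _ ih =>
    refine fun e he a => ih _ ?_
    rintro _ ⟨ψ, hψ, rfl⟩
    exact (sat_lift ψ a e).2 (he ψ hψ)
  | allE t _ ih => exact fun e he => (sat_inst _ t e).2 (ih e he _)

/-- Generalization on a variable that does not occur in the hypotheses. -/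
theorem all_of_inst_var {Γ : Set (Fml L)} {φ : Fml L} {c : ℕ} (hΓ : ∀ ψ ∈ Γ, ψ.FreeBelow c)
    (hφ : (Fml.all φ).FreeBelow c) (h : Deriv Γ (φ.inst (FirstOrder.Language.Term.var c))) :
    Deriv Γ (Fml.all φ) := by
  -- The witness `c` becomes the variable `0` and all other variables move up by one. So `f` undoes
  -- the instantiation of `φ` and acts on `Γ` as `lift`.
  let f : ℕ → L.Term ℕ := fun k => FirstOrder.Language.Term.var (if k = c then 0 else k + 1)
  have h' := h.subst f
  refine allI ?_
  have hφ' : (φ.inst (FirstOrder.Language.Term.var c)).subst f = φ := by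
    conv_rhs => rw [← Fml.subst_var φ]
    rw [Fml.inst, Fml.subst_subst]
    refine Fml.subst_congr hφ fun k hk => ?_
    cases k with
    | zero => simp [f, FirstOrder.Language.Term.subst]
    | succ k =>
      have : k ≠ c := by omega
      simp [f, FirstOrder.Language.Term.subst, this]
  rw [hφ'] at h'
  refine h'.mono ?_
  rintro _ ⟨ψ, hψ, rfl⟩
  refine ⟨ψ, hψ, Fml.subst_congr (hΓ ψ hψ) fun k hk => ?_⟩
  simp [f, hk.ne]

end Deriv

/-! ### Completeness -/

instance [Countable (Σ n, L.Functions n)] [Countable (Σ n, L.Relations n)] : Countable (Fml L) := by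
  -- Only injectivity matters, not meaning: all variables, bound ones included, stay free variables,
  -- and the conclusions `falsum` and `g → g` keep negations apart from disjunctions.
  let F : Fml L → ∀ n, L.BoundedFormula ℕ n := fun φ => Fml.rec
    (fun R ts n => .rel R fun i => (ts i).relabel Sum.inl)
    (fun _ f n => (f n).imp .falsum)
    (fun _ _ f g n => (f n).imp ((g n).imp (g n)))
    (fun _ f n => (f (n + 1)).all) φ
  have hF : ∀ φ ψ : Fml L, ∀ n, F φ n = F ψ n → φ = ψ := by
    intro φ
    induction φ with
    | @rel l R ts =>
      intro ψ n h
      cases ψ with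
      | @rel k R' ts' =>
        simp only [F, FirstOrder.Language.BoundedFormula.rel.injEq] at h
        obtain ⟨rfl, h₁, h₂⟩ := h
        obtain rfl := eq_of_heq h₁
        have h₂ := eq_of_heq h₂
        congr 1
        funext i
        have := congrFun h₂ i
        have := congrArg (FirstOrder.Language.Term.relabel (Sum.elim id fun _ : Fin n => 0)) this
        simpa [FirstOrder.Language.Term.relabel_relabel] using this
      | neg ψ => simp [F] at h
      | or ψ χ => simp [F] at h
      | all ψ => simp [F] at h
    | neg φ ih =>
      intro ψ n h
      cases ψ with
      | rel => simp [F] at h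
      | neg ψ =>
        simp only [F, FirstOrder.Language.BoundedFormula.imp.injEq, and_true] at h
        rw [ih ψ n h]
      | or ψ χ => simp [F] at h
      | all ψ => simp [F] at h
    | or φ φ' ih ih' =>
      intro ψ n h
      cases ψ with
      | rel => simp [F] at h
      | neg ψ => simp [F] at h
      | or ψ χ =>
        simp only [F, FirstOrder.Language.BoundedFormula.imp.injEq] at h
        rw [ih ψ n h.1, ih' χ n h.2.1]
      | all ψ => simp [F] at h
    | all φ ih =>
      intro ψ n h
      cases ψ with
      | rel => simp [F] at h
      | neg ψ => simp [F] at h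
      | or ψ χ => simp [F] at h
      | all ψ =>
        simp only [F, FirstOrder.Language.BoundedFormula.all.injEq] at h
        rw [ih ψ (n + 1) h]
  have : Countable (L.BoundedFormula ℕ 0) := by
    have : Countable L.Symbols := by
      unfold FirstOrder.Language.Symbols; infer_instance
    exact Function.Injective.countable (f := fun φ => (⟨0, φ⟩ : Σ n, L.BoundedFormula ℕ n))
      fun a b h => by simpa using h
  exact Function.Injective.countable (f := fun φ => F φ 0) fun a b h => hF a b 0 h

/-- The Henkin axiom of `φ` with the witness `c`. -/
def henkin (φ : Fml L) (c : ℕ) : Fml L := φ.inst (FirstOrder.Language.Term.var c) ⟶ᶠ Fml.all φ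

theorem Consistent.insert_henkin {Γ : Set (Fml L)} {φ : Fml L} {c : ℕ} (h : Consistent Γ)
    (hΓ : ∀ ψ ∈ Γ, ψ.FreeBelow c) (hφ : (Fml.all φ).FreeBelow c) :
    Consistent (insert (henkin φ c) Γ) := by
  by_contra hc
  have := Deriv.neg_of_not_consistent hc
  exact h ⟨_, Deriv.all_of_inst_var hΓ hφ (Deriv.dne this.neg_or_left), this.neg_or_right⟩

theorem consistent_of_finite {Γ : Set (Fml L)} (h : ∀ F ⊆ Γ, F.Finite → Consistent F) :
    Consistent Γ := by
  rintro ⟨φ, h₁, h₂⟩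
  obtain ⟨F, hF, hf, h₁⟩ := h₁.compact
  obtain ⟨G, hG, hg, h₂⟩ := h₂.compact
  exact h (F ∪ G) (Set.union_subset hF hG) (hf.union hg)
    ⟨φ, h₁.mono Set.subset_union_left, h₂.mono Set.subset_union_right⟩

theorem Consistent.mono {Γ Δ : Set (Fml L)} (h : Consistent Δ) (hs : Γ ⊆ Δ) : Consistent Γ :=
  fun ⟨φ, h₁, h₂⟩ => h ⟨φ, h₁.mono hs, h₂.mono hs⟩

/-- Witnesses are variables, not new constants. At every finite stage the free variables are
bounded, so a fresh one is available for the next Henkin axiom; the bound `b` starts this off. -/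
theorem exists_henkin_extension [Countable (Σ n, L.Functions n)] [Countable (Σ n, L.Relations n)]
    {Γ : Set (Fml L)} {b : ℕ} (h : Consistent Γ) (hb : ∀ ψ ∈ Γ, ψ.FreeBelow b) :
    ∃ Δ, Γ ⊆ Δ ∧ Consistent Δ ∧ ∀ φ, ∃ c, henkin φ c ∈ Δ := by
  by_cases hne : Nonempty (Fml L)
  swap
  · exact ⟨Γ, subset_rfl, h, fun φ => (hne ⟨φ⟩).elim⟩
  obtain ⟨θ, hθ⟩ := exists_surjective_nat (Fml L)
  have step : ∀ (n : ℕ) (s : {s : Set (Fml L) // Consistent s ∧ ∃ b, ∀ ψ ∈ s, ψ.FreeBelow b}),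
      ∃ t : {s : Set (Fml L) // Consistent s ∧ ∃ b, ∀ ψ ∈ s, ψ.FreeBelow b},
        s.1 ⊆ t.1 ∧ ∃ c, henkin (θ n) c ∈ t.1 := by
    rintro n ⟨s, hs, k, hk⟩
    obtain ⟨m, hm⟩ := (Fml.all (θ n)).exists_freeBelow
    obtain ⟨l, hl⟩ := (henkin (θ n) (max k m)).exists_freeBelow
    refine ⟨⟨insert (henkin (θ n) (max k m)) s,
      hs.insert_henkin (fun ψ hψ => (hk ψ hψ).mono (le_max_left _ _)) (hm.mono (le_max_right _ _)),
      max k l, ?_⟩, Set.subset_insert _ _, max k m, Set.mem_insert _ _⟩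
    rintro ψ (rfl | hψ)
    · exact hl.mono (le_max_right _ _)
    · exact (hk ψ hψ).mono (le_max_left _ _)
  choose next hnext hmem using step
  let G : ℕ → {s : Set (Fml L) // Consistent s ∧ ∃ b, ∀ ψ ∈ s, ψ.FreeBelow b} :=
    fun n => Nat.rec ⟨Γ, h, b, hb⟩ (fun n s => next n s) n
  have hG : Monotone fun n => (G n).1 := monotone_nat_of_le_succ fun n => hnext n (G n)
  refine ⟨⋃ n, (G n).1, Set.subset_iUnion (fun n => (G n).1) 0, ?_, fun φ => ?_⟩
  · refine consistent_of_finite fun F hF hf => ?_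
    obtain ⟨n, hn⟩ := hG.directed_le.exists_mem_subset_of_finset_subset_biUnion
      (s := hf.toFinset) (by simpa using hF)
    exact (G n).2.1.mono (by simpa using hn)
  · obtain ⟨n, rfl⟩ := hθ φ
    obtain ⟨c, hc⟩ := hmem n (G n)
    exact ⟨c, Set.mem_iUnion.2 ⟨n + 1, hc⟩⟩

theorem exists_maximal_consistent {Γ : Set (Fml L)} (h : Consistent Γ) :
    ∃ Δ, Γ ⊆ Δ ∧ Consistent Δ ∧ ∀ φ, φ ∈ Δ ∨ ¬ᶠ φ ∈ Δ := by
  obtain ⟨Δ, hΓ, hΔ⟩ := zorn_subset_nonempty {s : Set (Fml L) | Consistent s} (by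
    intro c hc hchain hne
    refine ⟨⋃₀ c, consistent_of_finite fun F hF hf => ?_, fun s hs => Set.subset_sUnion_of_mem hs⟩
    obtain ⟨s, hs, hFs⟩ := DirectedOn.exists_mem_subset_of_finite_of_subset_sUnion hne
      hchain.directedOn hf hF
    exact (hc hs).mono hFs) Γ h
  refine ⟨Δ, hΓ, hΔ.1, fun φ => ?_⟩
  by_contra hc
  push Not at hc
  have aux : ∀ ψ, ψ ∉ Δ → ¬ Consistent (insert ψ Δ) := fun ψ hψ hcon =>
    hψ (hΔ.2 hcon (Set.subset_insert _ _) (Set.mem_insert _ _))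
  exact hΔ.1 ⟨φ, Deriv.of_not_consistent (aux _ hc.2), Deriv.neg_of_not_consistent (aux _ hc.1)⟩

/-- The term structure of a set of formulas. -/
abbrev termStructure (Δ : Set (Fml L)) : L.Structure (L.Term ℕ) where
  funMap f ts := FirstOrder.Language.Term.func f ts
  RelMap R ts := Fml.rel R ts ∈ Δ

theorem termStructure_realize (Δ : Set (Fml L)) (t : L.Term ℕ) (e : ℕ → L.Term ℕ) :
    @FirstOrder.Language.Term.realize L _ (termStructure Δ) _ e t = t.subst e := by
  let _ := termStructure Δ
  induction t with
  | var x => rfl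
  | func f ts ih => simp [FirstOrder.Language.Term.realize, FirstOrder.Language.Term.subst, ih, FirstOrder.Language.Structure.funMap]

/-- Membership in a maximal consistent set with Henkin axioms obeys the clauses of truth, so the
terms form a model. No quotient is needed, since equality is not a logical symbol. -/
theorem exists_model_of_consistent [Countable (Σ n, L.Functions n)]
    [Countable (Σ n, L.Relations n)] {Γ : Set (Fml L)} {b : ℕ} (h : Consistent Γ)
    (hb : ∀ ψ ∈ Γ, ψ.FreeBelow b) :
    ∃ (X : Type) (_ : L.Structure X) (e : ℕ → X), ∀ ψ ∈ Γ, Sat ψ e := by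
  obtain ⟨Δ, hΓΔ, hΔ, hH⟩ := exists_henkin_extension h hb
  obtain ⟨Θ, hΔΘ, hΘ, hmax⟩ := exists_maximal_consistent hΔ
  have mem_of : ∀ {φ}, Deriv Θ φ → φ ∈ Θ := fun {φ} hφ =>
    (hmax φ).resolve_right fun hn => hΘ ⟨φ, hφ, .hyp hn⟩
  have mem_neg : ∀ φ, ¬ᶠ φ ∈ Θ ↔ φ ∉ Θ := fun φ =>
    ⟨fun hn hφ => hΘ ⟨φ, .hyp hφ, .hyp hn⟩, fun hn => (hmax φ).resolve_left hn⟩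
  have mem_or : ∀ φ ψ, φ ∨ᶠ ψ ∈ Θ ↔ φ ∈ Θ ∨ ψ ∈ Θ := by
    refine fun φ ψ => ⟨fun ho => ?_, fun ho => ho.elim (fun h => mem_of (.orI₁ (.hyp h)))
      fun h => mem_of (.orI₂ (.hyp h))⟩
    by_contra hc
    push Not at hc
    rw [← mem_neg, ← mem_neg] at hc
    refine hΘ ⟨φ, .orE (.hyp ho) (.hyp (Set.mem_insert _ _)) ?_, .hyp hc.1⟩
    exact .absurd (.hyp (Set.mem_insert _ _)) (.hyp (Set.mem_insert_of_mem _ hc.2))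
  have mem_all : ∀ φ, Fml.all φ ∈ Θ ↔ ∀ t, φ.inst t ∈ Θ := by
    refine fun φ => ⟨fun ha t => mem_of (.allE t (.hyp ha)), fun ha => ?_⟩
    obtain ⟨c, hc⟩ := hH φ
    exact ((mem_or _ _).1 (hΔΘ hc)).resolve_left fun hn => (mem_neg _).1 hn (ha _)
  let _ := termStructure Θ
  have truth : ∀ (φ : Fml L) (e : ℕ → L.Term ℕ), Sat φ e ↔ φ.subst e ∈ Θ := by
    intro φ
    induction φ with
    | rel R ts =>
      intro e
      simp only [Sat, termStructure_realize, Fml.subst]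
      rfl
    | neg φ ih => intro e; simp only [sat_neg, ih, Fml.subst, mem_neg]
    | or φ ψ ih₁ ih₂ => intro e; simp only [sat_or, ih₁, ih₂, Fml.subst, mem_or]
    | all φ ih =>
      intro e
      simp only [sat_all, ih, Fml.subst, mem_all]
      refine forall_congr' fun t => ?_
      have : φ.subst (cons t e) = (φ.subst (Fml.up e)).inst t := by
        rw [Fml.inst, Fml.subst_subst]
        congr 1
        funext n
        cases n with
        | zero => rfl
        | succ n =>
          simp only [Fml.up, term_relabel_eq_subst, term_subst_subst]
          exact (term_subst_var _).symm
      rw [this]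
  exact ⟨L.Term ℕ, _, FirstOrder.Language.Term.var, fun ψ hψ => (truth ψ _).2 (by
    rw [Fml.subst_var]; exact hΔΘ (hΓΔ hψ))⟩

/-! ### Models of theories that are given by universal closures -/

theorem freeBelow_of_mem_univClosures {A : Fml L → Prop} {φ : Fml L} (h : φ ∈ univClosures A) :
    φ.FreeBelow 0 := by
  obtain ⟨ψ, n, -, hn, rfl⟩ := h
  exact Fml.freeBelow_alls (by simpa using hn)

theorem sat_alls {X : Type} [L.Structure X] (n : ℕ) (φ : Fml L) :
    (∀ e : ℕ → X, Sat (Fml.alls n φ) e) ↔ ∀ e : ℕ → X, Sat φ e := by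
  induction n generalizing φ with
  | zero => rfl
  | succ n ih =>
    rw [Fml.alls, ih]
    exact ⟨fun h e => cons_tail e ▸ h _ (e 0), fun h e a => h _⟩

/-- `X` satisfies all universal closures of the formulas in `A`. -/
def Models (X : Type) [L.Structure X] (A : Fml L → Prop) : Prop := ∀ φ, A φ → ∀ e : ℕ → X, Sat φ e

/-- Universal closures are sentences, so the one assignment that completeness provides decides them
for all assignments. -/
theorem models_iff {X : Type} [L.Structure X] {A : Fml L → Prop} (e : ℕ → X) :
    (∀ φ ∈ univClosures A, Sat φ e) ↔ Models X A := by
  refine ⟨fun h φ hφ => ?_, ?_⟩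
  · obtain ⟨n, hn⟩ := φ.exists_freeBelow
    rw [← sat_alls n]
    intro e'
    have hm : Fml.alls n φ ∈ univClosures A := ⟨φ, n, hφ, hn, rfl⟩
    exact (sat_congr _ (freeBelow_of_mem_univClosures hm) (by simp)).1 (h _ hm)
  · rintro h _ ⟨ψ, n, hψ, -, rfl⟩
    exact (sat_alls n ψ).2 (h ψ hψ) e

/-- Soundness and completeness for theories that are given by universal closures. -/
theorem deriv_iff [Countable (Σ n, L.Functions n)] [Countable (Σ n, L.Relations n)]
    {A : Fml L → Prop} {φ : Fml L} :
    Deriv (univClosures A) φ ↔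
      ∀ (X : Type) (_ : L.Structure X), Models X A → ∀ e : ℕ → X, Sat φ e := by
  refine ⟨fun h X _ hX e => h.sound e ((models_iff e).2 hX), fun h => ?_⟩
  refine Deriv.of_not_consistent fun hc => ?_
  obtain ⟨n, hn⟩ := φ.exists_freeBelow
  obtain ⟨X, _, e, he⟩ := exists_model_of_consistent hc (b := n) (by
    rintro ψ (rfl | hψ)
    · exact hn
    · exact (freeBelow_of_mem_univClosures hψ).mono (Nat.zero_le n))
  exact he _ (Set.mem_insert _ _)
    (h X _ ((models_iff e).1 fun ψ hψ => he ψ (Set.mem_insert_of_mem _ hψ)) e)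

theorem consistent_iff [Countable (Σ n, L.Functions n)] [Countable (Σ n, L.Relations n)]
    {A : Fml L → Prop} :
    Consistent (univClosures A) ↔ ∃ (X : Type) (_ : L.Structure X), Nonempty X ∧ Models X A := by
  refine ⟨fun h => ?_, ?_⟩
  · obtain ⟨X, i, e, he⟩ := exists_model_of_consistent h (b := 0)
      fun ψ hψ => freeBelow_of_mem_univClosures hψ
    exact ⟨X, i, ⟨e 0⟩, (models_iff e).1 he⟩
  · rintro ⟨X, i, ⟨x⟩, hX⟩ ⟨φ, h₁, h₂⟩
    have := (models_iff fun _ => x).2 hX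
    exact h₂.sound _ this (h₁.sound _ this)

end Logic

/-! ## Structures for set theory with urelements -/

/-- A structure for the language of ZFU in which equality is true equality. -/
class SetStr (V : Type) where
  S : V → Prop
  mem : V → V → Prop

open SetStr (S)

infix:50 " ∈ᵛ " => SetStr.mem

instance {V : Type} [SetStr V] : LZ.Structure V where
  RelMap := fun {_} R ts => match R with
    | ZRel.S => SetStr.S (ts 0)
    | ZRel.mem => ts 0 ∈ᵛ ts 1
    | ZRel.eq => ts 0 = ts 1

/-! ### Quotients by a congruent equality predicate -/

section Quotient

variable {X : Type} [LZ.Structure X]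

/-- The equality predicate of a structure for the language of ZFU. -/
def eqv (x y : X) : Prop := FirstOrder.Language.Structure.RelMap (L := LZ) ZRel.eq ![x, y]

theorem sat_rel_one {n : ℕ} {R : ZRel 1} {e : ℕ → X} :
    Sat (L := LZ) (.rel R ![.var n]) e ↔ FirstOrder.Language.Structure.RelMap (L := LZ) R ![e n] := by
  simp only [Sat]
  refine iff_of_eq (congrArg _ ?_)
  funext i; fin_cases i; rfl

theorem sat_rel_two {m n : ℕ} {R : ZRel 2} {e : ℕ → X} :
    Sat (L := LZ) (.rel R ![.var m, .var n]) e ↔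
      FirstOrder.Language.Structure.RelMap (L := LZ) R ![e m, e n] := by
  simp only [Sat]
  refine iff_of_eq (congrArg _ ?_)
  funext i; fin_cases i <;> rfl

/-- Every structure with a congruent equality predicate has a quotient with true equality. -/
theorem exists_quotient (hrefl : ∀ x : X, eqv x x)
    (hsubst : ∀ (A : Fml LZ) (e : ℕ → X) (x y : X), eqv x y → Sat A (cons x e) → Sat A (cons y e)) :
    ∃ (V : Type) (_ : SetStr V) (π : X → V), Function.Surjective π ∧
      ∀ (A : Fml LZ) (e : ℕ → X), Sat A e ↔ Sat A (fun n => π (e n)) := by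
  -- Symmetry comes from substituting into the property of being equal to `x`, which `x` has.
  have hsymm : ∀ x y : X, eqv x y → eqv y x := fun x y h => by
    have := hsubst (ZFU.eq 0 1) (fun _ => x) x y h
    simp only [ZFU.eq, sat_rel_two] at this
    exact this (hrefl x)
  have htrans : ∀ x y z : X, eqv x y → eqv y z → eqv x z := fun x y z h h' => by
    have := hsubst (ZFU.eq 1 0) (fun _ => x) y z h'
    simp only [ZFU.eq, sat_rel_two] at this
    exact this h
  let s : Setoid X := ⟨eqv, hrefl, fun h => hsymm _ _ h, fun h h' => htrans _ _ _ h h'⟩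
  let V := Quotient s
  let π : X → V := Quotient.mk s
  have hπ : Function.Surjective π := Quotient.mk_surjective
  have hπ' : ∀ x y, π x = π y ↔ eqv x y := fun x y => Quotient.eq (r := s)
  let str : SetStr V :=
    { S := fun a => ∃ x, π x = a ∧ FirstOrder.Language.Structure.RelMap (L := LZ) ZRel.S ![x]
      mem := fun a b => ∃ x y, π x = a ∧ π y = b ∧
        FirstOrder.Language.Structure.RelMap (L := LZ) ZRel.mem ![x, y] }
  have hS : ∀ x y : X, eqv x y → FirstOrder.Language.Structure.RelMap (L := LZ) ZRel.S ![x] →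
      FirstOrder.Language.Structure.RelMap (L := LZ) ZRel.S ![y] := fun x y h => by
    have := hsubst (ZFU.S 0) (fun _ => x) x y h
    simp only [ZFU.S, sat_rel_one] at this
    exact this
  have hmem : ∀ x x' y y' : X, eqv x x' → eqv y y' →
      FirstOrder.Language.Structure.RelMap (L := LZ) ZRel.mem ![x, y] →
      FirstOrder.Language.Structure.RelMap (L := LZ) ZRel.mem ![x', y'] := fun x x' y y' h h' hm => by
    have h₁ := hsubst (ZFU.mem 0 1) (fun _ => y) x x' h
    have h₂ := hsubst (ZFU.mem 1 0) (fun _ => x') y y' h'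
    simp only [ZFU.mem, sat_rel_two] at h₁ h₂
    exact h₂ (h₁ hm)
  refine ⟨V, str, π, hπ, fun A => ?_⟩
  induction A with
  | @rel n R ts =>
    intro e
    have hts : ∀ i, (ts i).realize (fun n => π (e n)) = π ((ts i).realize e) := by
      intro i
      cases ts i with
      | var n => rfl
      | func f _ => exact Empty.elim f
    simp only [Sat, hts]
    cases R with
    | S =>
      refine ⟨fun h => ⟨_, rfl, ?_⟩, fun ⟨x, hx, h⟩ => ?_⟩
      · convert h with i; fin_cases i; rfl
      · have := hS _ _ ((hπ' _ _).1 hx) h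
        convert this with i; fin_cases i; rfl
    | mem =>
      refine ⟨fun h => ⟨_, _, rfl, rfl, ?_⟩, fun ⟨x, y, hx, hy, h⟩ => ?_⟩
      · convert h with i; fin_cases i <;> rfl
      · have := hmem _ _ _ _ ((hπ' _ _).1 hx) ((hπ' _ _).1 hy) h
        convert this with i; fin_cases i <;> rfl
    | eq =>
      refine Iff.trans ?_ (hπ' _ _).symm
      refine iff_of_eq (congrArg _ ?_)
      funext i; fin_cases i <;> rfl
  | neg A ih => intro e; simp only [sat_neg, ih]
  | or A B ih₁ ih₂ => intro e; simp only [sat_or, ih₁, ih₂]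
  | all A ih =>
    intro e
    have key : ∀ a, (fun n => π (cons a e n)) = cons (π a) fun n => π (e n) := by
      intro a; funext n; cases n <;> rfl
    simp only [sat_all, ih, key]
    exact ⟨fun h a => by obtain ⟨x, rfl⟩ := hπ a; exact h x, fun h a => h (π a)⟩

end Quotient

/-! ### Definability with parameters, found by instance search -/

section Definability

variable {V : Type} [SetStr V]

section
variable (x y : ℕ) (e : ℕ → V)
@[simp] theorem sat_S : Sat (ZFU.S x) e ↔ S (e x) := Iff.rfl
@[simp] theorem sat_mem : Sat (ZFU.mem x y) e ↔ e x ∈ᵛ e y := Iff.rfl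
@[simp] theorem sat_eq : Sat (ZFU.eq x y) e ↔ e x = e y := Iff.rfl
end

/-- The assignment with `e` in the even places and `p` in the odd places. -/
def weave {X : Type} (e p : ℕ → X) (n : ℕ) : X := if n % 2 = 0 then e (n / 2) else p (n / 2)

theorem weave_even {X : Type} (e p : ℕ → X) (n : ℕ) : weave e p (2 * n) = e n := by
  simp [weave]
theorem weave_odd {X : Type} (e p : ℕ → X) (n : ℕ) : weave e p (2 * n + 1) = p n := by
  have : (2 * n + 1) / 2 = n := by omega
  simp [weave, this, Nat.add_mod]

/-- The predicates on assignments that are definable with parameters. -/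
class Dfn (P : (ℕ → V) → Prop) : Prop where
  -- Variables sit at even indices and parameters at odd ones, so that either supply can grow
  -- without running into the other.
  out : ∃ (A : Fml LZ) (p : ℕ → V), ∀ e, P e ↔ Sat A (weave e p)

/-- Projections and constants. -/
class DT (t : (ℕ → V) → V) : Prop where
  out : (∃ i, t = fun e => e i) ∨ ∃ c, t = fun _ => c

instance (i : ℕ) : DT fun e : ℕ → V => e i := ⟨Or.inl ⟨i, rfl⟩⟩
instance (c : V) : DT fun _ : ℕ → V => c := ⟨Or.inr ⟨c, rfl⟩⟩
variable [Nonempty V]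

/-- Definability is stable under substitution of projections and constants. -/
theorem Dfn.comp {P : (ℕ → V) → Prop} (hP : Dfn P) (T : ℕ → (ℕ → V) → V) (hT : ∀ n, DT (T n)) :
    Dfn fun e => P fun n => T n e := by
  obtain ⟨A, p, hA⟩ := hP.out
  have : ∀ n, ∃ (i : ℕ) (c : V), ∀ e q, q n = c → T n e = weave e (weave p q) i := fun n => by
    obtain ⟨i, hi⟩ | ⟨c, hc⟩ := (hT n).out
    · exact ⟨2 * i, Classical.arbitrary V, fun e q _ => by rw [hi, weave_even]⟩
    -- The constant becomes entry `n` of a second parameter list, which is entry `2 * n + 1` of the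
    -- woven list and has an odd index in the outer weaving.
    · exact ⟨2 * (2 * n + 1) + 1, c, fun e q h => by rw [hc, weave_odd, weave_odd, h]⟩
  choose i c hi using this
  refine ⟨A.rename fun n => if n % 2 = 0 then i (n / 2) else 2 * (2 * (n / 2)) + 1, weave p c,
    fun e => ?_⟩
  rw [sat_rename, hA]
  refine iff_of_eq (congrArg _ ?_)
  funext n
  by_cases hn : n % 2 = 0
  · simp only [hn, if_true]
    rw [← hi _ e c rfl]
    simp [weave, hn]
  · simp only [hn, if_false, weave_odd, weave_even]
    simp [weave, hn]

theorem Dfn.comp₁ {R : V → Prop} (h : Dfn fun e => R (e 0)) (t : (ℕ → V) → V) [ht : DT t] :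
    Dfn fun e => R (t e) :=
  h.comp (fun _ => t) fun _ => ht

theorem Dfn.comp₂ {R : V → V → Prop} (h : Dfn fun e => R (e 0) (e 1)) (t s : (ℕ → V) → V)
    [ht : DT t] [hs : DT s] : Dfn fun e => R (t e) (s e) :=
  h.comp (fun n => if n = 0 then t else s) fun n => by split_ifs <;> assumption

theorem Dfn.comp₃ {R : V → V → V → Prop} (h : Dfn fun e => R (e 0) (e 1) (e 2))
    (t s r : (ℕ → V) → V) [ht : DT t] [hs : DT s] [hr : DT r] : Dfn fun e => R (t e) (s e) (r e) :=
  h.comp (fun n => if n = 0 then t else if n = 1 then s else r) fun n => by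
    split_ifs <;> assumption

instance (t s : (ℕ → V) → V) [DT t] [DT s] : Dfn fun e => t e ∈ᵛ s e :=
  Dfn.comp₂ ⟨ZFU.mem 0 2, fun _ => Classical.arbitrary V, fun e => by simp [weave]⟩ t s
instance (t s : (ℕ → V) → V) [DT t] [DT s] : Dfn fun e => t e = s e :=
  Dfn.comp₂ ⟨ZFU.eq 0 2, fun _ => Classical.arbitrary V, fun e => by simp [weave]⟩ t s
instance (t : (ℕ → V) → V) [DT t] : Dfn fun e => S (t e) :=
  Dfn.comp₁ ⟨ZFU.S 0, fun _ => Classical.arbitrary V, fun e => by simp [weave]⟩ t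

instance Dfn.not (P : (ℕ → V) → Prop) [h : Dfn P] : Dfn fun e => ¬ P e := by
  obtain ⟨A, p, hA⟩ := h.out
  exact ⟨¬ᶠ A, p, fun e => by simp [hA]⟩

instance Dfn.or (P Q : (ℕ → V) → Prop) [h : Dfn P] [h' : Dfn Q] : Dfn fun e => P e ∨ Q e := by
  obtain ⟨A, p, hA⟩ := h.out
  obtain ⟨B, q, hB⟩ := h'.out
  -- The two parameter lists are woven together: parameter `k` moves to `2 * k + r`, with `r = 0`
  -- for `A` and `r = 1` for `B`.
  let f (r n : ℕ) : ℕ := if n % 2 = 0 then n else 2 * (2 * (n / 2) + r) + 1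
  have hf₁ : ∀ e : ℕ → V, (fun n => weave e (weave p q) (f 0 n)) = weave e p := fun e => by
    funext n
    by_cases hn : n % 2 = 0
    · simp [f, hn, weave]
    · simp only [f, hn, if_false, weave_odd, weave_even, Nat.add_zero]; simp [weave, hn]
  have hf₂ : ∀ e : ℕ → V, (fun n => weave e (weave p q) (f 1 n)) = weave e q := fun e => by
    funext n
    by_cases hn : n % 2 = 0
    · simp [f, hn, weave]
    · simp only [f, hn, if_false, weave_odd]; simp [weave, hn]
  exact ⟨A.rename (f 0) ∨ᶠ B.rename (f 1), weave p q, fun e => by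
    simp only [hA, hB, sat_or, sat_rename, hf₁, hf₂]⟩

omit [Nonempty V] in
theorem Dfn.congr {P Q : (ℕ → V) → Prop} (h : Dfn P) (hPQ : ∀ e, Q e ↔ P e) : Dfn Q := by
  obtain rfl : Q = P := funext fun e => propext (hPQ e)
  exact h

instance Dfn.and (P Q : (ℕ → V) → Prop) [Dfn P] [Dfn Q] : Dfn fun e => P e ∧ Q e :=
  Dfn.congr (P := fun e => ¬ (¬ P e ∨ ¬ Q e)) inferInstance fun e => by tauto

instance Dfn.imp (P Q : (ℕ → V) → Prop) [Dfn P] [Dfn Q] : Dfn fun e => P e → Q e :=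
  Dfn.congr (P := fun e => ¬ P e ∨ Q e) inferInstance fun e => by tauto

instance Dfn.iff (P Q : (ℕ → V) → Prop) [Dfn P] [Dfn Q] : Dfn fun e => (P e ↔ Q e) :=
  Dfn.congr (P := fun e => (P e → Q e) ∧ (Q e → P e)) inferInstance fun e => by tauto

instance Dfn.all (P : V → (ℕ → V) → Prop) [h : Dfn fun e => P (e 0) fun n => e (n + 1)] :
    Dfn fun e => ∀ a, P a e := by
  obtain ⟨A, p, hA⟩ := h.out
  -- The binder shifts every index by one, whereas a new first variable shifts the variables by two
  -- and the parameters not at all. Hence variables go down by one and parameters go up by one.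
  let f (n : ℕ) : ℕ := if n = 0 then 0 else if n % 2 = 0 then n - 1 else n + 1
  have hf : ∀ (a : V) (e : ℕ → V),
      (fun n => cons a (weave e p) (f n)) = weave (cons a e) p := fun a e => by
    funext n
    rcases Nat.even_or_odd' n with ⟨k, rfl | rfl⟩
    · cases k with
      | zero => rfl
      | succ k =>
        have : f (2 * (k + 1)) = 2 * k + 1 := by simp only [f]; split_ifs <;> omega
        rw [this, weave_even, cons_succ, cons_succ, weave_even]
    · have : f (2 * k + 1) = 2 * k + 1 + 1 := by simp only [f]; split_ifs <;> omega
      rw [this, weave_odd, cons_succ, weave_odd]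
  refine ⟨Fml.all (A.rename f), p, fun e => forall_congr' fun a => ?_⟩
  rw [sat_rename, hf, ← hA]
  rfl

instance Dfn.ex (P : V → (ℕ → V) → Prop) [h : Dfn fun e => P (e 0) fun n => e (n + 1)] :
    Dfn fun e => ∃ a, P a e :=
  Dfn.congr (P := fun e => ¬ ∀ a, ¬ P a e) inferInstance fun e => by simp

/-- `x ⊆ y`. -/
def Sub (x y : V) : Prop := ∀ t, t ∈ᵛ x → t ∈ᵛ y

instance (t s : (ℕ → V) → V) [DT t] [DT s] : Dfn fun e => Sub (t e) (s e) :=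
  Dfn.comp₂ (by unfold Sub; infer_instance) t s
end Definability

/-! ## The notions of ZFU in a structure -/

section Notions

variable {V : Type} [SetStr V]

def IsZero (x : V) : Prop := S x ∧ ∀ t, ¬ t ∈ᵛ x
def IsOne (x : V) : Prop := S x ∧ ∀ t, t ∈ᵛ x ↔ IsZero t
def IsTwo (x : V) : Prop := S x ∧ ∀ t, t ∈ᵛ x ↔ (IsZero t ∨ IsOne t)
def IsUPair (z a b : V) : Prop := S z ∧ ∀ t, t ∈ᵛ z ↔ (t = a ∨ t = b)
def IsPair (p a b : V) : Prop := S p ∧ ∀ t, t ∈ᵛ p ↔ (IsUPair t a a ∨ IsUPair t a b)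
def PairMem (a b f : V) : Prop := ∃ p, p ∈ᵛ f ∧ IsPair p a b
def IsUnion (z x y : V) : Prop := S z ∧ ∀ t, t ∈ᵛ z ↔ (t ∈ᵛ x ∨ t ∈ᵛ y)
def IsSucc (z x : V) : Prop := S z ∧ ∀ t, t ∈ᵛ z ↔ (t ∈ᵛ x ∨ t = x)
def IsFun (f x y : V) : Prop :=
  S f ∧ (∀ p, p ∈ᵛ f → ∃ a b, a ∈ᵛ x ∧ b ∈ᵛ y ∧ IsPair p a b) ∧
    ∀ a, a ∈ᵛ x → ∃ b, PairMem a b f ∧ ∀ c, PairMem a c f → c = b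
def Equinum (x y : V) : Prop :=
  S x ∧ S y ∧ ∃ f, IsFun f x y ∧ ∀ b, b ∈ᵛ y → ∃ a, PairMem a b f ∧ ∀ c, PairMem c b f → c = a
def IsOrd (x : V) : Prop :=
  S x ∧ (∀ y, y ∈ᵛ x → S y ∧ Sub y x) ∧
    ∀ y z, y ∈ᵛ x ∧ z ∈ᵛ x → y ∈ᵛ z ∨ y = z ∨ z ∈ᵛ y
def IsCardinal (x : V) : Prop := IsOrd x ∧ ∀ y, y ∈ᵛ x → ¬ Equinum y x
def IsCardOf (y x : V) : Prop := IsCardinal y ∧ Equinum x y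
def IsNat (x : V) : Prop :=
  IsOrd x ∧ ∀ y, y ∈ᵛ x ∨ y = x → IsZero y ∨ ∃ z, IsSucc y z
def CardLt (a b : V) : Prop := IsCardinal a ∧ IsCardinal b ∧ a ∈ᵛ b
def CardLe (a b : V) : Prop := IsCardinal a ∧ IsCardinal b ∧ (a ∈ᵛ b ∨ a = b)
def IsCardSum (c a b : V) : Prop :=
  ∃ x y z, IsCardOf a x ∧ IsCardOf b y ∧ (∀ t, ¬ (t ∈ᵛ x ∧ t ∈ᵛ y)) ∧ IsUnion z x y ∧ IsCardOf c z
def IsCardPow (c a : V) : Prop :=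
  IsCardinal a ∧ ∃ d, IsTwo d ∧ ∃ F, S F ∧ (∀ f, f ∈ᵛ F ↔ IsFun f a d) ∧ IsCardOf c F

section
variable (x y z : ℕ) (e : ℕ → V)
@[simp] theorem sat_sub : Sat (ZFU.sub x y) e ↔ Sub (e x) (e y) := by
  simp [ZFU.sub, Sub]
@[simp] theorem sat_isZero : Sat (ZFU.isZero x) e ↔ IsZero (e x) := by
  simp [ZFU.isZero, IsZero]
@[simp] theorem sat_isOne : Sat (ZFU.isOne x) e ↔ IsOne (e x) := by
  simp [ZFU.isOne, IsOne]
@[simp] theorem sat_isTwo : Sat (ZFU.isTwo x) e ↔ IsTwo (e x) := by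
  simp [ZFU.isTwo, IsTwo]
@[simp] theorem sat_isUPair : Sat (ZFU.isUPair x y z) e ↔ IsUPair (e x) (e y) (e z) := by
  simp [ZFU.isUPair, IsUPair]
@[simp] theorem sat_isPair : Sat (ZFU.isPair x y z) e ↔ IsPair (e x) (e y) (e z) := by
  simp [ZFU.isPair, IsPair]
@[simp] theorem sat_pairMem : Sat (ZFU.pairMem x y z) e ↔ PairMem (e x) (e y) (e z) := by
  simp [ZFU.pairMem, PairMem]
@[simp] theorem sat_isUnion : Sat (ZFU.isUnion x y z) e ↔ IsUnion (e x) (e y) (e z) := by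
  simp [ZFU.isUnion, IsUnion]
@[simp] theorem sat_isSucc : Sat (ZFU.isSucc x y) e ↔ IsSucc (e x) (e y) := by
  simp [ZFU.isSucc, IsSucc]
@[simp] theorem sat_isFun : Sat (ZFU.isFun x y z) e ↔ IsFun (e x) (e y) (e z) := by
  simp [ZFU.isFun, IsFun]
@[simp] theorem sat_equinum : Sat (ZFU.equinum x y) e ↔ Equinum (e x) (e y) := by
  simp [ZFU.equinum, Equinum]
@[simp] theorem sat_isOrd : Sat (ZFU.isOrd x) e ↔ IsOrd (e x) := by
  simp [ZFU.isOrd, IsOrd]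
@[simp] theorem sat_isCardinal : Sat (ZFU.isCardinal x) e ↔ IsCardinal (e x) := by
  simp [ZFU.isCardinal, IsCardinal]
@[simp] theorem sat_isCardOf : Sat (ZFU.isCardOf x y) e ↔ IsCardOf (e x) (e y) := by
  simp [ZFU.isCardOf, IsCardOf]
@[simp] theorem sat_isNat : Sat (ZFU.isNat x) e ↔ IsNat (e x) := by
  simp [ZFU.isNat, IsNat]
@[simp] theorem sat_cardLt : Sat (ZFU.cardLt x y) e ↔ CardLt (e x) (e y) := by
  simp [ZFU.cardLt, CardLt]
@[simp] theorem sat_cardLe : Sat (ZFU.cardLe x y) e ↔ CardLe (e x) (e y) := by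
  simp [ZFU.cardLe, CardLe]
@[simp] theorem sat_isCardSum : Sat (ZFU.isCardSum x y z) e ↔ IsCardSum (e x) (e y) (e z) := by
  simp [ZFU.isCardSum, IsCardSum]
@[simp] theorem sat_isCardPow : Sat (ZFU.isCardPow x y) e ↔ IsCardPow (e x) (e y) := by
  simp [ZFU.isCardPow, IsCardPow]
end

section
variable [Nonempty V] (t s r : (ℕ → V) → V) [DT t] [DT s] [DT r]
instance : Dfn fun e => IsZero (t e) :=
  Dfn.comp₁ (by unfold IsZero; infer_instance) t
instance : Dfn fun e => IsUPair (t e) (s e) (r e) :=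
  Dfn.comp₃ (by unfold IsUPair; infer_instance) t s r
instance : Dfn fun e => IsPair (t e) (s e) (r e) :=
  Dfn.comp₃ (by unfold IsPair; infer_instance) t s r
instance : Dfn fun e => PairMem (t e) (s e) (r e) :=
  Dfn.comp₃ (by unfold PairMem; infer_instance) t s r
instance : Dfn fun e => IsFun (t e) (s e) (r e) :=
  Dfn.comp₃ (by unfold IsFun; infer_instance) t s r
instance : Dfn fun e => Equinum (t e) (s e) :=
  Dfn.comp₂ (by unfold Equinum; infer_instance) t s
instance : Dfn fun e => IsOrd (t e) :=
  Dfn.comp₁ (by unfold IsOrd; infer_instance) t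
instance : Dfn fun e => IsCardinal (t e) :=
  Dfn.comp₁ (by unfold IsCardinal; infer_instance) t
instance : Dfn fun e => IsCardOf (t e) (s e) :=
  Dfn.comp₂ (by unfold IsCardOf; infer_instance) t s
end

/-- The axioms of ZFU except infinity and choice. -/
class BasicSet (V : Type) [SetStr V] : Prop where
  nonempty : Nonempty V
  isSet_of_mem {x y : V} : x ∈ᵛ y → S y
  ext {x y : V} : S x → S y → (∀ t, t ∈ᵛ x ↔ t ∈ᵛ y) → x = y
  pairing (a b : V) : ∃ z, IsUPair z a b
  union {x : V} : S x → ∃ z, S z ∧ ∀ t, t ∈ᵛ z ↔ ∃ w, w ∈ᵛ x ∧ t ∈ᵛ w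
  power {x : V} : S x → ∃ z, S z ∧ ∀ t, t ∈ᵛ z ↔ S t ∧ Sub t x
  separation (A : Fml LZ) (e : ℕ → V) {x : V} : S x →
    ∃ z, S z ∧ ∀ t, t ∈ᵛ z ↔ t ∈ᵛ x ∧ Sat A (cons t e)
  regularity {x : V} : S x → (∃ y, y ∈ᵛ x) → ∃ y, y ∈ᵛ x ∧ ∀ t, ¬ (t ∈ᵛ y ∧ t ∈ᵛ x)
  replacement (A : Fml LZ) (e : ℕ → V) {u : V} : S u →
    (∀ w, w ∈ᵛ u → ∃ s, Sat A (cons s (cons w e)) ∧ ∀ r, Sat A (cons r (cons w e)) → r = s) →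
    ∃ z, S z ∧ ∀ s, s ∈ᵛ z ↔ ∃ w, w ∈ᵛ u ∧ Sat A (cons s (cons w e))

/-- The axiom of infinity. -/
def AxInfinity (V : Type) [SetStr V] : Prop :=
  ∃ z : V, S z ∧ (∃ o, IsZero o ∧ o ∈ᵛ z) ∧ ∀ y, y ∈ᵛ z → ∃ s, IsSucc s y ∧ s ∈ᵛ z

/-- The axiom of choice. -/
def AxChoice (V : Type) [SetStr V] : Prop :=
  ∀ x : V, (S x ∧ (∀ y, y ∈ᵛ x → S y ∧ ∃ t, t ∈ᵛ y) ∧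
    ∀ y z, (y ∈ᵛ x ∧ z ∈ᵛ x ∧ ¬ y = z) → ∀ t, ¬ (t ∈ᵛ y ∧ t ∈ᵛ z)) →
    ∃ u, S u ∧ ∀ y, y ∈ᵛ x → ∃ v, ∀ t, (t ∈ᵛ y ∧ t ∈ᵛ u) ↔ t = v

theorem models_of_basicSet [BasicSet V] (hi : AxInfinity V) (hc : AxChoice V) : Models V ZFU.Ax := by
  intro φ hφ e
  cases hφ with
  | eqRefl => simp
  | eqSubst A =>
    simp only [sat_all, sat_imp, sat_rename, sat_eq, cons_zero, cons_succ]
    rintro x _ rfl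
    refine fun h => (iff_of_eq (congrArg _ ?_)).1 h
    funext n; cases n <;> rfl
  | memSet => simpa using fun x y h => BasicSet.isSet_of_mem h
  | ext => simpa using fun x y h h' h'' => BasicSet.ext h h' h''
  | pairing => simpa using BasicSet.pairing
  | union => simpa [and_comm] using fun (x : V) (h : S x) => BasicSet.union h
  | power => simpa using fun x h => BasicSet.power h
  | separation A =>
    simp only [sat_all, sat_imp, sat_ex, sat_and, sat_iff, sat_S, sat_mem, sat_rename, cons_zero,
        cons_succ]
    intro x hx
    obtain ⟨z, hz, h⟩ := BasicSet.separation A (cons x e) hx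
    refine ⟨z, hz, fun t => (h t).trans (and_congr_right fun _ => iff_of_eq (congrArg _ ?_))⟩
    funext n; cases n <;> rfl
  | infinity => simpa [AxInfinity] using hi
  | regularity => simpa using fun x h y h' => BasicSet.regularity h ⟨y, h'⟩
  | replacement A =>
    simp only [sat_all, sat_imp, sat_ex, sat_and, sat_iff, sat_S, sat_mem, sat_eq, sat_rename,
        cons_zero, cons_succ]
    rintro u ⟨hu, h⟩
    obtain ⟨z, hz, h⟩ := BasicSet.replacement A (cons u e) hu (fun w hw => by
      obtain ⟨s, hs, hs'⟩ := h w hw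
      refine ⟨s, hs, fun r hr => hs' r ?_⟩
      refine (iff_of_eq (congrArg _ ?_)).1 hr
      funext n; cases n <;> rfl)
    refine ⟨z, hz,
        fun t => (h t).trans (exists_congr fun w => and_congr_right fun _ => iff_of_eq (congrArg _ ?_))⟩
    funext n
    match n with
    | 0 => rfl
    | 1 => rfl
    | n + 2 => rfl
  | choice => simpa [AxChoice] using hc

theorem basicSet_of_models [Nonempty V] (h : Models V ZFU.Ax) :
    BasicSet V ∧ AxInfinity V ∧ AxChoice V := by
  have e₀ : ℕ → V := fun _ => Classical.arbitrary V
  refine ⟨?_, ?_, ?_⟩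
  · refine
    { nonempty := inferInstance
      isSet_of_mem := fun {x y} => by simpa using h _ .memSet e₀ x y
      ext := fun {x y} => by simpa using h _ .ext e₀ x y
      pairing := fun a b => by simpa using h _ .pairing e₀ a b
      union := fun {x} => by simpa [and_comm] using h _ .union e₀ x
      power := fun {x} => by simpa using h _ .power e₀ x
      regularity := fun {x} => by simpa using h _ .regularity e₀ x
      separation := fun A e x hx => ?_
      replacement := fun A e u hu hA => ?_ }
    -- The axiom reserves the variable `1` for the given set; the renaming makes `A` skip it.
    · have := h _ (.separation (A.rename (fun n => match n with | 0 => 0 | k + 1 => k + 2))) e x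
      simp only [sat_imp, sat_ex, sat_and, sat_all, sat_iff, sat_S, sat_mem, sat_rename,
          cons_zero, cons_succ] at this
      obtain ⟨z, hz, hz'⟩ := this hx
      refine ⟨z, hz, fun t => (hz' t).trans (and_congr_right fun _ => iff_of_eq (congrArg _ ?_))⟩
      funext n; cases n <;> rfl
    · have := h _ (.replacement (A.rename (fun n => match n with | 0 => 0 | 1 => 1 | k + 2 => k + 3))) e u
      simp only [sat_imp, sat_ex, sat_and, sat_all, sat_iff, sat_S, sat_mem, sat_eq, sat_rename,
          cons_zero, cons_succ] at this
      obtain ⟨z, hz, hz'⟩ := this ⟨hu, fun w hw => by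
        obtain ⟨s, hs, hs'⟩ := hA w hw
        refine ⟨s, (iff_of_eq (congrArg _ ?_)).1 hs,
            fun r hr => hs' r ((iff_of_eq (congrArg _ ?_)).1 hr)⟩
        all_goals
          funext n
          match n with
          | 0 => rfl
          | 1 => rfl
          | n + 2 => rfl⟩
      refine ⟨z, hz,
          fun t => (hz' t).trans (exists_congr fun w => and_congr_right fun _ => iff_of_eq (congrArg _ ?_))⟩
      funext n
      match n with
      | 0 => rfl
      | 1 => rfl
      | n + 2 => rfl
  · simpa [AxInfinity] using h _ .infinity e₀
  · simpa [AxChoice] using h _ .choice e₀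

end Notions

/-! ## Elementary set theory in a structure -/

section Elementary

variable {V : Type} [SetStr V] [BasicSet V]

attribute [instance] BasicSet.nonempty

/-- Lets later arguments separate by a plain predicate, without writing a formula. As only `e 0`
matters, all even variables of the defining formula can be read as `t`. -/
theorem sep (P : V → Prop) [h : Dfn fun e : ℕ → V => P (e 0)] {x : V} (hx : S x) :
    ∃ z, S z ∧ ∀ t, t ∈ᵛ z ↔ t ∈ᵛ x ∧ P t := by
  obtain ⟨A, p, hA⟩ := h.out
  obtain ⟨z, hz, hz'⟩ := BasicSet.separation
    (A.rename fun n => if n % 2 = 0 then 0 else n / 2 + 1) p hx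
  refine ⟨z, hz, fun t => (hz' t).trans (and_congr_right fun _ => ?_)⟩
  rw [hA fun _ => t, sat_rename]
  refine iff_of_eq (congrArg _ ?_)
  funext n
  by_cases hn : n % 2 = 0 <;> simp [hn, weave]

theorem repl (R : V → V → Prop) [h : Dfn fun e : ℕ → V => R (e 0) (e 1)] {u : V} (hu : S u)
    (hR : ∀ w, w ∈ᵛ u → ∃ s, R w s ∧ ∀ r, R w r → r = s) :
    ∃ z, S z ∧ ∀ s, s ∈ᵛ z ↔ ∃ w, w ∈ᵛ u ∧ R w s := by
  obtain ⟨A, p, hA⟩ := h.out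
  -- The relation is evaluated at the assignment `w, s, s, …`: even indices mean `w` at `0` and `s`
  -- elsewhere, and the parameters come after these two variables.
  let B := A.rename fun n => if n % 2 = 0 then (if n = 0 then 1 else 0) else n / 2 + 2
  have hB : ∀ w s, R w s ↔ Sat B (cons s (cons w p)) := fun w s => by
    rw [show R w s ↔ _ from hA (cons w fun _ => s), sat_rename]
    refine iff_of_eq (congrArg _ ?_)
    funext n
    rcases Nat.even_or_odd' n with ⟨k, rfl | rfl⟩
    · rw [weave_even]
      cases k with
      | zero => rfl
      | succ k => simp
    · have : (2 * k + 1) / 2 = k := by omega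
      rw [weave_odd]
      simp [this, Nat.add_mod]
  simp only [hB] at hR ⊢
  exact BasicSet.replacement B p hu hR

theorem exists_empty : ∃ z : V, IsZero z := by
  obtain ⟨p, hp, -⟩ := BasicSet.pairing (Classical.arbitrary V) (Classical.arbitrary V)
  obtain ⟨z, hz, h⟩ := sep (fun t => ¬ t = t) hp
  exact ⟨z, hz, fun t ht => ((h t).1 ht).2 rfl⟩

theorem exists_union (x y : V) : ∃ z, IsUnion z x y := by
  obtain ⟨p, hp, h⟩ := BasicSet.pairing x y
  obtain ⟨z, hz, h'⟩ := BasicSet.union hp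
  exact ⟨z, hz, fun t => by simp [h', h]⟩

variable (V) in
/-- The empty set. -/
noncomputable def emp : V := exists_empty.choose
/-- The set of `a` and `b`. -/
noncomputable def upair (a b : V) : V := (BasicSet.pairing a b).choose
/-- The union of `x` and `y`. -/
noncomputable def cup (x y : V) : V := (exists_union x y).choose
/-- Ordered pairs. -/
noncomputable def pr (a b : V) : V := upair (upair a a) (upair a b)
/-- The set `x ∪ {x}`. -/
noncomputable def succ (x : V) : V := cup x (upair x x)

theorem isZero_emp : IsZero (emp V) := exists_empty.choose_spec
theorem not_mem_emp (t : V) : ¬ t ∈ᵛ emp V := isZero_emp.2 t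
theorem isUPair_upair (a b : V) : IsUPair (upair a b) a b := (BasicSet.pairing a b).choose_spec
theorem isSet_upair (a b : V) : S (upair a b) := (isUPair_upair a b).1
@[simp] theorem mem_upair {a b t : V} : t ∈ᵛ upair a b ↔ t = a ∨ t = b := (isUPair_upair a b).2 t
theorem isSet_cup (a b : V) : S (cup a b) := (exists_union a b).choose_spec.1
@[simp] theorem mem_cup {a b t : V} : t ∈ᵛ cup a b ↔ t ∈ᵛ a ∨ t ∈ᵛ b := (exists_union a b).choose_spec.2 t
theorem isSet_succ (a : V) : S (succ a) := isSet_cup _ _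
@[simp] theorem mem_succ {a t : V} : t ∈ᵛ succ a ↔ t ∈ᵛ a ∨ t = a := by simp [succ]

theorem isUPair_iff {z a b : V} : IsUPair z a b ↔ z = upair a b :=
  ⟨fun h => BasicSet.ext h.1 (isSet_upair a b) fun t => (h.2 t).trans mem_upair.symm,
    by rintro rfl; exact isUPair_upair a b⟩

theorem isPair_iff {p a b : V} : IsPair p a b ↔ p = pr a b := by
  refine ⟨fun h => BasicSet.ext h.1 (isSet_upair _ _) fun t => ?_, ?_⟩
  · simp [h.2, isUPair_iff, pr]
  · rintro rfl
    exact ⟨isSet_upair _ _, fun t => by simp [pr, isUPair_iff]⟩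

theorem isSucc_iff {z x : V} : IsSucc z x ↔ z = succ x :=
  ⟨fun h => BasicSet.ext h.1 (isSet_succ x) fun t => (h.2 t).trans mem_succ.symm,
    by rintro rfl; exact ⟨isSet_succ x, fun t => mem_succ⟩⟩

theorem isZero_iff {z : V} : IsZero z ↔ z = emp V :=
  ⟨fun h => BasicSet.ext h.1 isZero_emp.1 fun t => iff_of_false (h.2 t) (not_mem_emp t),
    by rintro rfl; exact isZero_emp⟩

theorem isOne_iff {z : V} : IsOne z ↔ z = upair (emp V) (emp V) := by
  refine ⟨fun h => BasicSet.ext h.1 (isSet_upair _ _) fun t => by simp [h.2, isZero_iff], ?_⟩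
  rintro rfl
  exact ⟨isSet_upair _ _, fun t => by simp [isZero_iff]⟩

theorem upair_inj {a b c d : V} (h : upair a b = upair c d) :
    (a = c ∨ a = d) ∧ (b = c ∨ b = d) ∧ (c = a ∨ c = b) ∧ (d = a ∨ d = b) := by
  refine ⟨?_, ?_, ?_, ?_⟩
  · exact mem_upair.1 (h ▸ mem_upair.2 (Or.inl rfl))
  · exact mem_upair.1 (h ▸ mem_upair.2 (Or.inr rfl))
  · exact mem_upair.1 (h ▸ mem_upair.2 (Or.inl rfl))
  · exact mem_upair.1 (h ▸ mem_upair.2 (Or.inr rfl))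

theorem pr_inj {a b c d : V} : pr a b = pr c d ↔ a = c ∧ b = d := by
  refine ⟨fun h => ?_, by rintro ⟨rfl, rfl⟩; rfl⟩
  obtain ⟨h₁, h₂, h₃, h₄⟩ := upair_inj h
  have ac : a = c := by
    rcases h₁ with h₁ | h₁
    · rcases (upair_inj h₁).1 with h | h <;> exact h
    · rcases (upair_inj h₁).2.2.1 with h | h <;> exact h.symm
  subst ac
  refine ⟨rfl, ?_⟩
  rcases h₂ with h₂ | h₂
  · have hb : b = a := by rcases (upair_inj h₂).2.1 with h | h <;> exact h
    subst hb
    rcases h₄ with h₄ | h₄ <;> rcases (upair_inj h₄).2.1 with h | h <;> exact h.symm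
  · rcases (upair_inj h₂).2.1 with h | h
    · subst h
      rcases (upair_inj h₂).2.2.2 with h | h <;> exact h.symm
    · exact h

theorem pairMem_iff {a b f : V} : PairMem a b f ↔ pr a b ∈ᵛ f := by
  simp [PairMem, isPair_iff]

/-- Regularity for a definable class with an element that is contained in a set. -/
theorem exists_minimal (P : V → Prop) [Dfn fun e : ℕ → V => P (e 0)] {x a : V} (hx : S x)
    (ha : a ∈ᵛ x) (hP : P a) :
    ∃ y, y ∈ᵛ x ∧ P y ∧ ∀ t, t ∈ᵛ y → t ∈ᵛ x → ¬ P t := by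
  obtain ⟨z, hz, h⟩ := sep P hx
  obtain ⟨y, hy, hy'⟩ := BasicSet.regularity hz ⟨a, (h a).2 ⟨ha, hP⟩⟩
  exact ⟨y, ((h y).1 hy).1, ((h y).1 hy).2, fun t ht htx hPt => hy' t ⟨ht, (h t).2 ⟨htx, hPt⟩⟩⟩

theorem not_mem_cycle {a b c : V} (h₁ : a ∈ᵛ b) (h₂ : b ∈ᵛ c) : ¬ c ∈ᵛ a := by
  intro h₃
  obtain ⟨y, hy, hy'⟩ := BasicSet.regularity (isSet_cup (upair a b) (upair c c))
    ⟨a, by simp⟩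
  simp only [mem_cup, mem_upair, or_self] at hy hy'
  rcases hy with (rfl | rfl) | rfl
  · exact hy' _ ⟨h₃, by simp⟩
  · exact hy' _ ⟨h₁, by simp⟩
  · exact hy' _ ⟨h₂, by simp⟩

theorem not_mem_self (a : V) : ¬ a ∈ᵛ a := fun h => not_mem_cycle h h h

theorem not_mem_symm {a b : V} (h : a ∈ᵛ b) : ¬ b ∈ᵛ a := by
  intro h'
  obtain ⟨y, hy, hy'⟩ := BasicSet.regularity (isSet_upair a b) ⟨a, by simp⟩
  simp only [mem_upair] at hy hy'
  rcases hy with rfl | rfl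
  · exact hy' _ ⟨h', by simp⟩
  · exact hy' _ ⟨h, by simp⟩

/-! ### Equinumerous sets -/

/-- `R` is the graph of an injection on `x` into `y`. -/
def InjOn (R : V → V → Prop) (x y : V) : Prop :=
  (∀ a, a ∈ᵛ x → ∃ b, b ∈ᵛ y ∧ R a b) ∧
    ∀ a a' b b', a ∈ᵛ x → a' ∈ᵛ x → b ∈ᵛ y → b' ∈ᵛ y → R a b → R a' b' → (a = a' ↔ b = b')

/-- A binary relation that is definable with parameters. -/
def DRel (R : V → V → Prop) : Prop := Dfn fun e : ℕ → V => R (e 0) (e 1)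

theorem DRel.comp {R : V → V → Prop} (h : DRel R) (t s : (ℕ → V) → V) [DT t] [DT s] :
    Dfn fun e => R (t e) (s e) := Dfn.comp₂ h t s

theorem equinum_of_injOn {R : V → V → Prop} {x y : V} (hR : DRel R) (hx : S x) (hy : S y)
    (h : InjOn R x y) (hs : ∀ b, b ∈ᵛ y → ∃ a, a ∈ᵛ x ∧ R a b) : Equinum x y := by
  have := hR.comp
  -- Ordered pairs of elements of `x` and `y` lie in the double power set of `x ∪ y`.
  obtain ⟨P₁, hP₁, h₁⟩ := BasicSet.power (isSet_cup x y)
  obtain ⟨P₂, hP₂, h₂⟩ := BasicSet.power hP₁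
  obtain ⟨f, hf, hf'⟩ := sep (fun p => ∃ a b, a ∈ᵛ x ∧ b ∈ᵛ y ∧ IsPair p a b ∧ R a b) hP₂
  have hmem : ∀ a b, PairMem a b f ↔ a ∈ᵛ x ∧ b ∈ᵛ y ∧ R a b := by
    intro a b
    simp only [pairMem_iff, hf', isPair_iff, pr_inj]
    refine ⟨fun ⟨_, c, d, h₁, h₂, ⟨h₃, h₄⟩, h₅⟩ => by subst h₃ h₄; exact ⟨h₁, h₂, h₅⟩,
      fun ⟨ha, hb, hab⟩ => ⟨(h₂ _).2 ⟨isSet_upair _ _, fun t ht => (h₁ t).2 ?_⟩, a, b, ha, hb, ⟨rfl, rfl⟩, hab⟩⟩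
    rcases mem_upair.1 ht with rfl | rfl
    · exact ⟨isSet_upair _ _, fun s hs => by simp at hs; simp [hs, ha]⟩
    · refine ⟨isSet_upair _ _, fun s hs => ?_⟩
      rcases mem_upair.1 hs with rfl | rfl <;> simp [ha, hb]
  refine ⟨hx, hy, f, ⟨hf, fun p hp => ?_, fun a ha => ?_⟩, fun b hb => ?_⟩
  · obtain ⟨-, a, b, h₁, h₂, h₃, -⟩ := (hf' p).1 hp
    exact ⟨a, b, h₁, h₂, h₃⟩
  · obtain ⟨b, hb, hab⟩ := h.1 a ha
    refine ⟨b, (hmem _ _).2 ⟨ha, hb, hab⟩, fun c hc => ?_⟩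
    obtain ⟨-, hc, hac⟩ := (hmem _ _).1 hc
    exact (h.2 _ _ _ _ ha ha hc hb hac hab).1 rfl
  · obtain ⟨a, ha, hab⟩ := hs b hb
    refine ⟨a, (hmem _ _).2 ⟨ha, hb, hab⟩, fun c hc => ?_⟩
    obtain ⟨hc, -, hac⟩ := (hmem _ _).1 hc
    exact (h.2 _ _ _ _ hc ha hb hb hac hab).2 rfl

theorem Equinum.exists_injOn {x y : V} (h : Equinum x y) :
    ∃ R, DRel R ∧ InjOn R x y ∧ ∀ b, b ∈ᵛ y → ∃ a, a ∈ᵛ x ∧ R a b := by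
  obtain ⟨hx, hy, f, ⟨hf, h₁, h₂⟩, h₃⟩ := h
  have hmem : ∀ a b, PairMem a b f → a ∈ᵛ x ∧ b ∈ᵛ y := by
    rintro a b ⟨p, hp, hab⟩
    obtain ⟨c, d, hc, hd, hcd⟩ := h₁ p hp
    rw [isPair_iff] at hcd hab
    obtain ⟨rfl, rfl⟩ := pr_inj.1 (hcd.symm.trans hab)
    exact ⟨hc, hd⟩
  refine ⟨fun a b => PairMem a b f, by unfold DRel; infer_instance, ⟨fun a ha => ?_, ?_⟩, fun b hb => ?_⟩
  · obtain ⟨b, hb, -⟩ := h₂ a ha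
    exact ⟨b, (hmem _ _ hb).2, hb⟩
  · intro a a' b b' ha ha' hb hb' hab hab'
    obtain ⟨c, -, hc⟩ := h₂ a ha
    obtain ⟨d, -, hd⟩ := h₃ b hb
    constructor
    · rintro rfl
      exact (hc _ hab).trans (hc _ hab').symm
    · rintro rfl
      exact (hd _ hab).trans (hd _ hab').symm
  · obtain ⟨a, ha, -⟩ := h₃ b hb
    exact ⟨a, (hmem _ _ ha).1, ha⟩

theorem Equinum.refl {x : V} (hx : S x) : Equinum x x :=
  equinum_of_injOn (R := fun a b => a = b) (by unfold DRel; infer_instance) hx hx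
    ⟨fun a ha => ⟨a, ha, rfl⟩, by rintro a a' _ _ - - - - rfl rfl; rfl⟩ fun b hb => ⟨b, hb, rfl⟩

theorem Equinum.symm {x y : V} (h : Equinum x y) : Equinum y x := by
  obtain ⟨R, hR, h₁, h₂⟩ := h.exists_injOn
  have := hR.comp
  exact equinum_of_injOn (R := fun a b => R b a) (by unfold DRel; infer_instance) h.2.1 h.1
    ⟨h₂, fun a a' b b' ha ha' hb hb' hab hab' => (h₁.2 _ _ _ _ hb hb' ha ha' hab hab').symm⟩ h₁.1

theorem Equinum.trans {x y z : V} (h : Equinum x y) (h' : Equinum y z) : Equinum x z := by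
  obtain ⟨R, hR, h₁, h₂⟩ := h.exists_injOn
  obtain ⟨T, hT, h₃, h₄⟩ := h'.exists_injOn
  have := hR.comp
  have := hT.comp
  refine equinum_of_injOn (R := fun a c => ∃ b, b ∈ᵛ y ∧ R a b ∧ T b c)
    (by unfold DRel; infer_instance) h.1 h'.2.1 ⟨fun a ha => ?_, ?_⟩ fun c hc => ?_
  · obtain ⟨b, hb, hab⟩ := h₁.1 a ha
    obtain ⟨c, hc, hbc⟩ := h₃.1 b hb
    exact ⟨c, hc, b, hb, hab, hbc⟩
  · rintro a a' c c' ha ha' hc hc' ⟨b, hb, hab, hbc⟩ ⟨b', hb', hab', hbc'⟩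
    exact (h₁.2 _ _ _ _ ha ha' hb hb' hab hab').trans (h₃.2 _ _ _ _ hb hb' hc hc' hbc hbc')
  · obtain ⟨b, hb, hbc⟩ := h₄ c hc
    obtain ⟨a, ha, hab⟩ := h₂ b hb
    exact ⟨a, ha, b, hb, hab, hbc⟩

/-- A definable injection gives an equinumerous image. -/
theorem exists_image {R : V → V → Prop} {x y : V} (hR : DRel R) (hx : S x) (hy : S y)
    (h : InjOn R x y) : ∃ z, S z ∧ Sub z y ∧ Equinum x z ∧
      ∀ b, b ∈ᵛ z ↔ b ∈ᵛ y ∧ ∃ a, a ∈ᵛ x ∧ R a b := by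
  have := hR.comp
  obtain ⟨z, hz, hz'⟩ := sep (fun b => ∃ a, a ∈ᵛ x ∧ R a b) hy
  refine ⟨z, hz, fun t ht => ((hz' t).1 ht).1, equinum_of_injOn hR hx hz ⟨fun a ha => ?_, ?_⟩
    (fun b hb => ((hz' b).1 hb).2), hz'⟩
  · obtain ⟨b, hb, hab⟩ := h.1 a ha
    exact ⟨b, (hz' b).2 ⟨hb, a, ha, hab⟩, hab⟩
  · exact fun a a' b b' ha ha' hb hb' => h.2 a a' b b' ha ha' ((hz' b).1 hb).1 ((hz' b').1 hb').1

/-- The Cantor-Bernstein theorem. -/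
theorem equinum_of_injOn_injOn {R T : V → V → Prop} {x y : V} (hR : DRel R) (hT : DRel T)
    (hx : S x) (hy : S y) (h : InjOn R x y) (h' : InjOn T y x) : Equinum x y := by
  have := hR.comp
  have := hT.comp
  -- `C` will be the least part of `x` that contains everything outside the range of `T` and is
  -- closed under `R` followed by `T`. The bijection is `R` on `C` and the inverse of `T` off `C`.
  let closed : V → Prop := fun D => (∀ a, a ∈ᵛ x → (¬ ∃ b, b ∈ᵛ y ∧ T b a) → a ∈ᵛ D) ∧
    ∀ a b c, a ∈ᵛ D → a ∈ᵛ x → b ∈ᵛ y → c ∈ᵛ x → R a b → T b c → c ∈ᵛ D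
  have hclosed : Dfn fun e => closed (e 0) := by dsimp only [closed]; infer_instance
  have := fun t [DT t] => hclosed.comp₁ t
  obtain ⟨C, hC, hC'⟩ := sep (fun a => ∀ D, closed D → a ∈ᵛ D) hx
  have hCc : closed C := by
    refine ⟨fun a ha hn => (hC' a).2 ⟨ha, fun D hD => hD.1 a ha hn⟩, ?_⟩
    exact fun a b c ha hax hb hc hab hbc => (hC' c).2 ⟨hc, fun D hD =>
      hD.2 a b c (((hC' a).1 ha).2 D hD) hax hb hc hab hbc⟩
  -- By minimality: the elements of `C` for which the claim holds already form a closed set.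
  have hfix : ∀ c, c ∈ᵛ C → (∃ b, b ∈ᵛ y ∧ T b c) →
      ∃ a b, a ∈ᵛ C ∧ a ∈ᵛ x ∧ b ∈ᵛ y ∧ R a b ∧ T b c := by
    intro c hc hb
    obtain ⟨D, hD, hD'⟩ := sep (fun c => (∃ b, b ∈ᵛ y ∧ T b c) →
      ∃ a b, a ∈ᵛ C ∧ a ∈ᵛ x ∧ b ∈ᵛ y ∧ R a b ∧ T b c) hC
    have : closed D := by
      refine ⟨fun a ha hn => (hD' a).2 ⟨hCc.1 a ha hn, fun hn' => (hn hn').elim⟩, ?_⟩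
      intro a b c ha hax hb hc hab hbc
      have ha' := ((hD' a).1 ha).1
      exact (hD' c).2 ⟨hCc.2 a b c ha' hax hb hc hab hbc, fun _ => ⟨a, b, ha', hax, hb, hab, hbc⟩⟩
    exact ((hD' c).1 (((hC' c).1 hc).2 D this)).2 hb
  refine equinum_of_injOn (R := fun a b => (a ∈ᵛ C ∧ R a b) ∨ (¬ a ∈ᵛ C ∧ T b a))
    (by unfold DRel; infer_instance) hx hy ⟨fun a ha => ?_, ?_⟩ fun b hb => ?_
  · by_cases haC : a ∈ᵛ C
    · obtain ⟨b, hb, hab⟩ := h.1 a ha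
      exact ⟨b, hb, Or.inl ⟨haC, hab⟩⟩
    · have : ∃ b, b ∈ᵛ y ∧ T b a := by
        by_contra hn
        exact haC (hCc.1 a ha hn)
      obtain ⟨b, hb, hab⟩ := this
      exact ⟨b, hb, Or.inr ⟨haC, hab⟩⟩
  · rintro a a' b b' ha ha' hb hb' (⟨h₁, h₂⟩ | ⟨h₁, h₂⟩) (⟨h₃, h₄⟩ | ⟨h₃, h₄⟩)
    · exact h.2 _ _ _ _ ha ha' hb hb' h₂ h₄
    · refine iff_of_false (by rintro rfl; exact h₃ h₁) ?_
      rintro rfl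
      exact h₃ (hCc.2 a b a' h₁ ha hb ha' h₂ h₄)
    · refine iff_of_false (by rintro rfl; exact h₁ h₃) ?_
      rintro rfl
      exact h₁ (hCc.2 a' b a h₃ ha' hb ha h₄ h₂)
    · exact (h'.2 _ _ _ _ hb hb' ha ha' h₂ h₄).symm
  · obtain ⟨c, hc, hbc⟩ := h'.1 b hb
    by_cases hcC : c ∈ᵛ C
    · obtain ⟨a, b', haC, ha, hb', hab, hbc'⟩ := hfix c hcC ⟨b, hb, hbc⟩
      obtain rfl := (h'.2 _ _ _ _ hb hb' hc hc hbc hbc').2 rfl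
      exact ⟨a, ha, Or.inl ⟨haC, hab⟩⟩
    · exact ⟨c, hc, Or.inr ⟨hcC, hbc⟩⟩

/-! ### Ordinals -/

omit [BasicSet V] in
theorem IsOrd.trans {x y z : V} (hx : IsOrd x) (hy : y ∈ᵛ x) (hz : z ∈ᵛ y) : z ∈ᵛ x :=
  (hx.2.1 y hy).2 z hz

theorem IsOrd.mem {x y : V} (hx : IsOrd x) (hy : y ∈ᵛ x) : IsOrd y := by
  refine ⟨(hx.2.1 y hy).1, fun t ht => ⟨(hx.2.1 t (hx.trans hy ht)).1, fun z hz => ?_⟩,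
    fun s t h => hx.2.2 s t ⟨hx.trans hy h.1, hx.trans hy h.2⟩⟩
  rcases hx.2.2 z y ⟨hx.trans (hx.trans hy ht) hz, hy⟩ with h | rfl | h
  · exact h
  · exact (not_mem_symm hz ht).elim
  · exact (not_mem_cycle h hz ht).elim

/-- An ∈-minimal element of `a` outside `c` has exactly the elements of `c`, so it is `c`. -/
theorem IsOrd.mem_of_sub {a c : V} (ha : IsOrd a) (hc : IsOrd c) (h : Sub c a) (hne : c ≠ a) :
    c ∈ᵛ a := by
  have : ∃ t, t ∈ᵛ a ∧ ¬ t ∈ᵛ c := by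
    by_contra hn
    push Not at hn
    exact hne (BasicSet.ext hc.1 ha.1 fun t => ⟨h t, hn t⟩)
  obtain ⟨t, hta, htc⟩ := this
  obtain ⟨d, hda, hdc, hd⟩ := exists_minimal (fun t => ¬ t ∈ᵛ c) ha.1 hta htc
  have : c = d := BasicSet.ext hc.1 (ha.mem hda).1 fun s => by
    refine ⟨fun hs => ?_, fun hs => not_not.1 (hd s hs (ha.trans hda hs))⟩
    rcases ha.2.2 s d ⟨h s hs, hda⟩ with h | rfl | h
    · exact h
    · exact (hdc hs).elim
    · exact (hdc (hc.trans hs h)).elim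
  exact this ▸ hda

/-- The intersection of `a` and `b` is an ordinal. If it differed from both, it would belong to
both, hence to itself. -/
theorem IsOrd.trichotomy {a b : V} (ha : IsOrd a) (hb : IsOrd b) :
    a ∈ᵛ b ∨ a = b ∨ b ∈ᵛ a := by
  obtain ⟨c, hc, hc'⟩ := sep (fun t => t ∈ᵛ b) ha.1
  have hco : IsOrd c := by
    refine ⟨hc, fun y hy => ?_, fun y z h => ha.2.2 y z ⟨((hc' y).1 h.1).1, ((hc' z).1 h.2).1⟩⟩
    obtain ⟨h₁, h₂⟩ := (hc' y).1 hy
    exact ⟨(ha.2.1 y h₁).1, fun z hz => (hc' z).2 ⟨ha.trans h₁ hz, hb.trans h₂ hz⟩⟩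
  by_cases h₁ : c = a
  · subst h₁
    by_cases h₂ : c = b
    · exact Or.inr (Or.inl h₂)
    · exact Or.inl (hb.mem_of_sub hco (fun t ht => ((hc' t).1 ht).2) h₂)
  · have hca := ha.mem_of_sub hco (fun t ht => ((hc' t).1 ht).1) h₁
    by_cases h₂ : c = b
    · exact Or.inr (Or.inr (h₂ ▸ hca))
    · have hcb := hb.mem_of_sub hco (fun t ht => ((hc' t).1 ht).2) h₂
      exact (not_mem_self c ((hc' c).2 ⟨hca, hcb⟩)).elim

theorem IsOrd.sub_iff {a b : V} (ha : IsOrd a) (hb : IsOrd b) :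
    Sub a b ↔ a ∈ᵛ b ∨ a = b := by
  refine ⟨fun h => or_iff_not_imp_right.2 (hb.mem_of_sub ha h), ?_⟩
  rintro (h | rfl)
  · exact (hb.2.1 a h).2
  · exact fun t ht => ht

theorem isOrd_of_forall {x : V} (hx : S x) (h : ∀ y, y ∈ᵛ x → IsOrd y ∧ Sub y x) : IsOrd x :=
  ⟨hx, fun y hy => ⟨(h y hy).1.1, (h y hy).2⟩, fun y z hyz => (h y hyz.1).1.trichotomy (h z hyz.2).1⟩

theorem isOrd_emp : IsOrd (emp V) :=
  isOrd_of_forall isZero_emp.1 fun y hy => (not_mem_emp y hy).elim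

theorem IsOrd.succ {a : V} (ha : IsOrd a) : IsOrd (succ a) := by
  refine isOrd_of_forall (isSet_succ a) fun y hy => ?_
  rcases mem_succ.1 hy with h | rfl
  · exact ⟨ha.mem h, fun t ht => mem_succ.2 (Or.inl (ha.trans h ht))⟩
  · exact ⟨ha, fun t ht => mem_succ.2 (Or.inl ht)⟩

theorem IsOrd.succ_mem_or {a b : V} (hb : IsOrd b) (h : a ∈ᵛ b) :
    QST.succ a ∈ᵛ b ∨ QST.succ a = b := by
  refine (hb.mem h).succ.sub_iff hb |>.1 fun t ht => ?_
  rcases mem_succ.1 ht with h' | rfl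
  · exact hb.trans h h'
  · exact h

theorem IsOrd.emp_mem_or {a : V} (ha : IsOrd a) : emp V ∈ᵛ a ∨ emp V = a :=
  (isOrd_emp.sub_iff ha).1 fun t ht => (not_mem_emp t ht).elim

theorem IsOrd.exists_least (P : V → Prop) [Dfn fun e : ℕ → V => P (e 0)] {a : V} (ha : IsOrd a)
    (hP : P a) : ∃ b, (b ∈ᵛ a ∨ b = a) ∧ IsOrd b ∧ P b ∧ ∀ c, c ∈ᵛ b → ¬ P c := by
  obtain ⟨b, hb, hPb, h⟩ := exists_minimal P (isSet_succ a) (mem_succ.2 (Or.inr rfl)) hP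
  exact ⟨b, mem_succ.1 hb, ha.succ.mem hb, hPb, fun c hc => h c hc (ha.succ.trans hb hc)⟩

/-- An ordinal that is not a natural number yields the axiom of infinity. -/
theorem axInfinity_of_not_isNat {a : V} (ha : IsOrd a) (h : ¬ IsNat a) : AxInfinity V := by
  simp only [IsNat, ha, true_and] at h
  push Not at h
  obtain ⟨l, hl, h₀, h₁⟩ := h
  have hlo : IsOrd l := by
    rcases hl with hl | rfl
    exacts [ha.mem hl, ha]
  -- An ordinal that is neither zero nor a successor is itself an inductive set.
  refine ⟨l, hlo.1, ⟨emp V, isZero_emp, ?_⟩, fun y hy => ⟨succ y, isSucc_iff.2 rfl, ?_⟩⟩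
  · exact hlo.emp_mem_or.resolve_right fun h => h₀ (isZero_iff.2 h.symm)
  · exact (hlo.succ_mem_or hy).resolve_right fun h => h₁ y (isSucc_iff.2 h.symm)

/-- If every set is equinumerous with an ordinal, then the axiom of choice holds. -/
theorem axChoice_of_equinum_ord (h : ∀ x : V, S x → ∃ a, IsOrd a ∧ Equinum x a) : AxChoice V := by
  rintro x ⟨hx, hne, hdisj⟩
  obtain ⟨U, hU, hU'⟩ := BasicSet.union hx
  obtain ⟨a, ha, hUa⟩ := h U hU
  obtain ⟨R, hR, hR₁, -⟩ := hUa.exists_injOn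
  have := hR.comp
  -- `u` takes from each `y` the element to which `R` assigns the least ordinal.
  obtain ⟨u, hu, hu'⟩ := sep (fun v => ∃ y, y ∈ᵛ x ∧ v ∈ᵛ y ∧ ∃ b, b ∈ᵛ a ∧ R v b ∧
    ∀ w c, w ∈ᵛ y → c ∈ᵛ b → ¬ R w c) hU
  refine ⟨u, hu, fun y hy => ?_⟩
  obtain ⟨hyS, t, ht⟩ := hne y hy
  have hyU : ∀ {t}, t ∈ᵛ y → t ∈ᵛ U := fun {t} ht => (hU' t).2 ⟨y, hy, ht⟩
  obtain ⟨b, hb, htb⟩ := hR₁.1 t (hyU ht)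
  obtain ⟨c, hc, ⟨v, hv, hvc⟩, hmin⟩ := exists_minimal (fun b => ∃ v, v ∈ᵛ y ∧ R v b) ha.1 hb ⟨t,
      ht, htb⟩
  refine ⟨v, fun w => ⟨fun ⟨hw, hwu⟩ => ?_, ?_⟩⟩
  · obtain ⟨-, z, hz, hwz, d, hd, hwd, hmin'⟩ := (hu' w).1 hwu
    obtain rfl : y = z := by
      by_contra hyz
      exact hdisj y z ⟨hy, hz, hyz⟩ w ⟨hw, hwz⟩
    refine (hR₁.2 _ _ _ _ (hyU hw) (hyU hv) hd hc hwd hvc).2 ?_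
    rcases ha.2.2 d c ⟨hd, hc⟩ with h | h | h
    · exact (hmin d h hd ⟨w, hw, hwd⟩).elim
    · exact h
    · exact (hmin' v c hv h hvc).elim
  · rintro rfl
    exact ⟨hv, (hu' w).2 ⟨hyU hv, y, hy, hv, c, hc, hvc, fun v' c' hv' hc' hvc' =>
      hmin c' hc' (ha.trans hc hc') ⟨v', hv', hvc'⟩⟩⟩

end Elementary

/-! ## Structures for quasi-set theory -/

section QNotions

variable {X : Type} [LQ.Structure X]

open FirstOrder.Language.Structure in
def qm (x : X) : Prop := RelMap (L := LQ) QRel.m ![x]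
open FirstOrder.Language.Structure in
def qM (x : X) : Prop := RelMap (L := LQ) QRel.M ![x]
open FirstOrder.Language.Structure in
def qZ (x : X) : Prop := RelMap (L := LQ) QRel.Z ![x]
open FirstOrder.Language.Structure in
def qind (x y : X) : Prop := RelMap (L := LQ) QRel.ind ![x, y]
open FirstOrder.Language.Structure in
def qmem (x y : X) : Prop := RelMap (L := LQ) QRel.mem ![x, y]
open FirstOrder.Language.Structure in
/-- The quasi-cardinal. -/
def qcd (x : X) : X := funMap (L := LQ) QFun.qc ![x]

def qQ (x : X) : Prop := ¬ (qm x ∨ qM x)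
def qD (x : X) : Prop := qM x ∨ qZ x
/-- Extensional identity. -/
def qEq (x y : X) : Prop :=
  (qQ x ∧ qQ y ∧ ∀ z, qmem z x ↔ qmem z y) ∨ (qM x ∧ qM y ∧ ∀ z, qQ z → (qmem x z ↔ qmem y z))

section
variable (s t u : Qset.Tm) (e : ℕ → X) (a : X) (φ : Fml LQ) (n : ℕ)

theorem realize_vec_one : (fun i => (![t] i).realize e) = ![t.realize e] := by
  funext i; fin_cases i; rfl
theorem realize_vec_two : (fun i => (![t, s] i).realize e) = ![t.realize e, s.realize e] := by
  funext i; fin_cases i <;> rfl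

@[simp] theorem realize_v : (Qset.v n).realize e = e n := rfl
@[simp] theorem realize_sh : (Qset.sh t).realize (cons a e) = t.realize e := by
  rw [Qset.sh, FirstOrder.Language.Term.realize_relabel]; rfl
@[simp] theorem realize_qc : (Qset.qc t).realize e = qcd (t.realize e) := by
  simp only [Qset.qc, FirstOrder.Language.Term.realize, realize_vec_one, qcd]
@[simp] theorem sat_m : Sat (Qset.m t) e ↔ qm (t.realize e) := by
  simp only [Qset.m, Sat, realize_vec_one, qm]
@[simp] theorem sat_M : Sat (Qset.M t) e ↔ qM (t.realize e) := by
  simp only [Qset.M, Sat, realize_vec_one, qM]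
@[simp] theorem sat_Z : Sat (Qset.Z t) e ↔ qZ (t.realize e) := by
  simp only [Qset.Z, Sat, realize_vec_one, qZ]
@[simp] theorem sat_ind : Sat (Qset.ind t s) e ↔ qind (t.realize e) (s.realize e) := by
  simp only [Qset.ind, Sat, realize_vec_two, qind]
@[simp] theorem sat_qmem : Sat (Qset.mem t s) e ↔ qmem (t.realize e) (s.realize e) := by
  simp only [Qset.mem, Sat, realize_vec_two, qmem]
@[simp] theorem sat_Q : Sat (Qset.Q t) e ↔ qQ (t.realize e) := by simp [Qset.Q, qQ]
@[simp] theorem sat_D : Sat (Qset.D t) e ↔ qD (t.realize e) := by simp [Qset.D, qD]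
@[simp] theorem sat_allQ : Sat (Qset.allQ φ) e ↔ ∀ x, qQ x → Sat φ (cons x e) := by simp [Qset.allQ]
@[simp] theorem sat_exQ : Sat (Qset.exQ φ) e ↔ ∃ x, qQ x ∧ Sat φ (cons x e) := by simp [Qset.exQ]
@[simp] theorem sat_E : Sat (Qset.E t) e ↔ qQ (t.realize e) ∧ ∀ y, qmem y (t.realize e) → qQ y := by
  simp [Qset.E]
@[simp] theorem sat_eqE : Sat (Qset.eqE t s) e ↔ qEq (t.realize e) (s.realize e) := by
  simp [Qset.eqE, qEq]
@[simp] theorem sat_qsub :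
    Sat (Qset.sub t s) e ↔ ∀ y, qmem y (t.realize e) → qmem y (s.realize e) := by simp [Qset.sub]
@[simp] theorem sat_isEmpty :
    Sat (Qset.isEmpty t) e ↔ qQ (t.realize e) ∧ ∀ y, ¬ qmem y (t.realize e) := by simp [Qset.isEmpty]
@[simp] theorem sat_disj :
    Sat (Qset.disj t s) e ↔ ∀ y, ¬ (qmem y (t.realize e) ∧ qmem y (s.realize e)) := by
  simp [Qset.disj]
@[simp] theorem sat_qisUnion : Sat (Qset.isUnion t s u) e ↔ qQ (t.realize e) ∧
    ∀ y, qmem y (t.realize e) ↔ qmem y (s.realize e) ∨ qmem y (u.realize e) := by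
  simp [Qset.isUnion]
@[simp] theorem sat_isInter : Sat (Qset.isInter t s u) e ↔ qQ (t.realize e) ∧
    ∀ y, qmem y (t.realize e) ↔ qmem y (s.realize e) ∧ qmem y (u.realize e) := by
  simp [Qset.isInter]
@[simp] theorem sat_qisSucc : Sat (Qset.isSucc t s) e ↔ qQ (t.realize e) ∧
    ∀ y, qmem y (t.realize e) ↔ qmem y (s.realize e) ∨ qind y (s.realize e) := by
  simp [Qset.isSucc]
@[simp] theorem sat_isPower : Sat (Qset.isPower t s) e ↔ qQ (t.realize e) ∧
    ∀ y, qmem y (t.realize e) ↔ qQ y ∧ ∀ z, qmem z y → qmem z (s.realize e) := by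
  simp [Qset.isPower]
@[simp] theorem sat_isClass : Sat (Qset.isClass t s) e ↔ qQ (t.realize e) ∧
    ∃ w, qmem w (s.realize e) ∧ ∀ y, qmem y (t.realize e) ↔ qmem y (s.realize e) ∧ qind y w := by
  simp [Qset.isClass]
@[simp] theorem sat_QSim : Sat (Qset.QSim t s) e ↔
    (∀ y z, qmem y (t.realize e) ∧ qmem z (s.realize e) → qind y z) ∧
      qEq (qcd (t.realize e)) (qcd (s.realize e)) := by
  simp [Qset.QSim, Qset.Sim]
theorem sat_cl (A : Fml LZ) (ts : List Qset.Tm) :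
    Sat (Qset.cl A ts) e ↔ Sat (Qset.tr A) fun i => (ts.getD i (Qset.v i)).realize e := sat_subst _ _ _
end

@[simp] theorem tr_and (A B : Fml LZ) : Qset.tr (A ∧ᶠ B) = (Qset.tr A ∧ᶠ Qset.tr B) := by
  simp only [Fml.and, Qset.tr]
@[simp] theorem tr_S (n : ℕ) : Qset.tr (ZFU.S n) = Qset.Z (Qset.v n) := rfl

theorem sat_relD (n : ℕ) (φ : Fml LQ) (e : ℕ → X) :
    Sat (Qset.relD n φ) e ↔ ((∀ i < n, qD (e i)) → Sat φ e) := by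
  induction n generalizing φ with
  | zero => simp [Qset.relD]
  | succ n ih =>
    simp only [Qset.relD, ih, sat_imp, sat_D, realize_v]
    refine ⟨fun h h' => h (fun i hi => h' i (by omega)) (h' n (by omega)), fun h h' hn => h fun i hi => ?_⟩
    rcases Nat.lt_succ_iff_lt_or_eq.1 hi with hi | rfl
    exacts [h' i hi, hn]

end QNotions

/-! ### Bounds on the free variables of the classical notions and of translations -/

theorem trTerm_var (n : ℕ) : Qset.trTerm (.var n) = Qset.v n := rfl

theorem freeBelow_and {L : FirstOrder.Language.{0, 0}} {n : ℕ} {φ ψ : Fml L} :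
    (φ ∧ᶠ ψ).FreeBelow n ↔ φ.FreeBelow n ∧ ψ.FreeBelow n := by
  simp [Fml.and, Fml.FreeBelow]
theorem freeBelow_imp {L : FirstOrder.Language.{0, 0}} {n : ℕ} {φ ψ : Fml L} :
    (φ ⟶ᶠ ψ).FreeBelow n ↔ φ.FreeBelow n ∧ ψ.FreeBelow n := by
  simp [Fml.imp, Fml.FreeBelow]
theorem freeBelow_iff {L : FirstOrder.Language.{0, 0}} {n : ℕ} {φ ψ : Fml L} :
    (φ ⟷ᶠ ψ).FreeBelow n ↔ φ.FreeBelow n ∧ ψ.FreeBelow n := by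
  simp only [Fml.iff, freeBelow_and, freeBelow_imp]; tauto
theorem freeBelow_ex {L : FirstOrder.Language.{0, 0}} {n : ℕ} {φ : Fml L} :
    (Fml.ex φ).FreeBelow n ↔ φ.FreeBelow (n + 1) := by
  simp [Fml.ex, Fml.FreeBelow]
theorem freeBelow_S {n x : ℕ} : (ZFU.S x).FreeBelow n ↔ x < n := by
  simp [ZFU.S, Fml.FreeBelow, FirstOrder.Language.Term.varFinset]
theorem freeBelow_mem {n x y : ℕ} : (ZFU.mem x y).FreeBelow n ↔ x < n ∧ y < n := by
  simp [ZFU.mem, Fml.FreeBelow, FirstOrder.Language.Term.varFinset, Fin.forall_fin_two]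
theorem freeBelow_eq {n x y : ℕ} : (ZFU.eq x y).FreeBelow n ↔ x < n ∧ y < n := by
  simp [ZFU.eq, Fml.FreeBelow, FirstOrder.Language.Term.varFinset, Fin.forall_fin_two]

theorem freeBelow_isOrd : (ZFU.isOrd 0).FreeBelow 1 := by
  simp [ZFU.isOrd, ZFU.sub, freeBelow_and, freeBelow_imp, freeBelow_S, freeBelow_mem,
      freeBelow_eq, Fml.FreeBelow]

theorem freeBelow_equinum : (ZFU.equinum 0 1).FreeBelow 2 := by
  simp [ZFU.equinum, ZFU.isFun, ZFU.pairMem, ZFU.isPair, ZFU.isUPair, freeBelow_ex, freeBelow_iff,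
    freeBelow_and, freeBelow_imp, freeBelow_S, freeBelow_mem, freeBelow_eq, Fml.FreeBelow]

theorem freeBelow_isCardinal : (ZFU.isCardinal 0).FreeBelow 1 := by
  simp [ZFU.isCardinal, freeBelow_isOrd, freeBelow_equinum, freeBelow_and, freeBelow_imp,
    freeBelow_mem, Fml.FreeBelow]

theorem freeBelow_isCardinal' : (ZFU.isCardinal 1).FreeBelow 2 := by
  simp [ZFU.isCardinal, ZFU.isOrd, ZFU.sub, ZFU.equinum, ZFU.isFun, ZFU.pairMem, ZFU.isPair,
      ZFU.isUPair, freeBelow_ex, freeBelow_iff,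
    freeBelow_and, freeBelow_imp, freeBelow_S, freeBelow_mem, freeBelow_eq, Fml.FreeBelow]

theorem freeBelow_isCardOf : (ZFU.isCardOf 0 1).FreeBelow 2 := by
  simp [ZFU.isCardOf, freeBelow_isCardinal.mono, ZFU.equinum, ZFU.isFun, ZFU.pairMem, ZFU.isPair,
    ZFU.isUPair, freeBelow_ex, freeBelow_iff, freeBelow_and, freeBelow_imp, freeBelow_S,
    freeBelow_mem, freeBelow_eq, Fml.FreeBelow]

theorem freeBelow_cardLe : (ZFU.cardLe 0 1).FreeBelow 2 := by
  simp [ZFU.cardLe, freeBelow_and, freeBelow_isCardinal.mono, freeBelow_isCardinal', freeBelow_mem,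
    freeBelow_eq, Fml.FreeBelow]

theorem freeBelow_cardLt : (ZFU.cardLt 0 1).FreeBelow 2 := by
  simp [ZFU.cardLt, freeBelow_and, freeBelow_isCardinal.mono, freeBelow_isCardinal', freeBelow_mem]

theorem freeBelow_isNat : (ZFU.isNat 0).FreeBelow 1 := by
  simp [ZFU.isNat, ZFU.isZero, ZFU.isSucc, freeBelow_isOrd, freeBelow_ex, freeBelow_iff,
    freeBelow_and, freeBelow_imp, freeBelow_S, freeBelow_mem, freeBelow_eq, Fml.FreeBelow]

theorem freeBelow_tr (A : Fml LZ) : ∀ n, A.FreeBelow n → (Qset.tr A).FreeBelow n := by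
  induction A with
  | @rel k R ts =>
    intro n h
    have hts : ∀ i, ∃ m, ts i = .var m ∧ m < n := fun i => by
      have := h i
      cases hi : ts i with
      | var m => exact ⟨m, rfl, this m (by simp [hi, FirstOrder.Language.Term.varFinset])⟩
      | func f _ => exact Empty.elim f
    choose m hm hmn using hts
    obtain rfl : ts = fun i => .var (m i) := funext hm
    cases R <;>
    simp [Qset.tr, trTerm_var, freeBelow_and, freeBelow_iff, freeBelow_imp, Qset.eqE, Qset.Q,
        Qset.allQ, Qset.M, Qset.m,
      Qset.Z, Qset.mem, Fml.FreeBelow, Qset.v, Qset.sh, FirstOrder.Language.Term.varFinset, FirstOrder.Language.Term.relabel,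
      Fin.forall_fin_two, hmn]
  | neg A ih => exact fun n h => ih n h
  | or A B ih₁ ih₂ => exact fun n h => ⟨ih₁ n h.1, ih₂ n h.2⟩
  | all A ih =>
    intro n h
    refine ⟨?_, ih (n + 1) h⟩
    simp [Qset.M, Qset.Z, Qset.v, Fml.FreeBelow, FirstOrder.Language.Term.varFinset]

/-! ## The classical part of a model of quasi-set theory -/

section ClassicalPart

variable {X : Type} [LQ.Structure X]

/-- `π` is a quotient of the classical part of `X`, which satisfies exactly the translations. -/
structure IsClassicalPart {V : Type} [SetStr V] (π : {x : X // qD x} → V) : Prop where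
  surj : Function.Surjective π
  sat : ∀ (A : Fml LZ) (e : ℕ → {x : X // qD x}),
    Sat (Qset.tr A) (fun n => (e n).1) ↔ Sat A fun n => π (e n)

theorem qEq.symm {x y : X} (h : qEq x y) : qEq y x := by
  rcases h with ⟨h₁, h₂, h₃⟩ | ⟨h₁, h₂, h₃⟩
  · exact Or.inl ⟨h₂, h₁, fun z => (h₃ z).symm⟩
  · exact Or.inr ⟨h₂, h₁, fun z hz => (h₃ z hz).symm⟩

variable (hX : Models X Qset.Ax)
include hX

/-- The renaming keeps `A` away from the variable `1`, where the axiom retains the old value, so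
that every occurrence of the variable `0` is replaced. -/
theorem qEq_subst (A : Fml LQ) (e : ℕ → X) {x y : X} (h : qEq x y) (hA : Sat A (cons x e)) :
    Sat A (cons y e) := by
  have := hX _ (.q4 (A.rename fun n => match n with | 0 => 0 | k + 1 => k + 2)) e x y
  simp only [sat_imp, sat_eqE, realize_v, sat_rename, cons_succ, cons_zero] at this
  refine (iff_of_eq (congrArg _ ?_)).1 (this h ((iff_of_eq (congrArg _ ?_)).1 hA)) <;>
  · funext n
    cases n <;> rfl

theorem qQ_of_qmem {x y : X} (h : qmem x y) : qQ y := by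
  have := hX _ .q6 (fun _ => x)
  simp at this
  exact this x y h

theorem qQ_of_qZ {x : X} (h : qZ x) : qQ x := by
  have := hX _ .q7 (fun _ => x)
  simp at this
  exact this x h

theorem qZ_iff {x : X} (h : qQ x) : (∀ y, qmem y x → qD y) ↔ qZ x := by
  have := hX _ .q8 (fun _ => x)
  simp at this
  exact this x h

theorem qD_of_qmem {x y : X} (hx : qZ x) (h : qmem y x) : qD y :=
  (qZ_iff hX (qQ_of_qZ hX hx)).2 hx y h

theorem qEq_refl {x : X} (h : qD x) : qEq x x :=
  h.elim (fun h => Or.inr ⟨h, h, fun _ _ => Iff.rfl⟩)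
    fun h => Or.inl ⟨qQ_of_qZ hX h, qQ_of_qZ hX h, fun _ => Iff.rfl⟩

/-- The symbols of ZFU are read on the subtype by their translations, so relativized quantifiers
become quantifiers over the subtype. Translated equality implies extensional identity, which q4
makes substitutive; this is what the quotient needs. -/
theorem exists_classicalPart : ∃ (V : Type) (_ : SetStr V) (π : {x : X // qD x} → V),
    IsClassicalPart π := by
  let _ : LZ.Structure {x : X // qD x} :=
    { RelMap := fun {_} R ts => match R with
        | ZRel.S => qZ (ts 0).1
        | ZRel.mem => (qD (ts 0).1 ∧ qZ (ts 1).1) ∧ qmem (ts 0).1 (ts 1).1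
        | ZRel.eq => (qM (ts 0).1 ∧ qM (ts 1).1 ∨ qZ (ts 0).1 ∧ qZ (ts 1).1) ∧
            qEq (ts 0).1 (ts 1).1 }
  have htr : ∀ (A : Fml LZ) (e : ℕ → {x : X // qD x}),
      Sat (Qset.tr A) (fun n => (e n).1) ↔ Sat A e := by
    intro A
    induction A with
    | @rel k R ts =>
      intro e
      have hts : ∀ i, (Qset.trTerm (ts i)).realize (fun n => (e n).1) = ((ts i).realize e).1 := fun i => by
        cases ts i with
        | var m => rfl
        | func f _ => exact Empty.elim f
      cases R <;> simp [Qset.tr, hts, Sat] <;> exact Iff.rfl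
    | neg A ih => intro e; simp only [Qset.tr, sat_neg, ih]
    | or A B ih₁ ih₂ => intro e; simp only [Qset.tr, sat_or, ih₁, ih₂]
    | all A ih =>
      intro e
      simp only [Qset.tr, sat_all, sat_imp, sat_or, sat_M, sat_Z, realize_v, cons_zero,
          Subtype.forall, ← ih]
      refine forall_congr' fun a => forall_congr' fun ha => iff_of_eq (congrArg _ ?_)
      funext n; cases n <;> rfl
  obtain ⟨V, str, π, hπ, hsat⟩ := exists_quotient (X := {x : X // qD x}) (fun x =>
      show (qM x.1 ∧ qM x.1 ∨ qZ x.1 ∧ qZ x.1) ∧ qEq x.1 x.1 from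
        ⟨x.2.imp (fun h => ⟨h, h⟩) fun h => ⟨h, h⟩, qEq_refl hX x.2⟩) (by
    rintro A e x y ⟨-, h⟩ hA
    rw [← htr] at hA ⊢
    refine (iff_of_eq (congrArg _ ?_)).1 (qEq_subst hX (Qset.tr A) (fun n => (e n).1) h
      ((iff_of_eq (congrArg _ ?_)).1 hA)) <;>
    · funext n
      cases n <;> rfl)
  exact ⟨V, str, π, hπ, fun A e => (htr A e).trans (hsat A e)⟩

omit hX

variable {V : Type} [SetStr V] {π : {x : X // qD x} → V} (hπ : IsClassicalPart π)
include hπ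

theorem IsClassicalPart.isSet_iff {x : {x : X // qD x}} : S (π x) ↔ qZ x.1 := by
  have := hπ.sat (ZFU.S 0) fun _ => x
  simpa using this.symm

theorem IsClassicalPart.mem_iff {x y : {x : X // qD x}} : π x ∈ᵛ π y ↔ qZ y.1 ∧ qmem x.1 y.1 := by
  have := hπ.sat (ZFU.mem 0 1) (cons x fun _ => y)
  have hx := x.2
  have key : Qset.tr (ZFU.mem 0 1) = (((Qset.M (Qset.v 0) ∨ᶠ Qset.Z (Qset.v 0)) ∧ᶠ Qset.Z (Qset.v 1)) ∧ᶠ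
    Qset.mem (Qset.v 0) (Qset.v 1)) := rfl
  rw [key] at this
  simp only [sat_and, sat_or, sat_M, sat_Z, sat_qmem, realize_v, sat_mem, cons_zero] at this
  have h1 : cons x (fun _ => y) 1 = y := rfl
  rw [h1] at this
  rw [← this]
  unfold qD at hx
  tauto

theorem IsClassicalPart.eq_iff {x y : {x : X // qD x}} : π x = π y ↔
    (qM x.1 ∧ qM y.1 ∨ qZ x.1 ∧ qZ y.1) ∧ qEq x.1 y.1 := by
  have := hπ.sat (ZFU.eq 0 1) (cons x fun _ => y)
  have key : Qset.tr (ZFU.eq 0 1) = (((Qset.M (Qset.v 0) ∧ᶠ Qset.M (Qset.v 1)) ∨ᶠ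
    (Qset.Z (Qset.v 0) ∧ᶠ Qset.Z (Qset.v 1))) ∧ᶠ Qset.eqE (Qset.v 0) (Qset.v 1)) := rfl
  rw [key] at this
  simp only [sat_and, sat_or, sat_M, sat_Z, sat_eqE, realize_v, sat_eq, cons_zero] at this
  exact this.symm

/-- The variables beyond the list `ts` may have non-classical values. The bound on the free
variables allows these to be ignored. -/
theorem IsClassicalPart.sat_cl {A : Fml LZ} {ts : List Qset.Tm} (hA : A.FreeBelow ts.length)
    {e : ℕ → X} (e' : ℕ → {x : X // qD x})
    (h : ∀ i < ts.length, (ts.getD i (Qset.v i)).realize e = (e' i).1) :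
    Sat (Qset.cl A ts) e ↔ Sat A fun n => π (e' n) := by
  rw [QST.sat_cl, ← hπ.sat]
  exact sat_congr _ (freeBelow_tr A _ hA) h

theorem IsClassicalPart.sat_cl_one {A : Fml LZ} (hA : A.FreeBelow 1) {t : Qset.Tm} {e : ℕ → X}
    (a : {x : X // qD x}) (h : t.realize e = a.1) : Sat (Qset.cl A [t]) e ↔ Sat A fun _ => π a :=
  hπ.sat_cl (ts := [t]) hA (fun _ => a) fun i hi => by
    obtain rfl : i = 0 := by simpa using hi
    exact h

theorem IsClassicalPart.sat_cl_two {A : Fml LZ} (hA : A.FreeBelow 2) {t s : Qset.Tm} {e : ℕ → X}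
    (a b : {x : X // qD x}) (h : t.realize e = a.1) (h' : s.realize e = b.1) :
    Sat (Qset.cl A [t, s]) e ↔ Sat A (cons (π a) fun _ => π b) := by
  rw [hπ.sat_cl (ts := [t, s]) hA (cons a fun _ => b)]
  · refine iff_of_eq (congrArg _ ?_)
    funext n; cases n <;> rfl
  · intro i hi
    match i with
    | 0 => exact h
    | 1 => exact h'

include hX

omit hX in
theorem IsClassicalPart.exists_of_qZ {z : X} (hz : qZ z) :
    ∃ y, S y ∧ ∀ t : {x : X // qD x}, π t ∈ᵛ y ↔ qmem t.1 z :=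
  ⟨π ⟨z, Or.inr hz⟩, hπ.isSet_iff.2 hz, fun t => by rw [hπ.mem_iff]; simp [hz]⟩

omit hπ

theorem qseparation (A : Fml LQ) (e : ℕ → X) {x : X} (hx : qQ x) :
    ∃ z, qQ z ∧ ∀ t, qmem t z ↔ qmem t x ∧ Sat A (cons t e) := by
  have := hX _ (.q13 (A.rename fun n => match n with | 0 => 0 | k + 1 => k + 2)) e
  simp only [sat_allQ, sat_exQ, sat_all, sat_iff, sat_and, sat_qmem, sat_rename, realize_v,
      cons_zero, cons_succ] at this
  obtain ⟨z, hz, h⟩ := this x hx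
  refine ⟨z, hz, fun t => (h t).trans (and_congr_right fun _ => iff_of_eq (congrArg _ ?_))⟩
  funext n; cases n <;> rfl

theorem qreplacement (A : Fml LQ) (e : ℕ → X) {u : X} (hu : qQ u)
    (h₁ : ∀ w, qmem w u → ∃ s, Sat A (cons s (cons w e)))
    (h₂ : ∀ w w' s s', qmem w u → qmem w' u → Sat A (cons s (cons w e)) →
      Sat A (cons s' (cons w' e)) → qind w w' → qind s s') :
    ∃ z, qQ z ∧ ∀ s, qmem s z ↔ ∃ w, qmem w u ∧ Sat A (cons s (cons w e)) := by
  have := hX _ (.q27 (A.rename fun n => match n with | 0 => 0 | 1 => 1 | k + 2 => k + 3)) e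
  simp only [sat_allQ, sat_exQ, sat_imp, sat_and, sat_all, sat_ex, sat_iff, sat_ind, sat_qmem,
    sat_rename, realize_v, cons_zero, cons_succ] at this
  have env : ∀ {s w : X} {F : ℕ → X}, F = cons s (cons w e) →
      (Sat A F ↔ Sat A (cons s (cons w e))) := by rintro s w F rfl; rfl
  refine (this u hu ⟨fun w hw => ?_, ?_⟩).imp fun z hz => ⟨hz.1, fun s => (hz.2 s).trans
    (exists_congr fun w => and_congr_right fun _ => env ?_)⟩
  · obtain ⟨s, hs⟩ := h₁ w hw
    refine ⟨s, (env ?_).2 hs⟩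
    funext n
    match n with
    | 0 => rfl
    | 1 => rfl
    | n + 2 => rfl
  · rintro w w' ⟨hw, hw'⟩ s s' ⟨hs, hs', hww'⟩
    refine h₂ w w' s s' hw hw' ((env ?_).1 hs) ((env ?_).1 hs') hww' <;>
    · funext n
      match n with
      | 0 => rfl
      | 1 => rfl
      | n + 2 => rfl
  · funext n
    match n with
    | 0 => rfl
    | 1 => rfl
    | n + 2 => rfl

/-- Reflexivity of indistinguishability together with substitutivity. For classical things q11 gives
the converse. -/
theorem qind_of_qEq {x y : X} (h : qEq x y) : qind y x ∧ qind x y := by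
  have h₁ := hX _ .q1 (fun _ => x) x
  have h₂ := hX _ .q1 (fun _ => x) y
  simp only [sat_ind, realize_v, cons_zero] at h₁ h₂
  have h₃ := qEq_subst hX (Qset.ind (Qset.v 0) (Qset.v 1)) (fun _ => x) h
  have h₄ := qEq_subst hX (Qset.ind (Qset.v 0) (Qset.v 1)) (fun _ => y) h.symm
  simp only [sat_ind, realize_v, cons_zero] at h₃ h₄
  exact ⟨h₃ h₁, h₄ h₂⟩

include hπ

omit hX in
theorem IsClassicalPart.eq_iff_of_qEq {x y : {x : X // qD x}} : π x = π y ↔ qEq x.1 y.1 := by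
  rw [hπ.eq_iff]
  refine ⟨fun h => h.2, fun h => ⟨?_, h⟩⟩
  have : ∀ {x : X}, qD x → qQ x → qZ x := fun h h' => h.resolve_left fun h => h' (Or.inr h)
  exact h.elim (fun h => Or.inr ⟨this x.2 h.1, this y.2 h.2.1⟩) fun h => Or.inl ⟨h.1, h.2.1⟩

/-- Separation from a quasi-set for the classical part. -/
theorem IsClassicalPart.separation (A : Fml LZ) (e : ℕ → V) {x : X} (hx : qQ x) :
    ∃ z, S z ∧ ∀ t : {x : X // qD x}, π t ∈ᵛ z ↔ qmem t.1 x ∧ Sat A (cons (π t) e) := by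
  choose f hf using hπ.surj
  -- The conjunct `D` makes the result a set by q8, even if `x` has non-classical elements.
  obtain ⟨z, hz, h⟩ := qseparation hX (Qset.D (Qset.v 0) ∧ᶠ Qset.tr A) (fun n => (f (e n)).1) hx
  simp only [sat_and, sat_D, realize_v, cons_zero] at h
  have hZ : qZ z := (qZ_iff hX hz).1 fun t ht => ((h t).1 ht).2.1
  obtain ⟨y, hy, h'⟩ := hπ.exists_of_qZ hZ
  refine ⟨y, hy, fun t => ((h' t).trans (h t.1)).trans (and_congr_right fun _ => ?_)⟩
  simp only [t.2, true_and]
  have := hπ.sat A (cons t fun n => f (e n))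
  refine ((iff_of_eq (congrArg _ ?_)).trans this).trans (iff_of_eq (congrArg _ ?_))
  · funext n; cases n <;> rfl
  · funext n
    cases n with
    | zero => rfl
    | succ n => exact hf (e n)

/-- Each axiom is applied to representatives in `X`. Where the resulting qset could contain
non-classical things, it is cut down first; q8 then makes it a set. -/
theorem IsClassicalPart.basicSet [Nonempty X] : BasicSet V := by
  have hnot : ∀ {x : X}, qM x → ¬ qQ x := fun h h' => h' (Or.inr h)
  refine
    { nonempty := ?_
      isSet_of_mem := fun {x y} h => ?_
      ext := fun {x y} hx hy h => ?_
      pairing := fun a b => ?_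
      union := fun {x} hx => ?_
      power := fun {x} hx => ?_
      separation := fun A e x hx => ?_
      regularity := fun {x} hx hne => ?_
      replacement := fun A e u hu hA => ?_ }
  · by_contra hV
    have h₁ : ∀ x : X, ¬ qD x := fun x hx => hV ⟨π ⟨x, hx⟩⟩
    have := hX _ .q10 (fun _ => Classical.arbitrary X)
    simp only [sat_exQ, sat_all, sat_neg, sat_qmem, realize_v, cons_zero] at this
    obtain ⟨z, hz, h⟩ := this
    exact h₁ z (Or.inr ((qZ_iff hX hz).1 fun y hy => (h y hy).elim))
  · obtain ⟨x, rfl⟩ := hπ.surj x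
    obtain ⟨y, rfl⟩ := hπ.surj y
    exact hπ.isSet_iff.2 (hπ.mem_iff.1 h).1
  · obtain ⟨x, rfl⟩ := hπ.surj x
    obtain ⟨y, rfl⟩ := hπ.surj y
    rw [hπ.isSet_iff] at hx hy
    refine hπ.eq_iff.2 ⟨Or.inr ⟨hx, hy⟩, Or.inl ⟨qQ_of_qZ hX hx, qQ_of_qZ hX hy, fun z => ?_⟩⟩
    have key : ∀ hz : qD z, (qmem z x.1 ↔ qmem z y.1) := fun hz => by
      have := h (π ⟨z, hz⟩)
      simpa [hπ.mem_iff, hx, hy] using this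
    exact ⟨fun hz => (key (qD_of_qmem hX hx hz)).1 hz, fun hz => (key (qD_of_qmem hX hy hz)).2 hz⟩
  · obtain ⟨a, rfl⟩ := hπ.surj a
    obtain ⟨b, rfl⟩ := hπ.surj b
    have := hX _ .q12 (fun _ => a.1) a.1 b.1
    simp only [sat_exQ, sat_all, sat_iff, sat_or, sat_qmem, sat_ind, realize_v, cons_zero,
        cons_succ] at this
    obtain ⟨w, hw, h⟩ := this
    -- The weak pair may contain non-classical things that are indistinguishable from `a` or `b`;
    -- only the classical things equal to one of the two are kept.
    obtain ⟨z, hz, h'⟩ := hπ.separation hX (ZFU.eq 0 1 ∨ᶠ ZFU.eq 0 2) (cons (π a) fun _ => π b) hw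
    refine ⟨z, hz, fun t => ?_⟩
    obtain ⟨t, rfl⟩ := hπ.surj t
    refine (h' t).trans ?_
    simp only [sat_or, sat_eq, cons_zero, cons_succ, h, and_iff_right_iff_imp]
    rintro (h | h)
    · exact Or.inl (qind_of_qEq hX (hπ.eq_iff.1 h).2).2
    · exact Or.inr (qind_of_qEq hX (hπ.eq_iff.1 h).2).2
  · obtain ⟨x, rfl⟩ := hπ.surj x
    rw [hπ.isSet_iff] at hx
    -- Macro-atoms are removed because q14 requires a qset of qsets. They have no elements to
    -- contribute.
    obtain ⟨w, hw, h⟩ := qseparation hX (Qset.Z (Qset.v 0)) (fun _ => x.1) (qQ_of_qZ hX hx)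
    have := hX _ .q14 (fun _ => x.1) w
    simp only [sat_imp, sat_E, sat_exQ, sat_all, sat_iff, sat_ex, sat_and, sat_Q, sat_Z,
        sat_qmem, realize_v, cons_zero, cons_succ] at this h
    obtain ⟨z, hz, h'⟩ := this hw ⟨hw, fun y hy => qQ_of_qZ hX ((h y).1 hy).2⟩
    have hZ : qZ z := (qZ_iff hX hz).1 fun t ht => by
      obtain ⟨y, h₁, h₂⟩ := (h' t).1 ht
      exact qD_of_qmem hX ((h y).1 h₂).2 h₁
    obtain ⟨y, hy, hy'⟩ := hπ.exists_of_qZ hZ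
    refine ⟨y, hy, fun t => ?_⟩
    obtain ⟨t, rfl⟩ := hπ.surj t
    rw [hy', h']
    refine ⟨fun ⟨u, h₁, h₂⟩ => ?_, fun ⟨u, h₁, h₂⟩ => ?_⟩
    · obtain ⟨h₃, h₄⟩ := (h u).1 h₂
      exact ⟨π ⟨u, Or.inr h₄⟩, hπ.mem_iff.2 ⟨hx, h₃⟩, hπ.mem_iff.2 ⟨h₄, h₁⟩⟩
    · obtain ⟨u, rfl⟩ := hπ.surj u
      rw [hπ.mem_iff] at h₁ h₂
      exact ⟨u.1, h₂.2, (h _).2 ⟨h₁.2, h₂.1⟩⟩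
  · obtain ⟨x, rfl⟩ := hπ.surj x
    rw [hπ.isSet_iff] at hx
    have := hX _ .q15 (fun _ => x.1)
    simp only [sat_allQ, sat_ex, sat_isPower, realize_v, cons_zero, cons_succ] at this
    obtain ⟨z, hz, h⟩ := this x.1 (qQ_of_qZ hX hx)
    have hsub : ∀ t, qmem t z → qZ t := fun t ht =>
      (qZ_iff hX ((h t).1 ht).1).1 fun s hs => qD_of_qmem hX hx (((h t).1 ht).2 s hs)
    obtain ⟨y, hy, hy'⟩ := hπ.exists_of_qZ ((qZ_iff hX hz).1 fun t ht => Or.inr (hsub t ht))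
    refine ⟨y, hy, fun t => ?_⟩
    obtain ⟨t, rfl⟩ := hπ.surj t
    rw [hy', hπ.isSet_iff]
    refine ⟨fun ht => ⟨hsub _ ht, fun s hs => ?_⟩, fun ⟨ht, hs⟩ => (h _).2 ⟨qQ_of_qZ hX ht,
        fun s hst => ?_⟩⟩
    · obtain ⟨s, rfl⟩ := hπ.surj s
      exact hπ.mem_iff.2 ⟨hx, ((h _).1 ht).2 _ (hπ.mem_iff.1 hs).2⟩
    · exact (hπ.mem_iff.1 (hs (π ⟨s, qD_of_qmem hX ht hst⟩) (hπ.mem_iff.2 ⟨ht, hst⟩))).2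
  · obtain ⟨x, rfl⟩ := hπ.surj x
    rw [hπ.isSet_iff] at hx
    obtain ⟨z, hz, h⟩ := hπ.separation hX A e (qQ_of_qZ hX hx)
    refine ⟨z, hz, fun t => ?_⟩
    obtain ⟨t, rfl⟩ := hπ.surj t
    rw [h, hπ.mem_iff]
    simp [hx]
  · obtain ⟨x, rfl⟩ := hπ.surj x
    rw [hπ.isSet_iff] at hx
    obtain ⟨a, ha⟩ := hne
    obtain ⟨a, rfl⟩ := hπ.surj a
    have hxQ := qQ_of_qZ hX hx
    -- q17 covers only qsets of qsets. In the other case an element that is not a qset will do,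
    -- since nothing belongs to it.
    by_cases hE : ∀ y, qmem y x.1 → qQ y
    · have := hX _ .q17 (fun _ => x.1)
      simp only [sat_allQ, sat_exQ, sat_imp, sat_and, sat_E, sat_neg, sat_isEmpty, sat_qmem,
          sat_disj, realize_v, cons_zero, cons_succ] at this
      obtain ⟨y, hy, hyx, h⟩ := this x.1 hxQ ⟨⟨hxQ, hE⟩, fun h => h.2 a.1 (hπ.mem_iff.1 ha).2⟩
      refine ⟨π ⟨y, qD_of_qmem hX hx hyx⟩, hπ.mem_iff.2 ⟨hx, hyx⟩, fun t ⟨h₁, h₂⟩ => ?_⟩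
      obtain ⟨t, rfl⟩ := hπ.surj t
      exact h t.1 ⟨(hπ.mem_iff.1 h₁).2, (hπ.mem_iff.1 h₂).2⟩
    · push Not at hE
      obtain ⟨y, hy, hyQ⟩ := hE
      refine ⟨π ⟨y, qD_of_qmem hX hx hy⟩, hπ.mem_iff.2 ⟨hx, hy⟩, fun t ⟨h₁, h₂⟩ => ?_⟩
      exact hyQ (qQ_of_qZ hX (hπ.isSet_iff.1 (by
        obtain ⟨t, rfl⟩ := hπ.surj t
        exact hπ.isSet_iff.2 (hπ.mem_iff.1 h₁).1)))
  · obtain ⟨u, rfl⟩ := hπ.surj u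
    rw [hπ.isSet_iff] at hu
    choose f hf using hπ.surj
    have hsat : ∀ w s : {x : X // qD x}, Sat (Qset.tr A) (cons s.1 (cons w.1 fun n => (f (e n)).1)) ↔
        Sat A (cons (π s) (cons (π w) e)) := fun w s => by
      have := hπ.sat A (cons s (cons w fun n => f (e n)))
      refine ((iff_of_eq (congrArg _ ?_)).trans this).trans (iff_of_eq (congrArg _ ?_))
      · funext n
        match n with
        | 0 => rfl
        | 1 => rfl
        | n + 2 => rfl
      · funext n
        match n with
        | 0 => rfl
        | 1 => rfl
        | n + 2 => exact hf (e n)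
    -- `D` keeps the values classical. By q11, indistinguishable arguments in `u` are extensionally
    -- identical, so they represent the same element of the quotient and uniqueness there gives
    -- indistinguishable values.
    have hrep : ∃ z, qQ z ∧ ∀ s, qmem s z ↔ ∃ w, qmem w u.1 ∧
        Sat (Qset.D (Qset.v 0) ∧ᶠ Qset.tr A) (cons s (cons w fun n => (f (e n)).1)) := by
      refine qreplacement hX _ _ (qQ_of_qZ hX hu) (fun w hw => ?_) ?_
      · obtain ⟨s, hs, -⟩ := hA (π ⟨w, qD_of_qmem hX hu hw⟩) (hπ.mem_iff.2 ⟨hu, hw⟩)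
        obtain ⟨s, rfl⟩ := hπ.surj s
        exact ⟨s.1, (sat_and _ _ _).2 ⟨(sat_D _ _).2 s.2, (hsat _ _).2 hs⟩⟩
      · intro w w' s s' hw hw' hs hs' hww'
        rw [sat_and, sat_D, realize_v, cons_zero] at hs hs'
        have hwD := qD_of_qmem hX hu hw
        have hwD' := qD_of_qmem hX hu hw'
        have h₁₁ := hX _ .q11 (fun _ => w)
        simp only [sat_all, sat_imp, sat_D, sat_ind, sat_eqE, realize_v, cons_zero,
            cons_succ] at h₁₁
        have hE := h₁₁ w hwD w' hwD' hww'
        have hs₂ := (hsat ⟨w, hwD⟩ ⟨s, hs.1⟩).1 hs.2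
        have hs₂' := (hsat ⟨w', hwD'⟩ ⟨s', hs'.1⟩).1 hs'.2
        have hww : π ⟨w, hwD⟩ = π ⟨w', hwD'⟩ := hπ.eq_iff_of_qEq.2 hE
        rw [← hww] at hs₂'
        obtain ⟨r, -, hr⟩ := hA (π ⟨w, hwD⟩) (hπ.mem_iff.2 ⟨hu, hw⟩)
        have := hπ.eq_iff.1 ((hr _ hs₂).trans (hr _ hs₂').symm)
        exact (qind_of_qEq hX this.2).2
    obtain ⟨z, hz, h⟩ := hrep
    have hZ : qZ z := (qZ_iff hX hz).1 fun s hs => by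
      obtain ⟨w, hw, hs⟩ := (h s).1 hs
      exact (sat_D _ _).1 ((sat_and _ _ _).1 hs).1
    obtain ⟨y, hy, hy'⟩ := hπ.exists_of_qZ hZ
    refine ⟨y, hy, fun s => ?_⟩
    obtain ⟨s, rfl⟩ := hπ.surj s
    rw [hy', h]
    refine ⟨fun ⟨w, hw, hs⟩ => ?_, fun ⟨w, hw, hs⟩ => ?_⟩
    · exact ⟨π ⟨w, qD_of_qmem hX hu hw⟩, hπ.mem_iff.2 ⟨hu, hw⟩,
        (hsat ⟨w, qD_of_qmem hX hu hw⟩ s).1 ((sat_and _ _ _).1 hs).2⟩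
    · obtain ⟨w, rfl⟩ := hπ.surj w
      exact ⟨w.1, (hπ.mem_iff.1 hw).2, (sat_and _ _ _).2 ⟨(sat_D _ _).2 s.2, (hsat _ _).2 hs⟩⟩

end ClassicalPart

/-! ### Quasi-cardinals, choice and infinity in the classical part -/

section ClassicalPartInfinity

variable {X : Type} [LQ.Structure X]

/-- The definition of an ordinal contains `S`, whose translation is `Z`; so the term need not be
known to be classical beforehand. -/
theorem qZ_of_isCardinal {t : Qset.Tm} {e : ℕ → X}
    (h : Sat (Qset.cl (ZFU.isCardinal 0) [t]) e) : qZ (t.realize e) := by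
  rw [sat_cl] at h
  simp only [ZFU.isCardinal, ZFU.isOrd, tr_and, sat_and, tr_S, sat_Z, realize_v] at h
  exact h.1.1

variable (hX : Models X Qset.Ax)
variable {V : Type} [SetStr V] {π : {x : X // qD x} → V} (hπ : IsClassicalPart π)
include hX hπ

/-- The quasi-cardinal of a quasi-set is a cardinal of the classical part, for a set its cardinal. -/
theorem IsClassicalPart.exists_isCardinal {x : X} (hx : qQ x) :
    ∃ h : qD (qcd x), IsCardinal (π ⟨qcd x, h⟩) ∧
      ∀ hz : qZ x, IsCardOf (π ⟨qcd x, h⟩) (π ⟨x, Or.inr hz⟩) := by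
  have := hX _ .q19 (fun _ => x)
  simp only [sat_allQ, sat_ex, sat_all, sat_and, sat_imp, sat_eqE, sat_Z, realize_v, realize_qc,
    cons_zero, cons_succ] at this
  obtain ⟨c, ⟨h₁, h₂, h₃⟩, -⟩ := this x hx
  have hc : qD c := Or.inr (qZ_of_isCardinal h₁)
  -- q19 only gives a cardinal that is extensionally identical with $qc(x)$; substitutivity carries
  -- the property over to $qc(x)$ itself.
  have hq : qD (qcd x) := Or.inr (qZ_of_isCardinal (t := Qset.v 0)
    (qEq_subst hX (Qset.cl (ZFU.isCardinal 0) [Qset.v 0]) _ h₂ h₁))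
  have heq : π ⟨qcd x, hq⟩ = π ⟨c, hc⟩ := (hπ.eq_iff_of_qEq.2 h₂).symm
  refine ⟨hq, ?_, fun hz => ?_⟩
  · rw [heq]
    have := (hπ.sat_cl_one freeBelow_isCardinal ⟨c, hc⟩ (by simp)).1 h₁
    rwa [sat_isCardinal] at this
  · rw [heq]
    have := (hπ.sat_cl_two freeBelow_isCardOf ⟨c, hc⟩ ⟨x, Or.inr hz⟩ (by simp) (by simp)).1 (h₃ hz)
    rwa [sat_isCardOf] at this

/-- By q19 each set is equinumerous with its quasi-cardinal, which is an ordinal of the classical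
part. -/
theorem IsClassicalPart.axChoice [Nonempty X] : AxChoice V := by
  have := hπ.basicSet hX
  refine axChoice_of_equinum_ord fun x hx => ?_
  obtain ⟨⟨x, hxD⟩, rfl⟩ := hπ.surj x
  rw [hπ.isSet_iff] at hx
  obtain ⟨h, -, hc⟩ := hπ.exists_isCardinal hX (qQ_of_qZ hX hx)
  exact ⟨_, (hc hx).1.1, (hc hx).2⟩

-- Regularity is applied to the elements of `x` that are extensionally identical with `y`, in place
-- of a singleton. If `y` belonged to itself, substitutivity would make each of them an element of
-- itself, so none could be disjoint from this qset.
omit hπ in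
theorem not_qmem_self {x y : X} (hx : ∀ t, qmem t x → qQ t) (hy : qmem y x) : ¬ qmem y y := by
  intro h
  have hyQ := hx y hy
  obtain ⟨w, hw,
      hw'⟩ := qseparation hX (Qset.eqE (Qset.v 0) (Qset.v 1)) (fun _ => y) (qQ_of_qmem hX hy)
  simp only [sat_eqE, realize_v, cons_zero, cons_succ] at hw'
  have hyw : qmem y w := (hw' y).2 ⟨hy, Or.inl ⟨hyQ, hyQ, fun _ => Iff.rfl⟩⟩
  have := hX _ .q17 (fun _ => y)
  simp only [sat_allQ, sat_exQ, sat_imp, sat_and, sat_E, sat_neg, sat_isEmpty, sat_qmem, sat_disj,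
    realize_v, cons_zero, cons_succ] at this
  obtain ⟨t, -, htw, hd⟩ := this w hw ⟨⟨hw, fun t ht => hx t ((hw' t).1 ht).1⟩, fun h => h.2 y hyw⟩
  have htt := qEq_subst hX (Qset.mem (Qset.v 0) (Qset.v 0)) (fun _ => y) ((hw' t).1 htw).2.symm
  simp only [sat_qmem, realize_v, cons_zero] at htt
  exact hd t ⟨htt h, htw⟩

theorem IsClassicalPart.axInfinity [Nonempty X] : AxInfinity V := by
  have hV := hπ.basicSet hX
  by_contra hinf
  -- Under the assumption that infinity fails, every quasi-cardinal is a natural number, so that q23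
  -- applies to all qsets.
  have hnat : ∀ a : V, IsOrd a → IsNat a := fun a ha => by
    by_contra hn
    exact hinf (axInfinity_of_not_isNat ha hn)
  have hcard : ∀ x : {x : X // qQ x}, ∃ k : V, IsCardinal k ∧ ∃ h, k = π ⟨qcd x.1, h⟩ := fun x => by
    obtain ⟨h, hk, -⟩ := hπ.exists_isCardinal hX x.2
    exact ⟨_, hk, h, rfl⟩
  choose κ hκ hD hκD using hcard
  have h22 : ∀ y z : {x : X // qQ x}, (∀ t, qmem t y.1 → qmem t z.1) → Sub (κ y) (κ z) := by
    intro y z hyz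
    have := hX _ .q22 (fun _ => y.1)
    simp only [sat_allQ, sat_imp, sat_qsub, realize_v, cons_zero, cons_succ] at this
    have := this z.1 z.2 y.1 y.2 hyz
    rw [hπ.sat_cl_two freeBelow_cardLe ⟨_, hD y⟩ ⟨_, hD z⟩ (by simp) (by simp), sat_cardLe] at this
    have h : CardLe (κ y) (κ z) := by rw [hκD y, hκD z]; exact this
    exact (h.1.1.sub_iff h.2.1.1).2 h.2.2
  have h23 : ∀ y z : {x : X // qQ x}, (∀ t, qmem t y.1 → qmem t z.1) → ¬ qEq y.1 z.1 →
      κ y ∈ᵛ κ z := by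
    intro y z hyz hne
    have := hX _ .q23 (fun _ => y.1)
    simp only [sat_allQ, sat_imp, sat_and, sat_qsub, sat_neg, sat_eqE, Qset.isFin, sat_Q,
        realize_v, cons_zero, cons_succ] at this
    have := this y.1 y.2 z.1 z.2 ⟨⟨y.2, ?_⟩, hyz, hne⟩
    · rw [hπ.sat_cl_two freeBelow_cardLt ⟨_, hD y⟩ ⟨_, hD z⟩ (by simp) (by simp),
          sat_cardLt] at this
      have h : CardLt (κ y) (κ z) := by rw [hκD y, hκD z]; exact this
      exact h.2.2
    · rw [hπ.sat_cl_one freeBelow_isNat ⟨_, hD y⟩ (by simp), sat_isNat]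
      exact hκD y ▸ hnat _ (hκ y).1
  have h16 := hX _ .q16 (fun _ => Classical.arbitrary X)
  simp only [sat_exQ, sat_ex, sat_all, sat_imp, sat_and, sat_isEmpty, sat_qmem, sat_Q,
      sat_qisSucc, realize_v, cons_zero, cons_succ] at h16
  obtain ⟨x, hx, ⟨o, ho, hox⟩, hsucc⟩ := h16
  -- Only the elements that are qsets are kept, so that the union `u` exists. By q22 its
  -- quasi-cardinal bounds those of all elements of `w`.
  obtain ⟨w, hw, hw'⟩ := qseparation hX (Qset.Q (Qset.v 0)) (fun _ => x) hx
  simp only [sat_Q, realize_v, cons_zero] at hw'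
  have hwQ : ∀ t, qmem t w → qQ t := fun t ht => ((hw' t).1 ht).2
  have h14 := hX _ .q14 (fun _ => x) w
  simp only [sat_imp, sat_E, sat_exQ, sat_all, sat_iff, sat_ex, sat_and, sat_Q, sat_qmem,
      realize_v, cons_zero, cons_succ] at h14
  obtain ⟨u, hu, hu'⟩ := h14 hw ⟨hw, hwQ⟩
  have hsub : ∀ y : {x : X // qQ x}, qmem y.1 w → Sub (κ y) (κ ⟨u, hu⟩) := fun y hy =>
    h22 y ⟨u, hu⟩ fun t ht => (hu' t).2 ⟨y.1, ht, hy⟩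
  -- `y` belongs to `[y]` but not to itself, so it is a proper part of its successor, and q23 makes
  -- the quasi-cardinal grow.
  have hstep : ∀ y : {x : X // qQ x}, qmem y.1 w → ∃ s : {x : X // qQ x}, qmem s.1 w ∧ κ y ∈ᵛ κ s := by
    intro y hy
    obtain ⟨s, ⟨hs, hs'⟩, hsx⟩ := hsucc y.1 ⟨((hw' _).1 hy).1, y.2⟩
    refine ⟨⟨s, hs⟩, (hw' s).2 ⟨hsx, hs⟩, h23 y ⟨s,
        hs⟩ (fun t ht => (hs' t).2 (Or.inl ht)) fun hE => ?_⟩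
    have hys : qmem y.1 s := (hs' _).2 (Or.inr (qind_of_qEq hX (Or.inl ⟨y.2, y.2,
        fun _ => Iff.rfl⟩)).1)
    rcases hE with ⟨-, -, hE⟩ | ⟨h, -⟩
    · exact not_qmem_self hX hwQ hy ((hE _).2 hys)
    · exact y.2 (Or.inr h)
  have hκmem : ∀ (t : {x : X // qD x}) (y : {x : X // qQ x}), π t ∈ᵛ κ y ↔ qmem t.1 (qcd y.1) := by
    intro t y
    have := (hκ y).1.1
    rw [hκD y] at this ⊢
    rw [hπ.mem_iff]
    simp [hπ.isSet_iff.1 this]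
  have hUS : S (κ ⟨u, hu⟩) := (hκ ⟨u, hu⟩).1.1
  rw [hκD, hπ.isSet_iff] at hUS
  -- The elements of `w` need not be classical, so this separation takes place in $\mathcal Q$. Its
  -- result is part of the set $qc(u)$, hence a set.
  obtain ⟨l, hl, hl'⟩ := qseparation hX (Fml.ex (Qset.mem (Qset.v 0) (Qset.v 2) ∧ᶠ
    Qset.mem (Qset.v 1) (Qset.qc (Qset.v 0)))) (fun _ => w) (qQ_of_qZ hX hUS)
  simp only [sat_ex, sat_and, sat_qmem, realize_v, realize_qc, cons_zero, cons_succ] at hl'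
  obtain ⟨z, hz, hz'⟩ := hπ.exists_of_qZ ((qZ_iff hX hl).1 fun t ht =>
    qD_of_qmem hX hUS ((hl' t).1 ht).1)
  have hmem : ∀ b : V, b ∈ᵛ z ↔ ∃ y : {x : X // qQ x}, qmem y.1 w ∧ b ∈ᵛ κ y := by
    intro b
    obtain ⟨b, rfl⟩ := hπ.surj b
    rw [hz', hl']
    refine ⟨fun ⟨_, y, hy, hb⟩ => ⟨⟨y, hwQ y hy⟩, hy, (hκmem _ _).2 hb⟩, fun ⟨y, hy, hb⟩ => ?_⟩
    exact ⟨(hκmem b ⟨u, hu⟩).1 (hsub y hy _ hb), y.1, hy, (hκmem _ _).1 hb⟩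
  refine hinf ⟨z, hz, ⟨emp V, isZero_emp, ?_⟩, fun b hb => ⟨succ b, isSucc_iff.2 rfl, ?_⟩⟩
  · obtain ⟨s, hs, hos⟩ := hstep ⟨o, ho.1⟩ ((hw' o).2 ⟨hox, ho.1⟩)
    refine (hmem _).2 ⟨s, hs, (hκ s).1.emp_mem_or.resolve_right fun h => ?_⟩
    rw [← h] at hos
    exact not_mem_emp _ hos
  -- The successor of `b` is at most `κ y`, and `κ y` is an element of `κ s` for the next qset `s`.
  · obtain ⟨y, hy, hby⟩ := (hmem b).1 hb
    obtain ⟨s, hs, hys⟩ := hstep y hy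
    refine (hmem _).2 ⟨s, hs, ?_⟩
    rcases (hκ y).1.succ_mem_or hby with h | h
    · exact (hκ s).1.trans hys h
    · rw [h]; exact hys

theorem IsClassicalPart.models [Nonempty X] : Models V ZFU.Ax := by
  have := hπ.basicSet hX
  exact models_of_basicSet (hπ.axInfinity hX) (hπ.axChoice hX)

end ClassicalPartInfinity

theorem sat_tr_of_deriv {A : Fml LZ} (h : Deriv ZFU.theory A) {X : Type} [LQ.Structure X]
    (hX : Models X Qset.Ax) {n : ℕ} (hA : A.FreeBelow n) (e : ℕ → X) (he : ∀ i < n, qD (e i)) :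
    Sat (Qset.tr A) e := by
  have : Nonempty X := ⟨e 0⟩
  obtain ⟨V, _, π, hπ⟩ := exists_classicalPart hX
  obtain ⟨d⟩ : Nonempty V := (hπ.basicSet hX).nonempty
  obtain ⟨d, -⟩ := hπ.surj d
  classical
  -- From `n` on the values may be non-classical; they do not matter and are replaced by `d` where
  -- necessary.
  let e' : ℕ → {x : X // qD x} := fun i => if h : qD (e i) then ⟨e i, h⟩ else d
  refine (sat_congr _ (freeBelow_tr A n hA) (e' := fun i => (e' i).1) fun i hi => ?_).2
    ((hπ.sat A e').2 (h.sound _ ((models_iff _).2 (hπ.models hX))))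
  simp [e', he i hi]

/-! ## Cardinals in models of ZFU -/

/-! ### The well-ordering theorem from the axiom of choice -/

section Wellorder

variable {V : Type} [SetStr V] [BasicSet V]

/-- A choice function for the non-empty subsets of a set. -/
theorem exists_choice (hC : AxChoice V) {x : V} (hx : S x) : ∃ G : V → V → Prop, DRel G ∧
    (∀ p, S p → Sub p x → (∃ t, t ∈ᵛ p) → ∃ a, a ∈ᵛ p ∧ G p a) ∧
    ∀ p a b, S p → Sub p x → a ∈ᵛ p → b ∈ᵛ p → G p a → G p b → a = b := by
  obtain ⟨P, hP, hP'⟩ := BasicSet.power hx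
  obtain ⟨Q, hQ, hQ'⟩ := sep (fun p => ∃ t, t ∈ᵛ p) hP
  -- `F p y` says that `y` is `{p} × p`. Tagging by `p` makes the sets disjoint, so that the choice
  -- axiom applies to all non-empty parts of `x` at once.
  let F : V → V → Prop := fun p y => S y ∧ ∀ t, t ∈ᵛ y ↔ ∃ a, a ∈ᵛ p ∧ IsPair t p a
  have hF : ∀ p, p ∈ᵛ Q → ∃ y, F p y ∧ ∀ z, F p z → z = y := by
    intro p hp
    have hpS := ((hP' p).1 ((hQ' p).1 hp).1).1
    obtain ⟨y, hy, hy'⟩ := repl (fun a s => IsPair s p a) hpS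
      fun a _ => ⟨pr p a, isPair_iff.2 rfl, fun r hr => isPair_iff.1 hr⟩
    exact ⟨y, ⟨hy, hy'⟩, fun z hz => BasicSet.ext hz.1 hy fun t => (hz.2 t).trans (hy' t).symm⟩
  obtain ⟨Y, hY, hY'⟩ := repl F hQ hF
  have hCY := hC Y ⟨hY, fun y hy => ?_, fun y z ⟨hy, hz, hne⟩ t ⟨hty, htz⟩ => ?_⟩
  · obtain ⟨u, hu, hu'⟩ := hCY
    have key : ∀ p, S p → Sub p x → (∃ t, t ∈ᵛ p) → ∃ v, ∀ a, (a ∈ᵛ p ∧ pr p a ∈ᵛ u) ↔ pr p a = v := by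
      intro p hp hpx hne
      have hpQ : p ∈ᵛ Q := (hQ' p).2 ⟨(hP' p).2 ⟨hp, hpx⟩, hne⟩
      obtain ⟨y, hy, -⟩ := hF p hpQ
      obtain ⟨v, hv⟩ := hu' y ((hY' y).2 ⟨p, hpQ, hy⟩)
      refine ⟨v, fun a => ?_⟩
      rw [← hv, hy.2]
      refine and_congr_left fun _ => ⟨fun h => ⟨a, h, isPair_iff.2 rfl⟩, fun ⟨b, hb, h⟩ => ?_⟩
      rw [isPair_iff, pr_inj] at h
      exact h.2 ▸ hb
    refine ⟨fun p a => PairMem p a u, by unfold DRel; infer_instance, fun p hp hpx hne => ?_, ?_⟩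
    · have hpQ : p ∈ᵛ Q := (hQ' p).2 ⟨(hP' p).2 ⟨hp, hpx⟩, hne⟩
      obtain ⟨y, hy, -⟩ := hF p hpQ
      obtain ⟨v, hv⟩ := hu' y ((hY' y).2 ⟨p, hpQ, hy⟩)
      obtain ⟨h₁, h₂⟩ := (hv v).2 rfl
      obtain ⟨a, ha, hva⟩ := (hy.2 v).1 h₁
      exact ⟨a, ha, v, h₂, hva⟩
    · intro p a b hp hpx ha hb hpa hpb
      obtain ⟨v, hv⟩ := key p hp hpx ⟨a, ha⟩
      have h₁ := (hv a).1 ⟨ha, pairMem_iff.1 hpa⟩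
      have h₂ := (hv b).1 ⟨hb, pairMem_iff.1 hpb⟩
      exact (pr_inj.1 (h₁.trans h₂.symm)).2
  · obtain ⟨p, hp, hy⟩ := (hY' y).1 hy
    obtain ⟨t, ht⟩ := ((hQ' p).1 hp).2
    exact ⟨hy.1, pr p t, (hy.2 _).2 ⟨t, ht, isPair_iff.2 rfl⟩⟩
  · obtain ⟨p, hp, hy⟩ := (hY' y).1 hy
    obtain ⟨q, hq, hz⟩ := (hY' z).1 hz
    obtain ⟨a, ha, hta⟩ := (hy.2 t).1 hty
    obtain ⟨b, hb, htb⟩ := (hz.2 t).1 htz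
    rw [isPair_iff] at hta htb
    obtain rfl := (pr_inj.1 (hta.symm.trans htb)).1
    exact hne (BasicSet.ext hy.1 hz.1 fun t => (hy.2 t).trans (hz.2 t).symm)

/-- The well-ordering theorem. -/
theorem exists_equinum_ord (hC : AxChoice V) {x : V} (hx : S x) : ∃ a, IsOrd a ∧ Equinum x a := by
  obtain ⟨G, hG, hG₁, hG₂⟩ := exists_choice hC hx
  have := hG.comp
  -- Transfinite recursion by approximations. The value at `b` is the choice of `G` from what the
  -- values below `b` leave of `x`; `Att f α` says that `f` obeys this rule on `α`, and `Val` merges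
  -- all such `f`.
  let Rest : V → V → V → Prop := fun p b f =>
    S p ∧ ∀ t, t ∈ᵛ p ↔ t ∈ᵛ x ∧ ¬ ∃ c, c ∈ᵛ b ∧ PairMem c t f
  have hRest : Dfn fun e => Rest (e 0) (e 1) (e 2) := by dsimp only [Rest]; infer_instance
  have := fun t s r [DT t] [DT s] [DT r] => hRest.comp₃ t s r
  let Att : V → V → Prop := fun f α => IsOrd α ∧ (∀ b, b ∈ᵛ α → ∃ a, PairMem b a f) ∧
    ∀ b a, b ∈ᵛ α → PairMem b a f → ∃ p, Rest p b f ∧ a ∈ᵛ p ∧ G p a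
  have hAtt : Dfn fun e => Att (e 0) (e 1) := by dsimp only [Att]; infer_instance
  have := fun t s [DT t] [DT s] => hAtt.comp₂ t s
  let Val : V → V → Prop := fun b a => ∃ f α, Att f α ∧ b ∈ᵛ α ∧ PairMem b a f
  have hVal : Dfn fun e => Val (e 0) (e 1) := by dsimp only [Val]; infer_instance
  have := fun t s [DT t] [DT s] => hVal.comp₂ t s
  have agree : ∀ f α f' α' b a a', Att f α → Att f' α' → b ∈ᵛ α → b ∈ᵛ α' →
      PairMem b a f → PairMem b a' f' → a = a' := by
    intro f α f' α' b a a' hf hf' hb hb' ha ha'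
    by_contra hne
    -- At the least disagreement, both approximations leave the same rest of `x`, hence they choose
    -- the same element.
    obtain ⟨c, -, -, ⟨hc, hc', d, d', hd, hd', hdd'⟩, hmin⟩ := (hf.1.mem hb).exists_least
      (fun b => b ∈ᵛ α ∧ b ∈ᵛ α' ∧ ∃ a a', PairMem b a f ∧ PairMem b a' f' ∧ ¬ a = a')
      ⟨hb, hb', a, a', ha, ha', hne⟩
    have heq : ∀ g t, g ∈ᵛ c → (PairMem g t f ↔ PairMem g t f') := by
      intro g t hg
      have hgα := hf.1.trans hc hg
      have hgα' := hf'.1.trans hc' hg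
      obtain ⟨s, hs⟩ := hf.2.1 g hgα
      obtain ⟨s', hs'⟩ := hf'.2.1 g hgα'
      have key : ∀ r r', PairMem g r f → PairMem g r' f' → r = r' := fun r r' hr hr' => by
        by_contra hrr
        exact hmin g hg ⟨hgα, hgα', r, r', hr, hr', hrr⟩
      exact ⟨fun h => key t s' h hs' ▸ hs', fun h => key s t hs h ▸ hs⟩
    obtain ⟨p, hp, hdp, hGd⟩ := hf.2.2 c d hc hd
    obtain ⟨p', hp', hdp', hGd'⟩ := hf'.2.2 c d' hc' hd'
    obtain rfl : p = p' := BasicSet.ext hp.1 hp'.1 fun t => by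
      rw [hp.2, hp'.2]
      exact and_congr_right fun _ => not_congr (exists_congr fun g => and_congr_right fun hg => heq g t hg)
    exact hdd' (hG₂ p d d' hp.1 (fun t ht => ((hp.2 t).1 ht).1) hdp hdp' hGd hGd')
  have val_iff : ∀ f α b t, Att f α → b ∈ᵛ α → (Val b t ↔ PairMem b t f) := by
    intro f α b t hf hb
    refine ⟨fun ⟨f', α', hf', hb', ht⟩ => ?_, fun h => ⟨f, α, hf, hb, h⟩⟩
    obtain ⟨s, hs⟩ := hf.2.1 b hb
    exact agree f α f' α' b s t hf hf' hb hb' hs ht ▸ hs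
  have val_fun : ∀ b a a', Val b a → Val b a' → a = a' := by
    rintro b a a' ⟨f, α, hf, hb, h⟩ ⟨f', α', hf', hb', h'⟩
    exact agree f α f' α' b a a' hf hf' hb hb' h h'
  have val_mem : ∀ b a, Val b a → a ∈ᵛ x ∧ IsOrd b := by
    rintro b a ⟨f, α, hf, hb, h⟩
    obtain ⟨p, hp, hap, -⟩ := hf.2.2 b a hb h
    exact ⟨((hp.2 a).1 hap).1, hf.1.mem hb⟩
  have val_lt : ∀ b c a, Val b a → Val c a → ¬ b ∈ᵛ c := by
    rintro b c a hba ⟨f, α, hf, hc, h⟩ hbc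
    obtain ⟨p, hp, hap, -⟩ := hf.2.2 c a hc h
    exact ((hp.2 a).1 hap).2 ⟨b, hbc, (val_iff f α b a hf (hf.1.trans hc hbc)).1 hba⟩
  have val_inj : ∀ b c a, Val b a → Val c a → b = c := by
    intro b c a hb hc
    rcases (val_mem _ _ hb).2.trichotomy (val_mem _ _ hc).2 with h | h | h
    · exact (val_lt _ _ _ hb hc h).elim
    · exact h
    · exact (val_lt _ _ _ hc hb h).elim
  obtain ⟨y, hy, hy'⟩ := sep (fun a => ∃ b, Val b a) hx
  -- As no element of `x` is the value at two ordinals, the ordinals with a value are an image of a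
  -- part of `x`; by replacement they form a set.
  obtain ⟨A, hA, hA'⟩ := repl (fun a b => Val b a) hy fun a ha => by
    obtain ⟨b, hb⟩ := ((hy' a).1 ha).2
    exact ⟨b, hb, fun c hc => val_inj c b a hc hb⟩
  have memA : ∀ b, b ∈ᵛ A ↔ ∃ a, Val b a := fun b => (hA' b).trans
    ⟨fun ⟨a, _, h⟩ => ⟨a, h⟩, fun ⟨a, h⟩ => ⟨a, (hy' a).2 ⟨(val_mem _ _ h).1, b, h⟩, h⟩⟩
  have hAo : IsOrd A := isOrd_of_forall hA fun b hb => by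
    obtain ⟨a, f, α, hf, hbα, hfa⟩ := (memA b).1 hb
    refine ⟨hf.1.mem hbα, fun c hc => (memA c).2 ?_⟩
    obtain ⟨d, hd⟩ := hf.2.1 c (hf.1.trans hbα hc)
    exact ⟨d, f, α, hf, hf.1.trans hbα hc, hd⟩
  have hall : ∀ a, a ∈ᵛ x → ∃ b, Val b a := by
    by_contra hn
    push Not at hn
    obtain ⟨a₀, ha₀, hn⟩ := hn
    obtain ⟨p, hp, hp'⟩ := sep (fun a => ¬ ∃ b, Val b a) hx
    obtain ⟨a, hap, hGa⟩ := hG₁ p hp (fun t ht => ((hp' t).1 ht).1) ⟨a₀, (hp' _).2 ⟨ha₀,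
        by simpa using hn⟩⟩
    obtain ⟨g, hg, hg'⟩ := repl (fun b s => ∃ a, Val b a ∧ IsPair s b a) hA fun b hb => by
      obtain ⟨a, ha⟩ := (memA b).1 hb
      refine ⟨pr b a, ⟨a, ha, isPair_iff.2 rfl⟩, ?_⟩
      rintro r ⟨c, hc, hr⟩
      rw [isPair_iff.1 hr, val_fun b c a hc ha]
    -- If some element of `x` were left over, the recursion would have one more step, at `A`. Then
    -- `A` would have a value and so belong to itself.
    let f := cup g (upair (pr A a) (pr A a))
    have hfm : ∀ b c, PairMem b c f ↔ Val b c ∨ (b = A ∧ c = a) := by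
      intro b c
      simp only [pairMem_iff, f, mem_cup, mem_upair, or_self, pr_inj, hg', isPair_iff]
      refine or_congr ⟨fun ⟨w, _, d, hd, h₁, h₂⟩ => by subst h₁ h₂; exact hd, fun h => ?_⟩ Iff.rfl
      exact ⟨b, (memA b).2 ⟨c, h⟩, c, h, rfl, rfl⟩
    have hf : Att f (succ A) := by
      refine ⟨hAo.succ, fun b hb => ?_, fun b c hb hc => ?_⟩
      · rcases mem_succ.1 hb with hb | rfl
        · obtain ⟨c, hc⟩ := (memA b).1 hb
          exact ⟨c, (hfm _ _).2 (Or.inl hc)⟩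
        · exact ⟨a, (hfm _ _).2 (Or.inr ⟨rfl, rfl⟩)⟩
      · rcases (hfm _ _).1 hc with ⟨f', α, hf', hbα, hbc⟩ | ⟨rfl, rfl⟩
        · obtain ⟨q, hq, hcq, hGc⟩ := hf'.2.2 b c hbα hbc
          refine ⟨q, ⟨hq.1, fun t => (hq.2 t).trans (and_congr_right fun _ => not_congr
            (exists_congr fun d => and_congr_right fun hd => ?_))⟩, hcq, hGc⟩
          have hbA : b ∈ᵛ A := (memA b).2 ⟨c, f', α, hf', hbα, hbc⟩
          rw [hfm, val_iff f' α d t hf' (hf'.1.trans hbα hd)]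
          refine ⟨Or.inl, fun h => h.resolve_right ?_⟩
          rintro ⟨rfl, -⟩
          exact not_mem_symm hd hbA
        · refine ⟨p, ⟨hp, fun t => (hp' t).trans (and_congr_right fun _ => not_congr ?_)⟩, hap, hGa⟩
          refine ⟨fun ⟨d, hd⟩ => ⟨d, (memA d).2 ⟨t, hd⟩, (hfm _ _).2 (Or.inl hd)⟩, fun ⟨d, hd,
              hdt⟩ => ?_⟩
          rcases (hfm _ _).1 hdt with h | ⟨rfl, -⟩
          · exact ⟨d, h⟩
          · exact (not_mem_self _ hd).elim
    exact not_mem_self A ((memA A).2 ⟨a, f, succ A, hf, mem_succ.2 (Or.inr rfl),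
        (hfm _ _).2 (Or.inr ⟨rfl, rfl⟩)⟩)
  refine ⟨A, hAo, equinum_of_injOn (R := fun a b => Val b a) (by unfold DRel; infer_instance) hx hA
    ⟨fun a ha => ?_, ?_⟩ fun b hb => ?_⟩
  · obtain ⟨b, hb⟩ := hall a ha
    exact ⟨b, (memA b).2 ⟨a, hb⟩, hb⟩
  · rintro a a' b b' - - - - hab hab'
    constructor
    · rintro rfl
      exact val_inj _ _ _ hab hab'
    · rintro rfl
      exact val_fun _ _ _ hab hab'
  · obtain ⟨a, ha⟩ := (memA b).1 hb
    exact ⟨a, (val_mem _ _ ha).1, ha⟩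

end Wellorder

/-! ### Cardinal arithmetic in a model -/

section Cardinals

variable {V : Type} [SetStr V] [BasicSet V]

theorem IsCardOf.unique {c d x : V} (hc : IsCardOf c x) (hd : IsCardOf d x) : c = d := by
  rcases hc.1.1.trichotomy hd.1.1 with h | h | h
  · exact (hd.1.2 c h (hc.2.symm.trans hd.2)).elim
  · exact h
  · exact (hc.1.2 d h (hd.2.symm.trans hc.2)).elim

theorem exists_isCardOf (hC : AxChoice V) {x : V} (hx : S x) : ∃ c, IsCardOf c x := by
  obtain ⟨a, ha, hxa⟩ := exists_equinum_ord hC hx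
  obtain ⟨c, -, hc, hxc, hmin⟩ := ha.exists_least (fun a => Equinum x a) hxa
  exact ⟨c, ⟨hc, fun y hy h => hmin y hy (hxc.trans h.symm)⟩, hxc⟩

omit [BasicSet V] in
theorem InjOn.trans {R T : V → V → Prop} {x y z : V} (h : InjOn R x y) (h' : InjOn T y z) :
    InjOn (fun a c => ∃ b, b ∈ᵛ y ∧ R a b ∧ T b c) x z := by
  refine ⟨fun a ha => ?_, ?_⟩
  · obtain ⟨b, hb, hab⟩ := h.1 a ha
    obtain ⟨c, hc, hbc⟩ := h'.1 b hb
    exact ⟨c, hc, b, hb, hab, hbc⟩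
  · rintro a a' c c' ha ha' hc hc' ⟨b, hb, hab, hbc⟩ ⟨b', hb', hab', hbc'⟩
    exact (h.2 _ _ _ _ ha ha' hb hb' hab hab').trans (h'.2 _ _ _ _ hb hb' hc hc' hbc hbc')

omit [BasicSet V] in
theorem InjOn.of_sub {x y : V} (h : Sub x y) : InjOn (fun a b : V => a = b) x y :=
  ⟨fun a ha => ⟨a, h a ha, rfl⟩, by rintro a a' _ _ - - - - rfl rfl; rfl⟩

theorem DRel.trans {R T : V → V → Prop} (hR : DRel R) (hT : DRel T) (y : V) :
    DRel fun a c => ∃ b, b ∈ᵛ y ∧ R a b ∧ T b c := by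
  have := hR.comp
  have := hT.comp
  unfold DRel
  infer_instance

theorem dRel_eq : DRel fun a b : V => a = b := by
  unfold DRel
  infer_instance

/-- If `d ∈ c`, then `d ⊆ c`, while `c` injects into `d` through `x ⊆ y`. Cantor-Bernstein would
make `c` equinumerous with its own element `d`. -/
theorem cardLe_of_sub {x y c d : V} (hc : IsCardOf c x) (hd : IsCardOf d y) (h : Sub x y) :
    CardLe c d := by
  refine ⟨hc.1, hd.1, ?_⟩
  rcases hc.1.1.trichotomy hd.1.1 with h' | h' | h'
  · exact Or.inl h'
  · exact Or.inr h'
  · exfalso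
    obtain ⟨R, hR, hR', -⟩ := hc.2.symm.exists_injOn
    obtain ⟨T, hT, hT', -⟩ := hd.2.exists_injOn
    have hsub : Sub d c := (hd.1.1.sub_iff hc.1.1).2 (Or.inl h')
    exact hc.1.2 d h' (equinum_of_injOn_injOn dRel_eq ((hR.trans dRel_eq x).trans hT y)
      hd.1.1.1 hc.1.1.1 (.of_sub hsub) ((hR'.trans (.of_sub h)).trans hT'))

/-- The smaller cardinal is a subset of the larger one, and a bijection from the latter to `x`
carries it to a part of `x`. -/
theorem exists_sub_isCardOf {x c d : V} (hc : IsCardOf c x) (h : CardLe d c) :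
    ∃ y, S y ∧ Sub y x ∧ IsCardOf d y := by
  obtain ⟨R, hR, hR', -⟩ := hc.2.symm.exists_injOn
  have hsub : Sub d c := (h.1.1.sub_iff hc.1.1).2 h.2.2
  obtain ⟨z, hz, hzx, he, -⟩ := exists_image (dRel_eq.trans hR c) h.1.1.1 hc.2.1
    ((InjOn.of_sub hsub).trans hR')
  exact ⟨z, hz, hzx, h.1, he.symm⟩

/-- Equinumerous sets remain so when an element is removed from each. -/
theorem Equinum.remove {x y a b x' y' : V} (h : Equinum x y) (ha : a ∈ᵛ x) (hb : b ∈ᵛ y)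
    (hx' : S x') (hy' : S y') (hxx : ∀ t, t ∈ᵛ x' ↔ t ∈ᵛ x ∧ t ≠ a)
    (hyy : ∀ t, t ∈ᵛ y' ↔ t ∈ᵛ y ∧ t ≠ b) : Equinum x' y' := by
  obtain ⟨R, hR, ⟨h₁, h₂⟩, h₃⟩ := h.exists_injOn
  have := hR.comp
  -- The element that was sent to `b` now goes to the former image of `a`; all others keep their
  -- images.
  refine equinum_of_injOn (R := fun i j => (R i j ∧ ¬ R i b) ∨ (R i b ∧ R a j))
    (by unfold DRel; infer_instance) hx' hy' ⟨fun i hi => ?_, ?_⟩ fun j hj => ?_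
  · obtain ⟨hi, hia⟩ := (hxx i).1 hi
    by_cases hib : R i b
    · obtain ⟨j, hj, haj⟩ := h₁ a ha
      refine ⟨j, (hyy j).2 ⟨hj, ?_⟩, Or.inr ⟨hib, haj⟩⟩
      rintro rfl
      exact hia ((h₂ _ _ _ _ hi ha hb hb hib haj).2 rfl)
    · obtain ⟨j, hj, hij⟩ := h₁ i hi
      refine ⟨j, (hyy j).2 ⟨hj, ?_⟩, Or.inl ⟨hij, hib⟩⟩
      rintro rfl
      exact hib hij
  · intro i i' j j' hi hi' hj hj' hij hij'
    obtain ⟨hi, hia⟩ := (hxx i).1 hi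
    obtain ⟨hi', hia'⟩ := (hxx i').1 hi'
    obtain ⟨hj, hjb⟩ := (hyy j).1 hj
    obtain ⟨hj', hjb'⟩ := (hyy j').1 hj'
    rcases hij with ⟨p, q⟩ | ⟨p, q⟩ <;> rcases hij' with ⟨r, s⟩ | ⟨r, s⟩
    · exact h₂ _ _ _ _ hi hi' hj hj' p r
    · refine iff_of_false (by rintro rfl; exact q r) ?_
      rintro rfl
      exact hia ((h₂ _ _ _ _ hi ha hj hj p s).2 rfl)
    · refine iff_of_false (by rintro rfl; exact s p) ?_
      rintro rfl
      exact hia' ((h₂ _ _ _ _ hi' ha hj hj r q).2 rfl)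
    · exact iff_of_true ((h₂ _ _ _ _ hi hi' hb hb p r).2 rfl) ((h₂ _ _ _ _ ha ha hj hj' q s).1 rfl)
  · obtain ⟨hj, hjb⟩ := (hyy j).1 hj
    obtain ⟨i, hi, hij⟩ := h₃ j hj
    by_cases hia : i = a
    · subst hia
      obtain ⟨k, hk, hkb⟩ := h₃ b hb
      refine ⟨k, (hxx k).2 ⟨hk, ?_⟩, Or.inr ⟨hkb, hij⟩⟩
      rintro rfl
      exact hjb ((h₂ _ _ _ _ hk hk hj hb hij hkb).1 rfl)
    · refine ⟨i, (hxx i).2 ⟨hi, hia⟩, Or.inl ⟨hij, fun hib => ?_⟩⟩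
      exact hjb ((h₂ _ _ _ _ hi hi hj hb hij hib).1 rfl)

/-- A set that is equinumerous with a natural number has no equinumerous proper subset. -/
theorem not_equinum_of_ssub {n x y b : V} (hn : IsNat n) (hx : Equinum x n) (hy : Equinum y n)
    (hxy : Sub x y) (hb : b ∈ᵛ y) : b ∈ᵛ x := by
  by_contra hbx
  -- The least `m` that admits a counterexample cannot be zero. Removing one element of `x` from
  -- both sets then yields a counterexample for its predecessor.
  obtain ⟨m, hmn, hm, ⟨x, y, b, hx, hy, hxy, hb, hbx⟩, hmin⟩ := hn.1.exists_least
    (fun n => ∃ x y b, Equinum x n ∧ Equinum y n ∧ Sub x y ∧ b ∈ᵛ y ∧ ¬ b ∈ᵛ x)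
    ⟨x, y, b, hx, hy, hxy, hb, hbx⟩
  rcases hn.2 m hmn with h | ⟨k, hk⟩
  · obtain ⟨R, -, hR, -⟩ := hy.exists_injOn
    obtain ⟨t, ht, -⟩ := hR.1 b hb
    exact h.2 t ht
  · have hkm : k ∈ᵛ m := (hk.2 k).2 (Or.inr rfl)
    obtain ⟨R, -, -, hR⟩ := hx.exists_injOn
    obtain ⟨a, ha, -⟩ := hR k hkm
    obtain ⟨x', hx', hxx⟩ := sep (fun t => ¬ t = a) hx.1
    obtain ⟨y', hy', hyy⟩ := sep (fun t => ¬ t = a) hy.1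
    have hkk : ∀ t, t ∈ᵛ k ↔ t ∈ᵛ m ∧ t ≠ k := fun t => by
      rw [hk.2]
      refine ⟨fun h => ⟨Or.inl h, ?_⟩, fun ⟨h, h'⟩ => h.resolve_right h'⟩
      rintro rfl
      exact not_mem_self t h
    have hkS := (hm.mem hkm).1
    refine hmin k hkm ⟨x', y', b, hx.remove ha hkm hx' hkS hxx hkk,
      hy.remove (hxy a ha) hkm hy' hkS hyy hkk, fun t ht => ?_, (hyy b).2 ⟨hb, ?_⟩, fun h => hbx ((hxx b).1 h).1⟩
    · exact (hyy t).2 ⟨hxy t ((hxx t).1 ht).1, ((hxx t).1 ht).2⟩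
    · rintro rfl
      exact hbx ha

theorem cardLt_of_ssub {x y c d : V} (hc : IsCardOf c x) (hd : IsCardOf d y) (h : Sub x y)
    (hn : IsNat c) (hne : x ≠ y) : CardLt c d := by
  have hle := cardLe_of_sub hc hd h
  refine ⟨hc.1, hd.1, hle.2.2.resolve_right ?_⟩
  rintro rfl
  exact hne (BasicSet.ext hc.2.1 hd.2.1 fun t => ⟨h t, not_equinum_of_ssub hn hc.2 hd.2 h⟩)

theorem isCardOf_emp_iff {x : V} (hx : S x) : IsCardOf (emp V) x ↔ ∀ t, ¬ t ∈ᵛ x := by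
  refine ⟨fun h t ht => ?_, fun h => ?_⟩
  · obtain ⟨R, -, hR, -⟩ := h.2.exists_injOn
    obtain ⟨b, hb, -⟩ := hR.1 t ht
    exact not_mem_emp b hb
  · obtain rfl := isZero_iff.1 ⟨hx, h⟩
    exact ⟨⟨isOrd_emp, fun y hy => (not_mem_emp y hy).elim⟩, .refl hx⟩

theorem isCardOf_one_upair (a : V) : IsCardOf (upair (emp V) (emp V)) (upair a a) := by
  have h1 : succ (emp V) = upair (emp V) (emp V) := BasicSet.ext (isSet_succ _) (isSet_upair _ _)
    fun t => by simp [not_mem_emp]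
  refine ⟨⟨h1 ▸ isOrd_emp.succ, fun y hy h => ?_⟩, ?_⟩
  · obtain rfl : y = emp V := by simpa using hy
    obtain ⟨R, -, -, hR⟩ := h.exists_injOn
    obtain ⟨b, hb, -⟩ := hR (emp V) (by simp)
    exact not_mem_emp b hb
  · refine equinum_of_injOn (R := fun x y => x = a ∧ y = emp V) (by unfold DRel; infer_instance)
      (isSet_upair _ _) (isSet_upair _ _) ⟨fun b hb => ⟨emp V, by simp, by simpa using hb, rfl⟩, ?_⟩
      fun b hb => ⟨a, by simp, rfl, by simpa using hb⟩
    rintro b b' c c' - - - - ⟨rfl, rfl⟩ ⟨rfl, rfl⟩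
    simp

/-- A set that contains the pairs of elements of `x` and `y`. -/
theorem exists_prod (x y : V) : ∃ P, S P ∧ ∀ a b, a ∈ᵛ x → b ∈ᵛ y → pr a b ∈ᵛ P := by
  obtain ⟨P₁, hP₁, h₁⟩ := BasicSet.power (isSet_cup x y)
  obtain ⟨P₂, hP₂, h₂⟩ := BasicSet.power hP₁
  refine ⟨P₂, hP₂, fun a b ha hb => (h₂ _).2 ⟨isSet_upair _ _, fun t ht => (h₁ t).2 ?_⟩⟩
  rcases mem_upair.1 ht with rfl | rfl
  · exact ⟨isSet_upair _ _, fun s hs => by simp at hs; simp [hs, ha]⟩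
  · refine ⟨isSet_upair _ _, fun s hs => ?_⟩
    rcases mem_upair.1 hs with rfl | rfl <;> simp [ha, hb]

theorem isCardPow_power {x P c d : V} (hP : S P) (hP' : ∀ t, t ∈ᵛ P ↔ S t ∧ Sub t x)
    (hc : IsCardOf c x) (hd : IsCardOf d P) : IsCardPow d c := by
  let o := emp V
  let i := upair (emp V) (emp V)
  have hoi : o ≠ i := fun h => by
    have : emp V ∈ᵛ i := by simp [i]
    rw [← h] at this
    exact not_mem_emp _ this
  have h2 : IsTwo (upair o i) := ⟨isSet_upair _ _, fun t => by simp [isZero_iff, isOne_iff, o, i]⟩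
  obtain ⟨W, hW, hW'⟩ := exists_prod c (upair o i)
  obtain ⟨W₁, hW₁, hW₁'⟩ := BasicSet.power hW
  obtain ⟨F, hF, hF'⟩ := sep (fun f => IsFun f c (upair o i)) hW₁
  have hFm : ∀ f, f ∈ᵛ F ↔ IsFun f c (upair o i) := fun f => by
    refine (hF' f).trans (and_iff_right_of_imp fun h => (hW₁' f).2 ⟨h.1, fun p hp => ?_⟩)
    obtain ⟨a, b, ha, hb, hab⟩ := h.2.1 p hp
    exact isPair_iff.1 hab ▸ hW' a b ha hb
  refine ⟨hc.1, _, h2, F, hF, hFm, hd.1, Equinum.trans ?_ hd.2⟩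
  obtain ⟨H, hH, ⟨h₁, h₂⟩, h₃⟩ := hc.2.exists_injOn
  have := hH.comp
  have val : ∀ f β, IsFun f c (upair o i) → β ∈ᵛ c → (PairMem β o f ↔ ¬ PairMem β i f) := by
    intro f β hf hβ
    obtain ⟨b, hb, hu⟩ := hf.2.2 β hβ
    refine ⟨fun h h' => hoi ((hu o h).trans (hu i h').symm), fun h => ?_⟩
    obtain ⟨p, hp, hpb⟩ := hb
    obtain ⟨γ, b', -, hb', hpb'⟩ := hf.2.1 p hp
    rw [isPair_iff] at hpb hpb'
    obtain ⟨-, rfl⟩ := pr_inj.1 (hpb.symm.trans hpb')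
    rcases mem_upair.1 hb' with rfl | rfl
    · exact ⟨p, hp, isPair_iff.2 hpb⟩
    · exact (h ⟨p, hp, isPair_iff.2 hpb⟩).elim
  have fext : ∀ f g, IsFun f c (upair o i) → IsFun g c (upair o i) →
      (∀ β, β ∈ᵛ c → PairMem β i f → PairMem β i g) → (∀ β, β ∈ᵛ c → PairMem β i g → PairMem β i f) →
      Sub f g := by
    intro f g hf hg hfg hgf p hp
    obtain ⟨β, b, hβ, hb, hpb⟩ := hf.2.1 p hp
    have hm : PairMem β b f := ⟨p, hp, hpb⟩
    have : PairMem β b g := by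
      rcases mem_upair.1 hb with rfl | rfl
      · rw [val g β hg hβ]
        exact fun h => (val f β hf hβ).1 hm (hgf β hβ h)
      · exact hfg β hβ hm
    rw [pairMem_iff] at this
    exact isPair_iff.1 hpb ▸ this
  -- A function `f` from `c` to `2` corresponds to the set of those `t` in `x` whose image under the
  -- bijection `H` has the value `1`.
  refine equinum_of_injOn (R := fun f y => ∀ t, t ∈ᵛ x → (t ∈ᵛ y ↔ ∃ β, β ∈ᵛ c ∧ H t β ∧ PairMem β i f))
    (by unfold DRel; infer_instance) hF hP ⟨fun f hf => ?_, ?_⟩ fun y hy => ?_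
  · obtain ⟨y, hy, hy'⟩ := sep (fun t => ∃ β, β ∈ᵛ c ∧ H t β ∧ PairMem β i f) hc.2.1
    exact ⟨y, (hP' y).2 ⟨hy, fun t ht => ((hy' t).1 ht).1⟩, fun t ht => (hy' t).trans (and_iff_right ht)⟩
  · intro f g y z hf hg hy hz hfy hgz
    rw [hFm] at hf hg
    rw [hP'] at hy hz
    constructor
    · rintro rfl
      refine BasicSet.ext hy.1 hz.1 fun t => ⟨fun h => ?_, fun h => ?_⟩
      · exact (hgz t (hy.2 t h)).2 ((hfy t (hy.2 t h)).1 h)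
      · exact (hfy t (hz.2 t h)).2 ((hgz t (hz.2 t h)).1 h)
    · rintro rfl
      have key : ∀ f g, (∀ t, t ∈ᵛ x → (t ∈ᵛ y ↔ ∃ β, β ∈ᵛ c ∧ H t β ∧ PairMem β i f)) →
          (∀ t, t ∈ᵛ x → (t ∈ᵛ y ↔ ∃ β, β ∈ᵛ c ∧ H t β ∧ PairMem β i g)) →
          ∀ β, β ∈ᵛ c → PairMem β i f → PairMem β i g := by
        intro f g hf hg β hβ h
        obtain ⟨t, ht, htβ⟩ := h₃ β hβ
        obtain ⟨γ, hγ, htγ, h'⟩ := (hg t ht).1 ((hf t ht).2 ⟨β, hβ, htβ, h⟩)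
        exact (h₂ _ _ _ _ ht ht hγ hβ htγ htβ).1 rfl ▸ h'
      exact BasicSet.ext hf.1 hg.1 fun p =>
        ⟨fext f g hf hg (key f g hfy hgz) (key g f hgz hfy) p,
          fext g f hg hf (key g f hgz hfy) (key f g hfy hgz) p⟩
  · obtain ⟨f, hf, hf'⟩ := sep (fun p => ∃ t β, t ∈ᵛ x ∧ β ∈ᵛ c ∧ H t β ∧
      ((t ∈ᵛ y ∧ IsPair p β i) ∨ (¬ t ∈ᵛ y ∧ IsPair p β o))) hW
    have hfm : ∀ t β b, t ∈ᵛ x → β ∈ᵛ c → H t β → (PairMem β b f ↔ (t ∈ᵛ y ∧ b = i) ∨ (¬ t ∈ᵛ y ∧ b = o)) := by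
      intro t β b ht hβ htβ
      rw [pairMem_iff, hf']
      simp only [isPair_iff, pr_inj]
      constructor
      · rintro ⟨-, s, γ, hs, hγ, hsγ, h⟩
        have hβγ : β = γ := by rcases h with ⟨-, h, -⟩ | ⟨-, h, -⟩ <;> exact h
        subst hβγ
        obtain rfl := (h₂ _ _ _ _ hs ht hβ hβ hsγ htβ).2 rfl
        exact h.imp (fun h => ⟨h.1, h.2.2⟩) fun h => ⟨h.1, h.2.2⟩
      · rintro h
        refine ⟨hW' β b hβ ?_, t, β, ht, hβ, htβ, h.imp (fun h => ⟨h.1, rfl, h.2⟩) fun h => ⟨h.1, rfl, h.2⟩⟩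
        rcases h with ⟨-, rfl⟩ | ⟨-, rfl⟩ <;> simp
    refine ⟨f, (hFm f).2 ⟨hf, fun p hp => ?_, fun β hβ => ?_⟩, fun t ht => ?_⟩
    · obtain ⟨-, t, β, ht, hβ, -, ⟨-, h⟩ | ⟨-, h⟩⟩ := (hf' p).1 hp
      · exact ⟨β, i, hβ, by simp, h⟩
      · exact ⟨β, o, hβ, by simp, h⟩
    · obtain ⟨t, ht, htβ⟩ := h₃ β hβ
      by_cases hty : t ∈ᵛ y
      · refine ⟨i, (hfm t β i ht hβ htβ).2 (Or.inl ⟨hty, rfl⟩), fun b hb => ?_⟩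
        rcases (hfm t β b ht hβ htβ).1 hb with h | h
        exacts [h.2, (h.1 hty).elim]
      · refine ⟨o, (hfm t β o ht hβ htβ).2 (Or.inr ⟨hty, rfl⟩), fun b hb => ?_⟩
        rcases (hfm t β b ht hβ htβ).1 hb with h | h
        exacts [(hty h.1).elim, h.2]
    · obtain ⟨β, hβ, htβ⟩ := h₁ t ht
      refine ⟨fun h => ⟨β, hβ, htβ, (hfm t β i ht hβ htβ).2 (Or.inl ⟨h, rfl⟩)⟩, ?_⟩
      rintro ⟨γ, hγ, htγ, h⟩
      rcases (hfm t γ i ht hγ htγ).1 h with h | h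
      exacts [h.1, (hoi h.2.symm).elim]

end Cardinals

/-! ## Models of ZFU as models of quasi-set theory -/

section Interpretation

variable {V : Type} [SetStr V] [BasicSet V]

open Classical in
/-- The cardinal of a set, and the empty set for an urelement. -/
noncomputable def card (x : V) : V := if h : ∃ c, IsCardOf c x then h.choose else emp V

theorem isCardOf_card (hC : AxChoice V) {x : V} (hx : S x) : IsCardOf (card x) x := by
  have h := exists_isCardOf hC hx
  rw [card, dif_pos h]
  exact h.choose_spec

theorem card_of_not_isSet {x : V} (hx : ¬ S x) : card x = emp V :=
  dif_neg fun ⟨_, h⟩ => hx h.2.1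

theorem IsCardOf.card_eq {x c : V} (h : IsCardOf c x) : card x = c := by
  have h' : ∃ c, IsCardOf c x := ⟨c, h⟩
  rw [card, dif_pos h']
  exact h'.choose_spec.unique h

/-- Replaces the chosen value `card x` by a condition in the language of ZFU, so that the graph of
`card` is definable. -/
theorem eq_card_iff (hC : AxChoice V) {x c : V} :
    c = card x ↔ IsCardOf c x ∨ (¬ S x ∧ IsZero c) := by
  by_cases hx : S x
  · have := isCardOf_card hC hx
    refine ⟨fun h => Or.inl (h ▸ this), fun h => ?_⟩
    exact (h.resolve_right fun h => h.1 hx).card_eq.symm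
  · rw [card_of_not_isSet hx, ← isZero_iff]
    exact ⟨fun h => Or.inr ⟨hx, h⟩, fun h => h.elim (fun h => (hx h.2.1).elim) fun h => h.2⟩

/-- A model of ZFU as a structure for quasi-set theory without micro-atoms. -/
noncomputable instance : LQ.Structure V where
  funMap := fun {_} f ts => match f with
    | QFun.qc => card (ts 0)
  RelMap := fun {_} R ts => match R with
    | QRel.m => False
    | QRel.M => ¬ S (ts 0)
    | QRel.Z => S (ts 0)
    | QRel.ind => ts 0 = ts 1
    | QRel.mem => ts 0 ∈ᵛ ts 1

@[simp] theorem qm_iff (x : V) : qm x ↔ False := Iff.rfl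
@[simp] theorem qM_iff (x : V) : qM x ↔ ¬ S x := Iff.rfl
@[simp] theorem qZ_iff_isSet (x : V) : qZ x ↔ S x := Iff.rfl
@[simp] theorem qind_iff (x y : V) : qind x y ↔ x = y := Iff.rfl
@[simp] theorem qmem_iff (x y : V) : qmem x y ↔ x ∈ᵛ y := Iff.rfl
@[simp] theorem qcd_eq (x : V) : qcd x = card x := rfl
@[simp] theorem qQ_iff (x : V) : qQ x ↔ S x := by simp [qQ]
@[simp] theorem qD_iff (x : V) : qD x ↔ True := by simp [qD, em']
@[simp] theorem qEq_iff (x y : V) : qEq x y ↔ x = y := by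
  refine ⟨?_, ?_⟩
  · simp only [qEq, qQ_iff, qmem_iff, qM_iff]
    rintro (⟨hx, hy, h⟩ | ⟨-, -, h⟩)
    · exact BasicSet.ext hx hy h
    -- Two urelements in the same sets are equal, as the singleton of one of them shows.
    · have h' : y ∈ᵛ upair x x := (h (upair x x) (isSet_upair x x)).1 (by simp)
      rw [mem_upair] at h'
      exact (h'.elim id id).symm
  · rintro rfl
    simp [qEq, em]

/-- Every object of this structure is classical, so relativized quantifiers are unrestricted. The
clauses on `M` and `Z` follow from the equality or membership that they accompany. -/
theorem sat_tr (A : Fml LZ) : ∀ e : ℕ → V, Sat (Qset.tr A) e ↔ Sat A e := by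
  induction A with
  | @rel k R ts =>
    intro e
    have hts : ∀ i, (Qset.trTerm (ts i)).realize e = (ts i).realize e := fun i => by
      cases ts i with
      | var m => rfl
      | func f _ => exact Empty.elim f
    cases R with
    | S => simp [Qset.tr, hts, Sat]; exact Iff.rfl
    | mem =>
      have h : ∀ x y : V, ((¬ S x ∨ S x) ∧ S y) ∧ x ∈ᵛ y ↔ x ∈ᵛ y := fun x y =>
        ⟨fun h => h.2, fun h => ⟨⟨em' _, BasicSet.isSet_of_mem h⟩, h⟩⟩
      simp only [Qset.tr, hts, Sat, sat_and, sat_M, sat_Z, sat_qmem, qM_iff, qZ_iff_isSet,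
          qmem_iff, h]
      exact Iff.rfl
    | eq =>
      have h : ∀ x y : V, ((¬ S x ∧ ¬ S y) ∨ (S x ∧ S y)) ∧ x = y ↔ x = y := fun x y => by
        refine ⟨fun h => h.2, ?_⟩
        rintro rfl
        simp [em']
      simp only [Qset.tr, hts, Sat, sat_and, sat_M, sat_Z, sat_eqE, qM_iff, qZ_iff_isSet,
          qEq_iff, h]
      exact Iff.rfl
  | neg A ih => intro e; simp only [Qset.tr, sat_neg, ih]
  | or A B ih₁ ih₂ => intro e; simp only [Qset.tr, sat_or, ih₁, ih₂]
  | all A ih => intro e; simp [Qset.tr, ih, em']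

theorem sat_cl_iff (A : Fml LZ) (ts : List Qset.Tm) (e : ℕ → V) :
    Sat (Qset.cl A ts) e ↔ Sat A fun i => (ts.getD i (Qset.v i)).realize e := by
  rw [sat_cl, sat_tr]

/-! ### Definability of the formulas of quasi-set theory -/

-- Naming the value by an existential quantifier allows a function with definable graph to be put
-- into a definable predicate.
omit [BasicSet V] in
theorem Dfn.exists_eq {t : (ℕ → V) → V} (ht : Dfn fun e : ℕ → V => e 0 = t fun n => e (n + 1))
    {P : V → (ℕ → V) → Prop} (hP : Dfn fun e : ℕ → V => P (e 0) fun n => e (n + 1)) :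
    Dfn fun e => P (t e) e :=
  Dfn.congr (Dfn.ex (fun a e => a = t e ∧ P a e)) (by simp)

theorem dfn_realize (hC : AxChoice V) (t : Qset.Tm) :
    Dfn fun e : ℕ → V => e 0 = t.realize fun n => e (n + 1) := by
  induction t with
  | var x => exact inferInstanceAs (Dfn fun e : ℕ → V => e 0 = e (x + 1))
  | @func l f ts ih =>
    cases f
    have hts : ∀ e : ℕ → V, FirstOrder.Language.Term.realize e (.func QFun.qc ts) =
        card ((ts 0).realize e) := fun e => rfl
    simp only [hts, eq_card_iff hC]
    refine Dfn.exists_eq (t := fun e => (ts 0).realize fun n => e (n + 1))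
      (P := fun a e => IsCardOf (e 0) a ∨ ¬ S a ∧ IsZero (e 0)) ?_ inferInstance
    exact (ih 0).comp (fun n e => if n = 0 then e 0 else e (n + 1)) fun n => by
      split_ifs <;> infer_instance

/-- Nested occurrences of $qc$ are eliminated through the definable graphs of terms. Thus separation
and replacement in ZFU cover the schemata of $\mathcal Q$. -/
theorem dfn_sat (hC : AxChoice V) (A : Fml LQ) : Dfn fun e : ℕ → V => Sat A e := by
  induction A with
  | @rel k R ts =>
    have one : ∀ (P : V → Prop), (Dfn fun e : ℕ → V => P (e 0)) → ∀ t : Qset.Tm,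
        Dfn fun e : ℕ → V => P (t.realize e) := fun P hP t =>
      Dfn.exists_eq (P := fun a _ => P a) (dfn_realize hC t) hP
    have two : ∀ (P : V → V → Prop), (Dfn fun e : ℕ → V => P (e 0) (e 1)) → ∀ t s : Qset.Tm,
        Dfn fun e : ℕ → V => P (t.realize e) (s.realize e) := fun P hP t s => by
      refine Dfn.exists_eq (P := fun a e => P a (s.realize e)) (dfn_realize hC t) ?_
      refine Dfn.exists_eq (t := fun e => s.realize fun n => e (n + 1)) (P := fun b e => P (e 0) b) ?_ (Dfn.comp₂ hP _ _)
      exact (dfn_realize hC s).comp (fun n e => if n = 0 then e 0 else e (n + 1)) fun n => by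
        split_ifs <;> infer_instance
    cases R with
    | m =>
      refine Dfn.congr (P := fun e : ℕ → V => ¬ e 0 = e 0) inferInstance fun e => ?_
      simp only [not_true]
      exact Iff.rfl
    | M => exact one (fun x => ¬ S x) inferInstance (ts 0)
    | Z => exact one (fun x => S x) inferInstance (ts 0)
    | ind => exact two (fun x y => x = y) inferInstance (ts 0) (ts 1)
    | mem => exact two (fun x y => x ∈ᵛ y) inferInstance (ts 0) (ts 1)
  | neg A ih => exact Dfn.not _
  | or A B ih₁ ih₂ => exact Dfn.or _ _
  | all A ih =>
    refine Dfn.all (fun a e => Sat A (cons a e)) (h := ?_)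
    exact Dfn.congr ih fun e => by rw [cons_tail]

theorem replacement_of_dfn_sat (hC : AxChoice V) (A : Fml LQ) (p : ℕ → V) {u : V} (hu : S u)
    (h : ∀ w, w ∈ᵛ u → ∃ s, Sat A (cons s (cons w p)))
    (h' : ∀ w, w ∈ᵛ u → ∀ s r, Sat A (cons s (cons w p)) → Sat A (cons r (cons w p)) → s = r) :
    ∃ z, S z ∧ ∀ s, s ∈ᵛ z ↔ ∃ w, w ∈ᵛ u ∧ Sat A (cons s (cons w p)) := by
  have : Dfn fun e' : ℕ → V => Sat A (cons (e' 1) (cons (e' 0) p)) :=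
    (dfn_sat hC A).comp (fun n e' => cons (e' 1) (cons (e' 0) p) n) fun n => by
      match n with
      | 0 => exact inferInstanceAs (DT fun e : ℕ → V => e 1)
      | 1 => exact inferInstanceAs (DT fun e : ℕ → V => e 0)
      | n + 2 => exact inferInstanceAs (DT fun _ : ℕ → V => p n)
  refine repl (fun w s => Sat A (cons s (cons w p))) hu fun w hw => ?_
  obtain ⟨s, hs⟩ := h w hw
  exact ⟨s, hs, fun r hr => h' w hw r s hr hs⟩

/-- A model of ZFU is a model of quasi-set theory. -/
theorem models_qset (hI : AxInfinity V) (hC : AxChoice V) : Models V Qset.Ax := by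
  intro φ hφ e
  have hcard : ∀ {x : V}, S x → IsCardOf (card x) x := fun hx => isCardOf_card hC hx
  have card_eq_emp : ∀ {x : V}, S x → (card x = emp V ↔ ∀ t, ¬ t ∈ᵛ x) := fun {x} hx => by
    rw [← isCardOf_emp_iff hx]
    exact ⟨fun h => h ▸ hcard hx, fun h => h.card_eq⟩
  cases hφ with
  | q1 => simp
  | q2 => simp
  | q3 => simp
  | q4 A =>
    simp only [sat_all, sat_imp, sat_rename, sat_eqE, realize_v, cons_zero, cons_succ, qEq_iff]
    rintro x _ rfl
    refine fun h => (iff_of_eq (congrArg _ ?_)).1 h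
    funext n; cases n <;> rfl
  | q5 => simp
  | q6 => simpa using fun x y h => BasicSet.isSet_of_mem h
  | q7 => simp
  | q8 => simp
  | q9 => simp
  | q10 => simpa [IsZero] using (exists_empty (V := V))
  | q11 => simp
  | q12 => simpa [IsUPair] using fun x y => BasicSet.pairing x y
  | q13 A =>
    simp only [sat_allQ, sat_exQ, sat_all, sat_iff, sat_and, sat_qmem, realize_v, qQ_iff, qmem_iff,
      sat_rename]
    intro x hx
    have : Dfn fun e' : ℕ → V => Sat A (cons (e' 0) (cons x e)) :=
      (dfn_sat hC A).comp (fun n e' => cons (e' 0) (cons x e) n) fun n => by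
        cases n with
        | zero => exact inferInstanceAs (DT fun e : ℕ → V => e 0)
        | succ n => exact inferInstanceAs (DT fun _ : ℕ → V => cons x e n)
    obtain ⟨z, hz, h⟩ := sep (fun t => Sat A (cons t (cons x e))) hx
    refine ⟨z, hz, fun t => (h t).trans (and_congr_right fun _ => iff_of_eq (congrArg _ ?_))⟩
    funext n; cases n <;> rfl
  | q14 =>
    simp [-forall_exists_index]
    intro x hx _
    obtain ⟨z, hz, h⟩ := BasicSet.union hx
    exact ⟨z, hz, fun t => (h t).trans (exists_congr fun _ => and_comm)⟩
  | q15 => simpa [Sub] using fun x hx => BasicSet.power (x := x) hx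
  | q16 =>
    simp
    obtain ⟨z, hz, ho, h⟩ := hI
    exact ⟨z, hz, ho, fun y hy _ => h y hy⟩
  | q17 =>
    simp
    intro x hx h hne
    obtain ⟨y, hy, h'⟩ := BasicSet.regularity hx (hne hx)
    exact ⟨y, h y hy, hy, fun t ht ht' => h' t ⟨ht, ht'⟩⟩
  | q18 =>
    simp
    intro x hx
    rw [card_of_not_isSet hx]
    exact isZero_emp
  | q19 =>
    simp [sat_cl_iff]
    exact fun x hx => ⟨⟨(hcard hx).1, fun _ => hcard hx⟩, fun a _ h _ => h⟩
  | q20 =>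
    simp
    intro x hx hne hc
    by_contra! h
    have : card x = emp V := isZero_iff.1 ⟨hc, h⟩
    obtain ⟨t, ht⟩ := hne hx
    exact (card_eq_emp hx).1 this t ht
  | q21 =>
    simp [sat_cl_iff]
    intro x hx a ha
    obtain ⟨y, hy, hyx, h⟩ := exists_sub_isCardOf (hcard hx) ha
    exact ⟨y, hy, hyx, h.card_eq⟩
  | q22 =>
    simp [sat_cl_iff]
    exact fun x hx y hy h => cardLe_of_sub (hcard hy) (hcard hx) h
  | q23 =>
    simp [sat_cl_iff, Qset.isFin]
    exact fun x hx y hy _ hn h hne => cardLt_of_ssub (hcard hx) (hcard hy) h hn hne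
  | q24 =>
    simp [sat_cl_iff]
    intro x hx y hy h
    obtain ⟨z, hz⟩ := exists_union x y
    refine ⟨z, hz, x, y, z, hcard hx, hcard hy, fun t ht => ?_, hz, hcard hz.1⟩
    exact (h t).elim (fun h => h ht.1) fun h => h ht.2
  | q25 =>
    simp [sat_cl_iff]
    intro x hx
    obtain ⟨P, hP, h⟩ := BasicSet.power hx
    exact ⟨P, ⟨hP, h⟩, isCardPow_power hP h (hcard hx) (hcard hP)⟩
  | q26 =>
    have key : ∀ x y : V, (∀ a : V, S a → ∀ u : V, u ∈ᵛ x →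
        (∀ t, t ∈ᵛ a ↔ t ∈ᵛ x ∧ t = u) → ∃ b : V,
          (S b ∧ ∃ w, w ∈ᵛ y ∧ ∀ t, t ∈ᵛ b ↔ t ∈ᵛ y ∧ t = w) ∧
          (∀ t s, t ∈ᵛ a → s ∈ᵛ b → t = s) ∧ card a = card b) → Sub x y := by
      intro x y h u hu
      -- Indistinguishability classes are singletons, so a class of `y` similar to `{u}` shows that
      -- `u` itself belongs to `y`.
      obtain ⟨b, ⟨-, w, hw, hb⟩, h', -⟩ := h (upair u u) (isSet_upair u u) u hu fun t => by
        simp only [mem_upair, or_self]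
        exact ⟨fun h => ⟨h ▸ hu, h⟩, fun h => h.2⟩
      rw [h' u w (by simp) ((hb w).2 ⟨hw, rfl⟩)]
      exact hw
    simp
    exact fun x hx y hy h h' => BasicSet.ext hx hy fun t => ⟨key x y h t, key y x h' t⟩
  | q27 A =>
    simp only [sat_allQ, sat_exQ, sat_all, sat_iff, sat_imp, sat_and, sat_ex, sat_qmem, sat_ind,
      realize_v, qQ_iff, qmem_iff, qind_iff, sat_rename]
    rintro x hx ⟨h₁, h₂⟩
    -- The coherence hypothesis, taken at two equal arguments, says that the relation is
    -- single-valued.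
    obtain ⟨z, hz, h⟩ := replacement_of_dfn_sat hC A (cons x e) hx h₁ fun w hw s r hs hr =>
      h₂ w w ⟨hw, hw⟩ s r ⟨by
        refine (iff_of_eq (congrArg _ ?_)).1 hs
        funext n
        rcases n with _ | _ | n <;> rfl, by
        refine (iff_of_eq (congrArg _ ?_)).1 hr
        funext n
        rcases n with _ | _ | n <;> rfl, rfl⟩
    refine ⟨z, hz, fun t => (h t).trans (exists_congr fun w => and_congr_right fun _ =>
      iff_of_eq (congrArg _ ?_))⟩
    funext n
    rcases n with _ | _ | n <;> rfl
  | q28 =>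
    simp [sat_cl_iff]
    intro x hx h _
    obtain ⟨u, hu, hu'⟩ := BasicSet.union hx
    -- Nothing has to be chosen: `[v]` is `{v}`, so `u` can be the whole union, and `w = {v}` has
    -- the intersection `{v}` with both `y` and `u`.
    refine ⟨u, hu, fun y v hy hv => ⟨upair v v, isSet_upair v v, by simp, ?_, ?_⟩⟩
    · rw [isOne_iff]
      exact (isCardOf_one_upair v).card_eq
    · refine ⟨upair v v, ⟨isSet_upair v v, fun t => ?_⟩, isSet_upair v v, fun t => ?_⟩ <;>
        simp only [mem_upair, or_self, iff_self_and]
      · exact fun ht => ht ▸ hv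
      · exact fun ht => ht ▸ (hu' v).2 ⟨y, hy, hv⟩

end Interpretation

/-! ## Conservativity of quasi-set theory over ZFU -/

instance : Countable (Σ n, LZ.Functions n) := ⟨fun x => Empty.elim x.2, fun x => Empty.elim x.2⟩

instance : Countable (Σ n, LZ.Relations n) := by
  refine Function.Injective.countable (f := fun x : Σ n, LZ.Relations n => (match x with
    | ⟨_, ZRel.S⟩ => 0
    | ⟨_, ZRel.mem⟩ => 1
    | ⟨_, ZRel.eq⟩ => 2 : ℕ)) ?_
  rintro ⟨_, _ | _ | _⟩ ⟨_, _ | _ | _⟩ <;> simp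

instance : Countable (Σ n, LQ.Functions n) := by
  refine Function.Injective.countable (f := fun _ => (0 : ℕ)) ?_
  rintro ⟨_, _ | _⟩ ⟨_, _ | _⟩
  simp

instance : Countable (Σ n, LQ.Relations n) := by
  refine Function.Injective.countable (f := fun x : Σ n, LQ.Relations n => (match x with
    | ⟨_, QRel.m⟩ => 0
    | ⟨_, QRel.M⟩ => 1
    | ⟨_, QRel.Z⟩ => 2
    | ⟨_, QRel.ind⟩ => 3
    | ⟨_, QRel.mem⟩ => 4 : ℕ)) ?_
  rintro ⟨_, _ | _ | _ | _ | _⟩ ⟨_, _ | _ | _ | _ | _⟩ <;> simp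

/-- Every model of ZFU has a quotient with true equality. -/
theorem exists_quotient_of_models {X : Type} [LZ.Structure X] (hX : Models X ZFU.Ax) :
    ∃ (V : Type) (_ : SetStr V) (π : X → V), Function.Surjective π ∧ Models V ZFU.Ax ∧
      ∀ (A : Fml LZ) (e : ℕ → X), Sat A e ↔ Sat A (fun n => π (e n)) := by
  have hrefl : ∀ x : X, eqv x x := fun x => by
    have := hX _ .eqRefl (fun _ => x) x
    rw [ZFU.eq, sat_rel_two] at this
    exact this
  have hsubst : ∀ (A : Fml LZ) (e : ℕ → X) (x y : X), eqv x y → Sat A (cons x e) →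
      Sat A (cons y e) := fun A e x y h hA => by
    have := hX _ (.eqSubst (A.rename fun n => match n with | 0 => 0 | k + 1 => k + 2)) e x y
    simp only [sat_imp, sat_rename, ZFU.eq, sat_rel_two] at this
    refine (iff_of_eq (congrArg _ ?_)).1 (this h ((iff_of_eq (congrArg _ ?_)).1 hA)) <;>
    · funext n
      cases n <;> rfl
  obtain ⟨V, str, π, hπ, hsat⟩ := exists_quotient hrefl hsubst
  refine ⟨V, str, π, hπ, fun φ hφ e => ?_, hsat⟩
  choose σ hσ using hπ
  have := (hsat φ fun n => σ (e n)).1 (hX φ hφ _)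
  simpa only [hσ] using this

/-- One direction evaluates the translation in the classical part of a model of $\mathcal Q$. In the
other, a model of ZFU is itself read as a model of $\mathcal Q$, where the premises `D` hold
automatically. -/
theorem deriv_iff_deriv_relD {n : ℕ} {A : Fml LZ} (hA : A.FreeBelow n) :
    Deriv ZFU.theory A ↔ Deriv Qset.theory (Qset.relD n (Qset.tr A)) := by
  refine ⟨fun h => deriv_iff.2 fun X _ hX e => ?_, fun h => deriv_iff.2 fun X _ hX e => ?_⟩
  · exact (sat_relD n _ e).2 fun he => sat_tr_of_deriv h hX hA e he
  · obtain ⟨V, _, π, -, hV, hsat⟩ := exists_quotient_of_models hX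
    have : Nonempty V := ⟨π (e 0)⟩
    obtain ⟨_, hI, hC⟩ := basicSet_of_models hV
    have := deriv_iff.1 h V _ (models_qset hI hC) fun n => π (e n)
    exact (hsat A e).2 ((sat_tr A _).1 ((sat_relD n _ _).1 this fun i _ => (qD_iff _).2 trivial))

theorem consistent_zfu_of_consistent_qset (h : Consistent Qset.theory) :
    Consistent ZFU.theory := by
  obtain ⟨X, _, _, hX⟩ := consistent_iff.1 h
  obtain ⟨V, _, π, hπ⟩ := exists_classicalPart hX
  exact consistent_iff.2 ⟨V, _, (hπ.basicSet hX).nonempty, hπ.models hX⟩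

end QST

theorem theorem5 :
    (∀ A : QST.Fml QST.LZ, A.IsSentence →
      (QST.Deriv QST.ZFU.theory A ↔ QST.Deriv QST.Qset.theory (QST.Qset.tr A))) ∧
    (∀ (n : ℕ) (A : QST.Fml QST.LZ), A.FreeBelow n →
      (QST.Deriv QST.ZFU.theory A ↔
        QST.Deriv QST.Qset.theory (QST.Qset.relD n (QST.Qset.tr A)))) ∧
    (QST.Consistent QST.Qset.theory → QST.Consistent QST.ZFU.theory) :=
  ⟨fun _ hA => QST.deriv_iff_deriv_relD (n := 0) hA, fun _ _ hA => QST.deriv_iff_deriv_relD hA,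
    QST.consistent_zfu_of_consistent_qset⟩
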